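/- Let $n\ge 2$ be an integer and $1<b<n$ a real number. Let $\mathcal S$ be the space of complex-valued Schwartz functions on $\mathbb R^n$, write $x=r\omega$ with $r\ge 0$ and $\omega\in S^{n-1}$, and let $L^q_\omega=L^q(S^{n-1})$ with respect to surface measure. Let $\mathrm D^{a}=(-\Delta)^{a/2}$ be the Fourier multiplier with symbol $|\xi|^{a}$ (for the Fourier transform with kernel $e^{-ix\cdot\xi}$), and let $\Lambda_\omega^{s}=(1-\Delta_\omega)^{s/2}$, where $\Delta_\omega=\sum_{1\le i<j\le n}(x_i\partial_j-x_j\partial_i)^2$ is the Laplace–Beltrami operator on $S^{n-1}$; that is, $\Lambda_\omega^s$ acts in the variable $\omega$ and multiplies the component of $f(r\,\cdot)$ in the spherical harmonics of degree $k$ by $(1+k(k+n-2))^{s/2}$. There is a constant $C$ depending only on $n$ and $b$ such that, for every $f\in\mathcal S$, $$\sup_{r>0}\ r^{\frac{n-b}{2}}\,\|f(r\omega)\|_{L^2_\omega}\le C\,\bigl\|\mathrm D^{\frac b2}\Lambda_\omega^{\frac{1-b}{2}}f\bigr\|_{L^2(\mathbb R^n)}$$ and $$\bigl\|\mathrm D^{-\frac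 b2}\Lambda_\omega^{\frac{b-1}{2}}f\bigr\|_{L^2(\mathbb R^n)}\le C\int_0^\infty r^{\frac{b-n}{2}}\,\|f(r\omega)\|_{L^2_\omega}\,r^{n-1}\,dr .$$ Moreover, for every real $s>\frac{n-b}{2}$ there is a constant $C$ depending only on $n$, $b$ and $s$ such that, for every $f\in\mathcal S$, $$\sup_{r>0}\ r^{\frac{n-b}{2}}\,\|f(r\omega)\|_{L^\infty_\omega}\le C\,\bigl\|\mathrm D^{\frac b2}\Lambda_\omega^{s}f\bigr\|_{L^2(\mathbb R^n)} .$$ -/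

import Mathlib

open MeasureTheory Set
open scoped FourierTransform SchwartzMap ENNReal NNReal

noncomputable section

namespace AngularSobolev

/-- Euclidean space `ℝⁿ`. -/
abbrev Eucl (n : ℕ) : Type := EuclideanSpace ℝ (Fin n)

/-- The unit sphere `S^{n-1} ⊆ ℝⁿ`. -/
abbrev Sph (n : ℕ) : Type := Metric.sphere (0 : Eucl n) 1

/-- The surface measure `dω` on `S^{n-1}`. -/
abbrev surf (n : ℕ) : Measure (Sph n) := (volume : Measure (Eucl n)).toSphere

/-! ### Spherical harmonics -/

/-- The Laplacian `∑ ∂ᵢ²` on polynomials. -/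
def polyLaplacian (n : ℕ) : MvPolynomial (Fin n) ℂ →ₗ[ℂ] MvPolynomial (Fin n) ℂ :=
  ∑ i, (MvPolynomial.pderiv i).toLinearMap ∘ₗ (MvPolynomial.pderiv i).toLinearMap

/-- The homogeneous harmonic polynomials of degree `k` in `n` variables. -/
def harmonicPolys (n k : ℕ) : Submodule ℂ (MvPolynomial (Fin n) ℂ) :=
  MvPolynomial.homogeneousSubmodule (Fin n) ℂ k ⊓ LinearMap.ker (polyLaplacian n)

/-- Restriction of a polynomial to the sphere. -/
def restrictPoly (n : ℕ) : MvPolynomial (Fin n) ℂ →ₗ[ℂ] C(Sph n, ℂ) where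
  toFun p :=
    { toFun := fun ω => MvPolynomial.eval (fun i => (((ω : Eucl n) i : ℝ) : ℂ)) p
      continuous_toFun := (MvPolynomial.continuous_eval p).comp (by fun_prop) }
  map_add' p q := by ext; simp
  map_smul' c p := by ext; simp

/-- The space `𝓗_k` of spherical harmonics of degree `k` on `S^{n-1}`. -/
def sphericalHarmonics (n k : ℕ) : Submodule ℂ C(Sph n, ℂ) :=
  (harmonicPolys n k).map (restrictPoly n)

/-- The inclusion of the continuous functions in `L²(S^{n-1})`. -/
def toL2 (n : ℕ) : C(Sph n, ℂ) →ₗ[ℂ] Lp ℂ 2 (surf n) :=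
  (ContinuousMap.toLp (E := ℂ) 2 (surf n) ℂ).toLinearMap

theorem toL2_injective (n : ℕ) : Function.Injective (toL2 n) :=
  ContinuousMap.toLp_injective (surf n)

/-- `𝓗_k` as a subspace of `L²(S^{n-1})`. -/
def sphericalHarmonicsL2 (n k : ℕ) : Submodule ℂ (Lp ℂ 2 (surf n)) :=
  (sphericalHarmonics n k).map (toL2 n)

instance finiteDimensional_harmonicPolys (n k : ℕ) :
    FiniteDimensional ℂ (harmonicPolys n k) := by
  have h : harmonicPolys n k ≤ MvPolynomial.restrictTotalDegree (Fin n) ℂ k := by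
    intro p hp
    rw [MvPolynomial.mem_restrictTotalDegree]
    exact MvPolynomial.IsHomogeneous.totalDegree_le hp.1
  exact Submodule.finiteDimensional_of_le h

instance finiteDimensional_sphericalHarmonicsL2 (n k : ℕ) :
    FiniteDimensional ℂ (sphericalHarmonicsL2 n k) := by
  unfold sphericalHarmonicsL2 sphericalHarmonics
  infer_instance

/-- The `L²(S^{n-1})`-orthogonal projection of `g` onto `𝓗_k`, as a continuous function. -/
def harmonicPart (n k : ℕ) (g : C(Sph n, ℂ)) : C(Sph n, ℂ) :=
  ((Submodule.equivMapOfInjective (toL2 n) (toL2_injective n) (sphericalHarmonics n k)).symm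
    ((sphericalHarmonicsL2 n k).orthogonalProjectionOnto (toL2 n g)) :
      sphericalHarmonics n k)

/-- The rotation field `Ω_{ij} = xᵢ ∂ⱼ - xⱼ ∂ᵢ`, acting on polynomials. -/
def rotField {n : ℕ} (i j : Fin n) (p : MvPolynomial (Fin n) ℂ) : MvPolynomial (Fin n) ℂ :=
  MvPolynomial.X i * MvPolynomial.pderiv j p - MvPolynomial.X j * MvPolynomial.pderiv i p

/-- The Laplace-Beltrami operator `Δ_ω = ∑_{i<j} Ω_{ij}²`, acting on polynomials. -/
def angularLaplacian {n : ℕ} (p : MvPolynomial (Fin n) ℂ) : MvPolynomial (Fin n) ℂ :=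
  ∑ i : Fin n, ∑ j ∈ Finset.Ioi i, rotField i j (rotField i j p)

/-- The eigenvalue `k (k + n - 2)` of `-Δ_ω` on the spherical harmonics of degree `k`. -/
def sphEigenvalue (n k : ℕ) : ℝ := (k : ℝ) * ((k : ℝ) + (n : ℝ) - 2)

theorem sum_lt_add_swap {n : ℕ} {M : Type*} [AddCommGroup M] (G : Fin n → Fin n → M) :
    ∑ i : Fin n, ∑ j ∈ Finset.Ioi i, (G i j + G j i) = ∑ i, ∑ j, G i j - ∑ i, G i i := by
  have h1 : ∀ i : Fin n, ∑ j, G i j =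
      ∑ j ∈ Finset.Ioi i, G i j + G i i + ∑ j ∈ Finset.Iio i, G i j := by
    intro i
    rw [← Finset.sum_filter_add_sum_filter_not Finset.univ (fun j => i ≤ j)]
    congr 1
    · have : Finset.univ.filter (fun j => i ≤ j) = insert i (Finset.Ioi i) := by
        ext j; simp [le_iff_eq_or_lt]
      rw [this, Finset.sum_insert (by simp), add_comm]
    · congr 1
      ext j; simp
  have h2 : ∑ i : Fin n, ∑ j ∈ Finset.Iio i, G i j = ∑ i : Fin n, ∑ j ∈ Finset.Ioi i, G j i :=
    Finset.sum_comm' (by intro x y; simp)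
  simp only [h1, Finset.sum_add_distrib, h2]
  abel

theorem pderiv_comm {n : ℕ} (i j : Fin n) (p : MvPolynomial (Fin n) ℂ) :
    MvPolynomial.pderiv i (MvPolynomial.pderiv j p) =
      MvPolynomial.pderiv j (MvPolynomial.pderiv i p) := by
  have h : ⁅(MvPolynomial.pderiv i : Derivation ℂ (MvPolynomial (Fin n) ℂ) (MvPolynomial (Fin n) ℂ)),
      (MvPolynomial.pderiv j :
        Derivation ℂ (MvPolynomial (Fin n) ℂ) (MvPolynomial (Fin n) ℂ))⁆ = 0 := by
    refine MvPolynomial.derivation_ext (R := ℂ) fun l => ?_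
    simp [Derivation.commutator_apply, MvPolynomial.pderiv_X, Pi.single_apply, apply_ite]
  have := congrArg (fun D : Derivation ℂ (MvPolynomial (Fin n) ℂ) (MvPolynomial (Fin n) ℂ) => D p) h
  simpa [Derivation.commutator_apply, sub_eq_zero] using this

/-- Spherical harmonics of degree `k` are eigenfunctions of `-Δ_ω`, with eigenvalue
`k (k + n - 2)`. -/
theorem angularLaplacian_eq {n k : ℕ} {p : MvPolynomial (Fin n) ℂ} (hp : p ∈ harmonicPolys n k) :
    angularLaplacian p = ((-sphEigenvalue n k : ℝ) : ℂ) • p := by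
  obtain ⟨hk, hΔ⟩ := hp
  have hk : p.IsHomogeneous k := hk
  have hΔ : ∑ j, MvPolynomial.pderiv j (MvPolynomial.pderiv j p) = 0 := by
    simpa [polyLaplacian] using hΔ
  have hE : ∑ i, MvPolynomial.X i * MvPolynomial.pderiv i p = (k : MvPolynomial (Fin n) ℂ) * p := by
    rw [hk.sum_X_mul_pderiv, nsmul_eq_mul]
  have hE2 : ∀ i, ∑ j, MvPolynomial.X j * MvPolynomial.pderiv j (MvPolynomial.pderiv i p) =
      ((k : MvPolynomial (Fin n) ℂ) - 1) * MvPolynomial.pderiv i p := by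
    intro i
    have h := congrArg (MvPolynomial.pderiv i) hE
    simp only [map_sum, Derivation.leibniz, smul_eq_mul, MvPolynomial.pderiv_X,
      Finset.sum_add_distrib, Derivation.map_natCast, mul_zero, add_zero] at h
    have h3 : ∑ j, MvPolynomial.pderiv j p * (Pi.single i 1 : Fin n → MvPolynomial (Fin n) ℂ) j =
        MvPolynomial.pderiv i p := by
      simp [Pi.single_apply]
    have h4 : ∀ j, MvPolynomial.pderiv i (MvPolynomial.pderiv j p) =
        MvPolynomial.pderiv j (MvPolynomial.pderiv i p) := fun j => pderiv_comm i j p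
    simp only [h4] at h
    rw [h3] at h
    linear_combination h
  let G : Fin n → Fin n → MvPolynomial (Fin n) ℂ := fun i j =>
    MvPolynomial.X i ^ 2 * MvPolynomial.pderiv j (MvPolynomial.pderiv j p)
      - MvPolynomial.X i * (MvPolynomial.X j * MvPolynomial.pderiv j (MvPolynomial.pderiv i p))
      - MvPolynomial.X i * MvPolynomial.pderiv i p
  have hF : ∀ i : Fin n, ∀ j ∈ Finset.Ioi i, rotField i j (rotField i j p) = G i j + G j i := by
    intro i j hj
    have hij : i ≠ j := (Finset.mem_Ioi.1 hj).ne
    simp only [rotField, G, map_sub, MvPolynomial.pderiv_mul, MvPolynomial.pderiv_X_self,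
      MvPolynomial.pderiv_X_of_ne hij, MvPolynomial.pderiv_X_of_ne hij.symm]
    rw [pderiv_comm i j p]
    ring
  have hG1 : ∀ i, G i i = -(MvPolynomial.X i * MvPolynomial.pderiv i p) := by
    intro i
    simp only [G]
    ring
  have hG2 : ∀ i, ∑ j, G i j = -(((k : MvPolynomial (Fin n) ℂ) - 1 + (n : MvPolynomial (Fin n) ℂ)) *
      (MvPolynomial.X i * MvPolynomial.pderiv i p)) := by
    intro i
    simp only [G, Finset.sum_sub_distrib, ← Finset.mul_sum, hΔ, hE2, Finset.sum_const,
      Finset.card_univ, Fintype.card_fin, nsmul_eq_mul]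
    ring
  have hc : (((-sphEigenvalue n k : ℝ) : ℂ)) • p =
      (-((k : MvPolynomial (Fin n) ℂ) * (k + (n : MvPolynomial (Fin n) ℂ) - 2))) * p := by
    have h2 : (MvPolynomial.C (2 : ℂ) : MvPolynomial (Fin n) ℂ) = 2 := map_ofNat _ 2
    rw [MvPolynomial.smul_eq_C_mul]
    simp [sphEigenvalue, h2]
  rw [hc, angularLaplacian, Finset.sum_congr rfl fun i _ => Finset.sum_congr rfl (hF i),
    sum_lt_add_swap]
  simp only [hG1, hG2, Finset.sum_neg_distrib, ← Finset.mul_sum, hE]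
  ring

/-! ### The angular operator and the fractional Laplacian -/

/-- The restriction `ω ↦ f (r ω)` of a Schwartz function to the sphere of radius `r`. -/
def restrictSphere {n : ℕ} (f : 𝓢(Eucl n, ℂ)) (r : ℝ) : C(Sph n, ℂ) where
  toFun ω := f (r • (ω : Eucl n))
  continuous_toFun := f.continuous.comp (by fun_prop)

/-- The operator `Λ_ω^s = (1 - Δ_ω)^{s/2}`, acting on Schwartz functions in the angular variable
by the expansion in spherical harmonics. The value at the origin, where `f` restricts to a constant,
is `f 0`. -/
def angularPow {n : ℕ} (s : ℝ) (f : 𝓢(Eucl n, ℂ)) (x : Eucl n) : ℂ :=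
  if hx : x = 0 then f 0
  else ∑' k : ℕ, (((1 + sphEigenvalue n k) ^ (s / 2) : ℝ) : ℂ) *
    harmonicPart n k (restrictSphere f ‖x‖) ⟨‖x‖⁻¹ • x, by simp [norm_smul, hx]⟩

/-- The operator `D^a = (-Δ)^{a/2}`: the Fourier multiplier with symbol `|2πξ|^a`, for the Fourier
transform `ĝ(ξ) = ∫ g(x) exp(-2πi x·ξ) dx`. -/
def fracD {n : ℕ} (a : ℝ) (g : Eucl n → ℂ) : Eucl n → ℂ :=
  𝓕⁻ (fun ξ : Eucl n => (((2 * Real.pi * ‖ξ‖) ^ a : ℝ) : ℂ) * 𝓕 g ξ)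

/-- The norm of `ω ↦ g (r ω)` in `L^q(S^{n-1})`. -/
def sphereNorm {n : ℕ} (q : ℝ≥0∞) (g : Eucl n → ℂ) (r : ℝ) : ℝ≥0∞ :=
  eLpNorm (fun ω : Sph n => g (r • (ω : Eucl n))) q (surf n)

/-- The norm of `g` in `L¹_{|x|^{n-1} d|x|} L²_ω`. -/
def mixedNorm {n : ℕ} (g : Eucl n → ℂ) : ℝ≥0∞ :=
  ∫⁻ r in Ioi (0 : ℝ), sphereNorm 2 g r * ENNReal.ofReal (r ^ (n - 1))

end AngularSobolev

end

open MeasureTheory Set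
open scoped FourierTransform SchwartzMap ENNReal NNReal

set_option linter.unusedSectionVars false

noncomputable section

namespace AngularSobolev

/-! ### Polar coordinates -/

section Polar

variable {n : ℕ} [Fact (2 ≤ n)]

/-! Everything rests on a Fourier restriction estimate in one fixed degree. If Y is a spherical
harmonic of degree k and `sphFourier Y` is the Fourier transform of the measure Y dω, then ∫
|ξ|^{-b} |`sphFourier Y`|² dξ ≤ C (k+1)^{1-b} ‖Y‖² (`exists_lintegral_sphFourier_le`). For |ξ| below
a small multiple of k+1, the harmonic Y is orthogonal to the Taylor terms of the plane wave of
degree less than k, so the transform is O(2^{-k}), and b < n makes the weight integrable at the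
origin. For larger |ξ|, the Agmon–Hörmander bound ∫_{|ξ|≤R} |`sphFourier g`|² ≤ C R ‖g‖² (in
Gaussian form, `integral_gaussian_sphFourier_le`) is summed over dyadic shells. The sum converges
because b > 1 and is dominated by |ξ| ~ k+1, whence the exponent 1-b.

The degrees decouple. Restricted to any sphere around the origin, `sphFourier Y` is again a harmonic
of degree k (`sphFourierOn_mem`), so angular multipliers commute with the Fourier transform
(`PolyGrowth.fourier_onSphere`). By Plancherel, together with Parseval on each sphere, ‖D^a Λ_ω^s
f‖² is up to a power of 2π the sum over k of (1+k(k+n-2))^s times the energy with weight |ξ|^{2a} of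
the degree-k part of the transform of f (`eLpNorm_fracD_angularPow_sq`).

For the first inequality the degree-k part of f on the sphere of radius r is paired with itself. On
the frequency side, Cauchy–Schwarz with weights |ξ|^{b} and |ξ|^{-b}, the restriction estimate and
scaling give the factor (k+1)^{1-b} r^{b-n}, and 1+k(k+n-2) is comparable to (k+1)². The second
inequality is the dual statement, proved by the same estimate. For the third, the sup norm of a
harmonic of degree k is at most a constant times (k+1)^{(n-2)/2} times its L² norm
(`norm_sq_apply_le`), and Cauchy–Schwarz over k converges exactly when s > (n-b)/2. -/

instance nontrivial_eucl : Nontrivial (Eucl n) := by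
  have h : 2 ≤ n := Fact.out
  have : Nonempty (Fin n) := ⟨⟨0, by omega⟩⟩
  infer_instance

theorem lintegral_polar {f : Eucl n → ℝ≥0∞} (hf : Measurable f) :
    ∫⁻ x, f x =
      ∫⁻ r in Ioi (0 : ℝ), ENNReal.ofReal (r ^ (n - 1)) * ∫⁻ ω, f (r • (ω : Eucl n)) ∂surf n := by
  have hm := (volume : Measure (Eucl n)).measurePreserving_homeomorphUnitSphereProd
  have hc : Continuous fun q : Sph n × Ioi (0 : ℝ) => (q.2 : ℝ) • (q.1 : Eucl n) := by fun_prop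
  have hF : Measurable fun q : Sph n × Ioi (0 : ℝ) => f ((q.2 : ℝ) • (q.1 : Eucl n)) :=
    hf.comp hc.measurable
  calc ∫⁻ x, f x = ∫⁻ x : ({(0)}ᶜ : Set (Eucl n)), f x ∂((volume : Measure (Eucl n)).comap (↑)) := by
        rw [lintegral_subtype_comap (measurableSet_singleton _).compl, restrict_compl_singleton]
    _ = ∫⁻ q : Sph n × Ioi (0 : ℝ), f ((q.2 : ℝ) • (q.1 : Eucl n))
          ∂((surf n).prod (.volumeIoiPow (Module.finrank ℝ (Eucl n) - 1))) := by
        rw [← hm.lintegral_comp hF]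
        refine lintegral_congr fun x => ?_
        congr 1
        have : (x : Eucl n) ≠ 0 := x.2
        simp [smul_smul, this]
    _ = ∫⁻ r : Ioi (0 : ℝ), ∫⁻ ω, f ((r : ℝ) • (ω : Eucl n)) ∂surf n
          ∂(Measure.volumeIoiPow (Module.finrank ℝ (Eucl n) - 1)) :=
        lintegral_prod_symm _ hF.aemeasurable
    _ = _ := by
        rw [finrank_euclideanSpace_fin, Measure.volumeIoiPow, lintegral_withDensity_eq_lintegral_mul]
        · simp only [Pi.mul_apply]
          rw [lintegral_subtype_comap measurableSet_Ioi
            (fun r : ℝ => ENNReal.ofReal (r ^ (n - 1)) * ∫⁻ ω, f (r • (ω : Eucl n)) ∂surf n)]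
        · fun_prop
        · exact hF.lintegral_prod_left'

theorem integral_polar {E : Type*} [NormedAddCommGroup E] [NormedSpace ℝ E] {f : Eucl n → E}
    (hf : Integrable f) :
    ∫ x, f x = ∫ r in Ioi (0 : ℝ), r ^ (n - 1) • ∫ ω, f (r • (ω : Eucl n)) ∂surf n := by
  have hm := (volume : Measure (Eucl n)).measurePreserving_homeomorphUnitSphereProd
  have he := (homeomorphUnitSphereProd (Eucl n)).measurableEmbedding
  set F : Sph n × Ioi (0 : ℝ) → E := fun q => f ((q.2 : ℝ) • (q.1 : Eucl n)) with hF
  have hcomp : F ∘ homeomorphUnitSphereProd (Eucl n) = fun x : ({(0)}ᶜ : Set (Eucl n)) => f x := by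
    ext x
    have : (x : Eucl n) ≠ 0 := x.2
    simp [hF, smul_smul, this]
  have hFi : Integrable F
      ((surf n).prod (.volumeIoiPow (Module.finrank ℝ (Eucl n) - 1))) := by
    rw [← hm.integrable_comp_emb he, hcomp]
    have := hf.integrableOn (s := {(0 : Eucl n)}ᶜ)
    rwa [integrableOn_iff_comap_subtypeVal (measurableSet_singleton _).compl] at this
  calc ∫ x, f x = ∫ x : ({(0)}ᶜ : Set (Eucl n)), f x ∂((volume : Measure (Eucl n)).comap (↑)) := by
        rw [integral_subtype_comap (measurableSet_singleton _).compl, restrict_compl_singleton]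
    _ = ∫ q, F q ∂((surf n).prod (.volumeIoiPow (Module.finrank ℝ (Eucl n) - 1))) := by
        rw [← hm.integral_comp he]
        exact integral_congr_ae (Filter.Eventually.of_forall fun x => (congrFun hcomp x).symm)
    _ = ∫ r : Ioi (0 : ℝ), ∫ ω, f ((r : ℝ) • (ω : Eucl n)) ∂surf n
          ∂(Measure.volumeIoiPow (Module.finrank ℝ (Eucl n) - 1)) :=
        integral_prod_symm _ hFi
    _ = _ := by
        rw [finrank_euclideanSpace_fin]
        simp only [Measure.volumeIoiPow, ENNReal.ofReal]
        rw [integral_withDensity_eq_integral_smul,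
          integral_subtype_comap measurableSet_Ioi
            (fun r : ℝ => Real.toNNReal (r ^ (n - 1)) • ∫ ω, f (r • (ω : Eucl n)) ∂surf n)]
        · refine setIntegral_congr_fun measurableSet_Ioi fun r hr => ?_
          rw [NNReal.smul_def, Real.coe_toNNReal _ (pow_nonneg (le_of_lt hr) _)]
        · exact (measurable_subtype_coe.pow_const _).real_toNNReal

end Polar

/-! ### Polynomials as functions -/

/-- The value of a complex polynomial at a real point. -/
def polyVal {n : ℕ} (p : MvPolynomial (Fin n) ℂ) (x : Eucl n) : ℂ :=
  MvPolynomial.eval (fun i => ((x i : ℝ) : ℂ)) p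

section PolyVal

variable {n : ℕ}

@[simp] theorem restrictPoly_apply (p : MvPolynomial (Fin n) ℂ) (ω : Sph n) :
    restrictPoly n p ω = polyVal p (ω : Eucl n) := rfl

@[simp] theorem polyVal_add (p q : MvPolynomial (Fin n) ℂ) (x : Eucl n) :
    polyVal (p + q) x = polyVal p x + polyVal q x := by simp [polyVal]

@[simp] theorem polyVal_sub (p q : MvPolynomial (Fin n) ℂ) (x : Eucl n) :
    polyVal (p - q) x = polyVal p x - polyVal q x := by simp [polyVal]

@[simp] theorem polyVal_mul (p q : MvPolynomial (Fin n) ℂ) (x : Eucl n) :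
    polyVal (p * q) x = polyVal p x * polyVal q x := by simp [polyVal]

@[simp] theorem polyVal_pow (p : MvPolynomial (Fin n) ℂ) (m : ℕ) (x : Eucl n) :
    polyVal (p ^ m) x = polyVal p x ^ m := by simp [polyVal]

@[simp] theorem polyVal_X (i : Fin n) (x : Eucl n) :
    polyVal (MvPolynomial.X i) x = ((x i : ℝ) : ℂ) := by simp [polyVal]

@[simp] theorem polyVal_C (c : ℂ) (x : Eucl n) : polyVal (MvPolynomial.C c) x = c := by
  simp [polyVal]

@[simp] theorem polyVal_smul (c : ℂ) (p : MvPolynomial (Fin n) ℂ) (x : Eucl n) :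
    polyVal (c • p) x = c * polyVal p x := by simp [polyVal]

@[simp] theorem polyVal_sum {ι : Type*} (s : Finset ι) (p : ι → MvPolynomial (Fin n) ℂ)
    (x : Eucl n) : polyVal (∑ i ∈ s, p i) x = ∑ i ∈ s, polyVal (p i) x := by simp [polyVal]

@[fun_prop] theorem continuous_polyVal (p : MvPolynomial (Fin n) ℂ) : Continuous (polyVal p) :=
  (MvPolynomial.continuous_eval p).comp (by fun_prop)

theorem polyVal_smul_arg {p : MvPolynomial (Fin n) ℂ} {d : ℕ} (hp : p.IsHomogeneous d) (r : ℝ)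
    (x : Eucl n) : polyVal p (r • x) = (r : ℂ) ^ d * polyVal p x := by
  simp only [polyVal, MvPolynomial.eval_eq', Finset.mul_sum]
  refine Finset.sum_congr rfl fun a ha => ?_
  have hd : ∑ i, a i = d := by
    have := hp (MvPolynomial.mem_support_iff.1 ha)
    simpa [Finsupp.weight_apply, Finsupp.sum_fintype] using this
  simp only [PiLp.smul_apply, smul_eq_mul, Complex.ofReal_mul, mul_pow, Finset.prod_mul_distrib,
    Finset.prod_pow_eq_pow_sum]
  simp [← hd]
  ring

theorem hasLineDerivAt_polyVal (p : MvPolynomial (Fin n) ℂ) (x : Eucl n) (j : Fin n) :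
    HasLineDerivAt ℝ (polyVal p) (polyVal (MvPolynomial.pderiv j p) x) x
      (EuclideanSpace.single j 1) := by
  unfold HasLineDerivAt
  induction p using MvPolynomial.induction_on with
  | C a => simpa [polyVal] using hasDerivAt_const (0 : ℝ) a
  | add p q hp hq =>
    simp only [polyVal_add, map_add]
    exact hp.add hq
  | mul_X p i hp =>
    have h : HasDerivAt (fun t : ℝ => (((x + t • EuclideanSpace.single j (1 : ℝ)) i : ℝ) : ℂ))
        (((Pi.single j 1 : Fin n → ℝ) i : ℝ) : ℂ) 0 := by
      refine HasDerivAt.ofReal_comp ?_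
      have := ((hasDerivAt_id (0 : ℝ)).mul_const ((Pi.single j 1 : Fin n → ℝ) i)).const_add (x i)
      simpa [Pi.single_apply] using this
    have := hp.mul h
    simp only [zero_smul, add_zero] at this
    simp only [polyVal_mul, polyVal_X, MvPolynomial.pderiv_mul, polyVal_add]
    convert! this using 2
    by_cases hij : i = j
    · subst hij; simp [polyVal]
    · simp [MvPolynomial.pderiv_X_of_ne hij, hij, polyVal]

end PolyVal

/-! ### Integration by parts for rotation fields on the sphere -/

section Rotation

variable {n : ℕ}

theorem isHomogeneous_rotField {p : MvPolynomial (Fin n) ℂ} {d : ℕ} (hp : p.IsHomogeneous d)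
    (i j : Fin n) : (rotField i j p).IsHomogeneous d := by
  have h : ∀ a b : Fin n, (MvPolynomial.X a * MvPolynomial.pderiv b p).IsHomogeneous d := by
    intro a b
    -- In degree 0 the truncated d - 1 would make the product look linear; it vanishes because the
    -- polynomial is constant.
    rcases Nat.eq_zero_or_pos d with rfl | hd
    · rw [MvPolynomial.totalDegree_eq_zero_iff_eq_C.1 (Nat.le_zero.1 hp.totalDegree_le)]
      simpa using MvPolynomial.isHomogeneous_zero _ _ _
    · have := (MvPolynomial.isHomogeneous_X ℂ a).mul (hp.pderiv (i := b))
      rwa [Nat.add_sub_cancel' hd] at this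
  exact (h i j).sub (h j i)

theorem rotField_mul (i j : Fin n) (p q : MvPolynomial (Fin n) ℂ) :
    rotField i j (p * q) = rotField i j p * q + p * rotField i j q := by
  simp only [rotField, MvPolynomial.pderiv_mul]; ring

theorem rotField_sum {ι : Type*} (s : Finset ι) (i j : Fin n) (p : ι → MvPolynomial (Fin n) ℂ) :
    rotField i j (∑ a ∈ s, p a) = ∑ a ∈ s, rotField i j (p a) := by
  simp only [rotField, map_sum, Finset.mul_sum, Finset.sum_sub_distrib]

/-- Rotation fields are divergence free; this divergence form is what gets integrated by parts. -/
theorem pderiv_X_mul_sub (i j : Fin n) (p : MvPolynomial (Fin n) ℂ) :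
    MvPolynomial.pderiv j (MvPolynomial.X i * p) - MvPolynomial.pderiv i (MvPolynomial.X j * p) =
      rotField i j p := by
  simp only [rotField, MvPolynomial.pderiv_mul, MvPolynomial.pderiv_X, Pi.single_apply]
  by_cases h : i = j
  · subst h; ring
  · simp [h, Ne.symm h]

theorem hasLineDerivAt_normSq {ψ : ℝ → ℝ} (hψ : Differentiable ℝ ψ) (x : Eucl n) (j : Fin n) :
    HasLineDerivAt ℝ (fun x : Eucl n => ((ψ (‖x‖ ^ 2) : ℝ) : ℂ))
      ((deriv ψ (‖x‖ ^ 2) * (2 * x j) : ℝ) : ℂ) x (EuclideanSpace.single j 1) := by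
  have h1 : HasFDerivAt (fun x : Eucl n => ‖x‖ ^ 2) (2 • innerSL ℝ x) x := by
    simpa using (hasStrictFDerivAt_norm_sq x).hasFDerivAt
  have h2 := (hψ (‖x‖ ^ 2)).hasDerivAt.comp_hasFDerivAt x h1
  have h3 := h2.hasLineDerivAt (EuclideanSpace.single j 1)
  have h4 := HasDerivAt.ofReal_comp h3
  have : (deriv ψ (‖x‖ ^ 2) • (2 • innerSL ℝ x)) (EuclideanSpace.single j 1) =
      deriv ψ (‖x‖ ^ 2) * (2 * x j) := by
    simp [EuclideanSpace.inner_single_right]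
  rw [this] at h4
  exact h4

variable [Fact (2 ≤ n)]

/-- Integrating by parts moves the derivatives onto the radial weight. The two resulting terms
2ψ'(|x|²) xᵢ xⱼ p are equal and cancel: a rotation field annihilates radial functions. -/
theorem integral_normSq_mul_rotField {ψ : ℝ → ℝ} (hψ : ContDiff ℝ 1 ψ)
    (hs : tsupport ψ ⊆ Metric.closedBall 1 (1 / 2)) (i j : Fin n) (p : MvPolynomial (Fin n) ℂ) :
    ∫ x : Eucl n, ((ψ (‖x‖ ^ 2) : ℝ) : ℂ) * polyVal (rotField i j p) x = 0 := by
  have hout : ∀ x : Eucl n, x ∉ Metric.closedBall (0 : Eucl n) 2 → ‖x‖ ^ 2 ∉ tsupport ψ := by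
    intro x hx h
    have := hs h
    simp only [Metric.mem_closedBall, dist_zero_right, not_le, Real.dist_eq, abs_le] at hx this
    nlinarith
  have hψc : Continuous (deriv ψ) := hψ.continuous_deriv le_rfl
  have hint : ∀ q : MvPolynomial (Fin n) ℂ,
      Integrable fun x : Eucl n => ((ψ (‖x‖ ^ 2) : ℝ) : ℂ) * polyVal q x := by
    intro q
    have hc := hψ.continuous
    refine Continuous.integrable_of_hasCompactSupport (by fun_prop)
      (HasCompactSupport.intro (isCompact_closedBall (0 : Eucl n) 2) fun x hx => ?_)
    rw [image_eq_zero_of_notMem_tsupport (hout x hx)]; simp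
  have hint' : ∀ (j : Fin n) (q : MvPolynomial (Fin n) ℂ),
      Integrable fun x : Eucl n => ((deriv ψ (‖x‖ ^ 2) * (2 * x j) : ℝ) : ℂ) * polyVal q x := by
    intro j q
    refine Continuous.integrable_of_hasCompactSupport (by fun_prop)
      (HasCompactSupport.intro (isCompact_closedBall (0 : Eucl n) 2) fun x hx => ?_)
    have : deriv ψ (‖x‖ ^ 2) = 0 := by
      by_contra h
      exact hout x hx (support_deriv_subset h)
    rw [this]; simp
  have key : ∀ i j : Fin n, ∫ x : Eucl n, ((ψ (‖x‖ ^ 2) : ℝ) : ℂ) *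
      polyVal (MvPolynomial.pderiv j (MvPolynomial.X i * p)) x =
      - ∫ x : Eucl n, ((deriv ψ (‖x‖ ^ 2) * (2 * x j) : ℝ) : ℂ) *
        polyVal (MvPolynomial.X i * p) x := by
    intro i j
    exact integral_bilinear_hasLineDerivAt_right_eq_neg_left_of_integrable
      (B := ContinuousLinearMap.mul ℝ ℂ) (v := EuclideanSpace.single j 1)
      (hint' _ _) (hint _) (hint _)
      (fun x _ => hasLineDerivAt_normSq (hψ.differentiable one_ne_zero) x j)
      (fun x _ => hasLineDerivAt_polyVal _ x j)
  have hsub : ∀ x : Eucl n, ((ψ (‖x‖ ^ 2) : ℝ) : ℂ) * polyVal (rotField i j p) x =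
      ((ψ (‖x‖ ^ 2) : ℝ) : ℂ) * polyVal (MvPolynomial.pderiv j (MvPolynomial.X i * p)) x -
      ((ψ (‖x‖ ^ 2) : ℝ) : ℂ) * polyVal (MvPolynomial.pderiv i (MvPolynomial.X j * p)) x := by
    intro x
    rw [← pderiv_X_mul_sub, polyVal_sub]; ring
  simp only [hsub]
  rw [integral_sub (hint _) (hint _), key, key, sub_eq_zero]
  congr 1
  refine integral_congr_ae (Filter.Eventually.of_forall fun x => ?_)
  simp only [polyVal_mul, polyVal_X]
  push_cast
  ring

/-- In polar coordinates the vanishing integral over ℝⁿ is a radial integral times the integral over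
the sphere. A bump in r² around 1 makes the radial factor positive. -/
theorem integral_rotField_of_isHomogeneous {p : MvPolynomial (Fin n) ℂ} {d : ℕ}
    (hp : p.IsHomogeneous d) (i j : Fin n) :
    ∫ ω : Sph n, polyVal (rotField i j p) ω ∂surf n = 0 := by
  let ψ : ContDiffBump (1 : ℝ) := ⟨1 / 4, 1 / 2, by norm_num, by norm_num⟩
  have hc : Continuous ψ := ψ.continuous
  have hi : Integrable fun x : Eucl n => ((ψ (‖x‖ ^ 2) : ℝ) : ℂ) * polyVal (rotField i j p) x := by
    refine Continuous.integrable_of_hasCompactSupport (by fun_prop)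
      (HasCompactSupport.intro (isCompact_closedBall (0 : Eucl n) 2) fun x hx => ?_)
    rw [ψ.zero_of_le_dist]; · simp
    simp only [Metric.mem_closedBall, dist_zero_right, not_le, Real.dist_eq] at hx ⊢
    refine le_trans ?_ (le_abs_self _)
    show (1 / 2 : ℝ) ≤ _
    nlinarith
  have h0 := integral_normSq_mul_rotField ψ.contDiff (ψ.tsupport_eq.le) i j p
  rw [integral_polar hi] at h0
  have h1 : ∀ r ∈ Ioi (0 : ℝ), (r ^ (n - 1) • ∫ ω : Sph n,
      ((ψ (‖r • (ω : Eucl n)‖ ^ 2) : ℝ) : ℂ) * polyVal (rotField i j p) (r • (ω : Eucl n)) ∂surf n) =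
      ((r ^ (n - 1) * ψ (r ^ 2) * r ^ d : ℝ) : ℂ) *
        ∫ ω : Sph n, polyVal (rotField i j p) ω ∂surf n := by
    intro r hr
    simp only [polyVal_smul_arg (isHomogeneous_rotField hp i j), norm_smul, norm_eq_of_mem_sphere,
      mul_one, Real.norm_eq_abs, sq_abs]
    rw [integral_const_mul, integral_const_mul, Complex.real_smul]
    push_cast; ring
  rw [setIntegral_congr_fun measurableSet_Ioi h1, integral_mul_const] at h0
  refine (mul_eq_zero.1 h0).resolve_left ?_
  rw [integral_complex_ofReal]
  refine Complex.ofReal_ne_zero.2 (ne_of_gt ?_)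
  have hint : Integrable fun r : ℝ => r ^ (n - 1) * ψ (r ^ 2) * r ^ d := by
    refine Continuous.integrable_of_hasCompactSupport (by fun_prop)
      (HasCompactSupport.intro (isCompact_closedBall (0 : ℝ) 2) fun x hx => ?_)
    rw [ψ.zero_of_le_dist]; · simp
    simp only [Metric.mem_closedBall, dist_zero_right, not_le, Real.dist_eq] at hx ⊢
    refine le_trans ?_ (le_abs_self _)
    rw [Real.norm_eq_abs] at hx
    show (1 / 2 : ℝ) ≤ _
    nlinarith [sq_abs x]
  have hnn : ∀ r ∈ Ioi (0 : ℝ), 0 ≤ r ^ (n - 1) * ψ (r ^ 2) * r ^ d := fun r hr => by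
    have : (0 : ℝ) < r := hr
    have := ψ.nonneg (x := r ^ 2)
    positivity
  rw [setIntegral_pos_iff_support_of_nonneg_ae
    ((ae_restrict_mem measurableSet_Ioi).mono hnn) hint.integrableOn]
  -- Here r² lies in (1, 1.21), inside the ball of radius 1/2 about 1 where the bump is positive.
  refine lt_of_lt_of_le ?_ (measure_mono (s := Ioo (1 : ℝ) (11 / 10)) ?_)
  · simp; norm_num
  · intro r hr
    refine ⟨?_, lt_trans one_pos hr.1⟩
    have h : (0 : ℝ) < r := lt_trans one_pos hr.1
    have : 0 < ψ (r ^ 2) := by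
      refine ψ.pos_of_mem_ball ?_
      rw [Metric.mem_ball, Real.dist_eq, abs_lt]
      show -(1 / 2 : ℝ) < _ ∧ _ < (1 / 2 : ℝ)
      constructor <;> nlinarith [hr.1, hr.2]
    rw [Function.mem_support]
    positivity

theorem integrable_sphere {E : Type*} [NormedAddCommGroup E] {f : Sph n → E} (hf : Continuous f) :
    Integrable f (surf n) :=
  hf.integrable_of_hasCompactSupport (HasCompactSupport.of_compactSpace f)

theorem integral_rotField (p : MvPolynomial (Fin n) ℂ) (i j : Fin n) :
    ∫ ω : Sph n, polyVal (rotField i j p) ω ∂surf n = 0 := by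
  rw [← MvPolynomial.sum_homogeneousComponent p, rotField_sum]
  simp only [polyVal_sum]
  rw [integral_finsetSum _ fun d _ => integrable_sphere (by fun_prop)]
  exact Finset.sum_eq_zero fun d _ =>
    integral_rotField_of_isHomogeneous (MvPolynomial.homogeneousComponent_isHomogeneous d p) i j

/-- A derivation with mean zero on the sphere is skew for the bilinear pairing. No conjugation
enters; it is added later through `polyConj`. -/
theorem integral_rotField_mul (p q : MvPolynomial (Fin n) ℂ) (i j : Fin n) :
    ∫ ω : Sph n, polyVal (rotField i j p) ω * polyVal q ω ∂surf n =
      -∫ ω : Sph n, polyVal p ω * polyVal (rotField i j q) ω ∂surf n := by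
  have h := integral_rotField (p * q) i j
  simp only [rotField_mul, polyVal_add, polyVal_mul] at h
  rw [integral_add (integrable_sphere (by fun_prop)) (integrable_sphere (by fun_prop))] at h
  exact eq_neg_of_add_eq_zero_left h

theorem integral_angularLaplacian_mul (p q : MvPolynomial (Fin n) ℂ) :
    ∫ ω : Sph n, polyVal (angularLaplacian p) ω * polyVal q ω ∂surf n =
      -∑ i : Fin n, ∑ j ∈ Finset.Ioi i,
        ∫ ω : Sph n, polyVal (rotField i j p) ω * polyVal (rotField i j q) ω ∂surf n := by
  simp only [angularLaplacian, polyVal_sum, Finset.sum_mul]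
  rw [integral_finsetSum _ fun d _ => integrable_sphere (by fun_prop), ← Finset.sum_neg_distrib]
  refine Finset.sum_congr rfl fun i _ => ?_
  rw [integral_finsetSum _ fun d _ => integrable_sphere (by fun_prop), ← Finset.sum_neg_distrib]
  exact Finset.sum_congr rfl fun j _ => integral_rotField_mul _ _ i j

theorem integral_angularLaplacian_mul_comm (p q : MvPolynomial (Fin n) ℂ) :
    ∫ ω : Sph n, polyVal (angularLaplacian p) ω * polyVal q ω ∂surf n =
      ∫ ω : Sph n, polyVal p ω * polyVal (angularLaplacian q) ω ∂surf n := by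
  rw [integral_angularLaplacian_mul]
  simp_rw [mul_comm (polyVal p _), integral_angularLaplacian_mul, mul_comm]

end Rotation

/-! ### Harmonic polynomials: stability, decomposition of polynomials, orthogonality -/

section Harmonics

variable {n : ℕ}

/-- Complex conjugation of the coefficients of a polynomial. -/
def polyConj (p : MvPolynomial (Fin n) ℂ) : MvPolynomial (Fin n) ℂ :=
  MvPolynomial.map (starRingEnd ℂ) p

@[simp] theorem polyVal_polyConj (p : MvPolynomial (Fin n) ℂ) (x : Eucl n) :
    polyVal (polyConj p) x = starRingEnd ℂ (polyVal p x) := by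
  have := MvPolynomial.eval₂_comp_left (starRingEnd ℂ) (RingHom.id ℂ)
    (fun i => ((x i : ℝ) : ℂ)) p
  simp only [polyVal, polyConj, MvPolynomial.eval_map]
  rw [← MvPolynomial.eval₂_id, this]
  congr 1
  ext i; simp

theorem pderiv_polyConj (i : Fin n) (p : MvPolynomial (Fin n) ℂ) :
    MvPolynomial.pderiv i (polyConj p) = polyConj (MvPolynomial.pderiv i p) :=
  MvPolynomial.pderiv_map

theorem rotField_polyConj (i j : Fin n) (p : MvPolynomial (Fin n) ℂ) :
    rotField i j (polyConj p) = polyConj (rotField i j p) := by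
  simp only [rotField, pderiv_polyConj]
  simp [polyConj]

theorem mem_harmonicPolys {k : ℕ} {p : MvPolynomial (Fin n) ℂ} :
    p ∈ harmonicPolys n k ↔
      p.IsHomogeneous k ∧ ∑ j, MvPolynomial.pderiv j (MvPolynomial.pderiv j p) = 0 := by
  simp [harmonicPolys, polyLaplacian, MvPolynomial.mem_homogeneousSubmodule]

theorem polyConj_mem {k : ℕ} {p : MvPolynomial (Fin n) ℂ} (hp : p ∈ harmonicPolys n k) :
    polyConj p ∈ harmonicPolys n k := by
  rw [mem_harmonicPolys] at hp ⊢
  refine ⟨hp.1.map _, ?_⟩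
  simp only [pderiv_polyConj]
  have := congrArg polyConj hp.2
  simpa [polyConj] using this

/-- The Laplacian of X_a ∂_b p is 2 ∂_a ∂_b p plus X_a ∂_b Δp. The first term is symmetric in a and
b, so it drops out of the rotation field. -/
theorem rotField_mem {k : ℕ} {p : MvPolynomial (Fin n) ℂ} (hp : p ∈ harmonicPolys n k)
    (i j : Fin n) : rotField i j p ∈ harmonicPolys n k := by
  rw [mem_harmonicPolys] at hp ⊢
  refine ⟨isHomogeneous_rotField hp.1 i j, ?_⟩
  have key : ∀ a b : Fin n, ∑ l, MvPolynomial.pderiv l (MvPolynomial.pderiv l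
      (MvPolynomial.X a * MvPolynomial.pderiv b p)) =
        2 * MvPolynomial.pderiv a (MvPolynomial.pderiv b p) := by
    intro a b
    have h1 : ∀ l, MvPolynomial.pderiv l (MvPolynomial.pderiv l
        (MvPolynomial.X a * MvPolynomial.pderiv b p)) =
          2 * ((Pi.single a 1 : Fin n → MvPolynomial (Fin n) ℂ) l *
            MvPolynomial.pderiv l (MvPolynomial.pderiv b p)) +
          MvPolynomial.X a * MvPolynomial.pderiv b (MvPolynomial.pderiv l
            (MvPolynomial.pderiv l p)) := by
      intro l
      rw [pderiv_comm b l, pderiv_comm b l]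
      simp only [MvPolynomial.pderiv_mul, map_add, MvPolynomial.pderiv_X, Pi.single_apply]
      split_ifs with h1 h2 h2
      · simp; ring
      · exact absurd h1.symm h2
      · exact absurd h2.symm h1
      · simp
    simp only [h1, Finset.sum_add_distrib, ← Finset.mul_sum, ← map_sum, hp.2]
    simp [Pi.single_apply]
  simp only [rotField, map_sub, Finset.sum_sub_distrib, key, pderiv_comm i j, sub_self]

theorem star_mem_sphericalHarmonics {k : ℕ} {Y : C(Sph n, ℂ)} (hY : Y ∈ sphericalHarmonics n k) :
    star Y ∈ sphericalHarmonics n k := by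
  obtain ⟨p, hp, rfl⟩ := hY
  exact ⟨polyConj p, polyConj_mem hp, by ext ω; simp⟩

/-- Subtracting c |x|² ∂ᵢp from xᵢ p leaves a harmonic polynomial of degree k+1, and on the sphere
the subtracted term is c ∂ᵢp, which is harmonic of degree k-1. -/
theorem restrictPoly_X_mul_mem {k : ℕ} {p : MvPolynomial (Fin n) ℂ} (hp : p ∈ harmonicPolys n k)
    [Fact (2 ≤ n)] (i : Fin n) :
    restrictPoly n (MvPolynomial.X i * p) ∈
      sphericalHarmonics n (k + 1) ⊔ sphericalHarmonics n (k - 1) := by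
  have hn : 2 ≤ n := Fact.out
  obtain ⟨hk, hΔ⟩ := mem_harmonicPolys.1 hp
  -- A constant times xᵢ is already harmonic. The case is separate because n + 2k - 2 vanishes for k
  -- = 0, n = 2.
  rcases Nat.eq_zero_or_pos k with rfl | hk0
  · refine Submodule.mem_sup_left ⟨_, ?_, rfl⟩
    have hC := MvPolynomial.totalDegree_eq_zero_iff_eq_C.1 (Nat.le_zero.1 hk.totalDegree_le)
    refine mem_harmonicPolys.2 ⟨by simpa [add_comm] using (MvPolynomial.isHomogeneous_X ℂ i).mul hk, ?_⟩
    rw [hC]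
    refine Finset.sum_eq_zero fun j _ => ?_
    simp [MvPolynomial.pderiv_X, Pi.single_apply, apply_ite]
  have hdp : (MvPolynomial.pderiv i p).IsHomogeneous (k - 1) := hk.pderiv
  have hdΔ : ∑ j, MvPolynomial.pderiv j (MvPolynomial.pderiv j (MvPolynomial.pderiv i p)) = 0 := by
    have : ∀ j, MvPolynomial.pderiv j (MvPolynomial.pderiv j (MvPolynomial.pderiv i p)) =
        MvPolynomial.pderiv i (MvPolynomial.pderiv j (MvPolynomial.pderiv j p)) := fun j => by
      rw [pderiv_comm i j, pderiv_comm i j]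
    simp only [this, ← map_sum, hΔ, map_zero]
  -- Forced by Δ(xᵢ p) = 2 ∂ᵢp and Δ(|x|² ∂ᵢp) = (2n + 4(k-1)) ∂ᵢp.
  set c : ℂ := ((n : ℂ) + 2 * k - 2)⁻¹ with hc
  have hc0 : (n : ℂ) + 2 * k - 2 ≠ 0 := by
    have : (0 : ℝ) < (n : ℝ) + 2 * k - 2 := by
      have h1 : (2 : ℝ) ≤ n := by exact_mod_cast hn
      have h2 : (1 : ℝ) ≤ k := by exact_mod_cast hk0
      linarith
    exact_mod_cast this.ne'
  set S : MvPolynomial (Fin n) ℂ := ∑ j, MvPolynomial.X j ^ 2 with hS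
  have hSh : S.IsHomogeneous 2 := MvPolynomial.IsHomogeneous.sum _ _ _ fun j _ => by
    simpa using (MvPolynomial.isHomogeneous_X ℂ j).pow 2
  set q : MvPolynomial (Fin n) ℂ :=
    MvPolynomial.X i * p - MvPolynomial.C c * (S * MvPolynomial.pderiv i p) with hq
  have hdS : ∀ j, MvPolynomial.pderiv j S = 2 * MvPolynomial.X j := by
    intro j
    rw [hS, map_sum, Finset.sum_eq_single j]
    · simp
    · intro b _ hb; simp [MvPolynomial.pderiv_X_of_ne hb]
    · simp
  have hE : ∑ j, MvPolynomial.X j * MvPolynomial.pderiv j (MvPolynomial.pderiv i p) =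
      ((k : MvPolynomial (Fin n) ℂ) - 1) * MvPolynomial.pderiv i p := by
    rw [hdp.sum_X_mul_pderiv, nsmul_eq_mul, Nat.cast_sub hk0, Nat.cast_one]
  have h1 : ∑ j, MvPolynomial.pderiv j (MvPolynomial.pderiv j (MvPolynomial.X i * p)) =
      2 * MvPolynomial.pderiv i p := by
    have : ∀ j, MvPolynomial.pderiv j (MvPolynomial.pderiv j (MvPolynomial.X i * p)) =
        2 * ((Pi.single i 1 : Fin n → MvPolynomial (Fin n) ℂ) j * MvPolynomial.pderiv j p) +
        MvPolynomial.X i * MvPolynomial.pderiv j (MvPolynomial.pderiv j p) := by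
      intro j
      simp only [MvPolynomial.pderiv_mul, map_add, MvPolynomial.pderiv_X, Pi.single_apply]
      split_ifs with h1 h2 h2
      · simp; ring
      · exact absurd h1.symm h2
      · exact absurd h2.symm h1
      · simp
    simp only [this, Finset.sum_add_distrib, ← Finset.mul_sum, hΔ]
    simp [Pi.single_apply]
  have h2 : ∑ j, MvPolynomial.pderiv j (MvPolynomial.pderiv j (S * MvPolynomial.pderiv i p)) =
      (2 * (n : MvPolynomial (Fin n) ℂ) + 4 * ((k : MvPolynomial (Fin n) ℂ) - 1)) *
        MvPolynomial.pderiv i p := by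
    have : ∀ j, MvPolynomial.pderiv j (MvPolynomial.pderiv j (S * MvPolynomial.pderiv i p)) =
        2 * MvPolynomial.pderiv i p +
        4 * (MvPolynomial.X j * MvPolynomial.pderiv j (MvPolynomial.pderiv i p)) +
        S * MvPolynomial.pderiv j (MvPolynomial.pderiv j (MvPolynomial.pderiv i p)) := by
      intro j
      have h2' : MvPolynomial.pderiv j (2 : MvPolynomial (Fin n) ℂ) = 0 := by
        exact (MvPolynomial.pderiv j).map_natCast 2
      simp only [MvPolynomial.pderiv_mul, map_add, hdS, MvPolynomial.pderiv_X_self, h2']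
      ring
    simp only [this, Finset.sum_add_distrib, ← Finset.mul_sum, hdΔ, hE, Finset.sum_const,
      Finset.card_univ, Fintype.card_fin, nsmul_eq_mul]
    ring
  have hqm : q ∈ harmonicPolys n (k + 1) := by
    refine mem_harmonicPolys.2 ⟨MvPolynomial.IsHomogeneous.sub ?_ ?_, ?_⟩
    · simpa [add_comm] using (MvPolynomial.isHomogeneous_X ℂ i).mul hk
    · have := (MvPolynomial.isHomogeneous_C (Fin n) c).mul (hSh.mul hdp)
      rwa [show 0 + (2 + (k - 1)) = k + 1 by omega] at this
    · have hcC : MvPolynomial.C c * (2 * (n : MvPolynomial (Fin n) ℂ) +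
          4 * ((k : MvPolynomial (Fin n) ℂ) - 1)) = 2 := by
        have h3 : (2 * (n : MvPolynomial (Fin n) ℂ) + 4 * ((k : MvPolynomial (Fin n) ℂ) - 1)) =
            MvPolynomial.C (2 * ((n : ℂ) + 2 * k - 2)) := by
          have h2 : (MvPolynomial.C (2 : ℂ) : MvPolynomial (Fin n) ℂ) = 2 := map_ofNat _ 2
          simp [h2]; ring
        rw [h3, ← map_mul, hc]
        have : ((n : ℂ) + 2 * k - 2)⁻¹ * (2 * ((n : ℂ) + 2 * k - 2)) = 2 := by field_simp
        rw [this]; exact map_ofNat _ 2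
      simp only [hq, map_sub, MvPolynomial.pderiv_C_mul, Finset.sum_sub_distrib, ← Finset.mul_sum,
        h1, h2]
      rw [← mul_assoc, hcC, sub_self]
  have hdm : MvPolynomial.C c * MvPolynomial.pderiv i p ∈ harmonicPolys n (k - 1) := by
    rw [← MvPolynomial.smul_eq_C_mul]
    exact Submodule.smul_mem _ _ (mem_harmonicPolys.2 ⟨hdp, hdΔ⟩)
  refine Submodule.mem_sup.2 ⟨_, ⟨q, hqm, rfl⟩, _, ⟨_, hdm, rfl⟩, ?_⟩
  ext ω
  have hω : polyVal S (ω : Eucl n) = 1 := by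
    have h := norm_eq_of_mem_sphere ω
    have h2 := EuclideanSpace.norm_sq_eq (ω : Eucl n)
    rw [h] at h2
    simp only [hS, polyVal_sum, polyVal_pow, polyVal_X]
    have : ∑ j, ((ω : Eucl n) j) ^ 2 = 1 := by simpa using h2.symm
    exact_mod_cast this
  simp [hq, hω]

/-- The sum of the spaces of spherical harmonics of degree at most `m`. -/
def harmonicsUpTo (n m : ℕ) : Submodule ℂ C(Sph n, ℂ) :=
  ⨆ (l : ℕ) (_ : l ≤ m), sphericalHarmonics n l

theorem sphericalHarmonics_le_upTo {l m : ℕ} (h : l ≤ m) :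
    sphericalHarmonics n l ≤ harmonicsUpTo n m :=
  le_iSup₂_of_le l h le_rfl

theorem harmonicsUpTo_mono {l m : ℕ} (h : l ≤ m) : harmonicsUpTo n l ≤ harmonicsUpTo n m :=
  iSup₂_le fun _ ha => sphericalHarmonics_le_upTo (ha.trans h)

theorem restrictPoly_mul (p q : MvPolynomial (Fin n) ℂ) :
    restrictPoly n (p * q) = restrictPoly n p * restrictPoly n q := by ext ω; simp

variable [Fact (2 ≤ n)]

theorem X_mul_mem_upTo {m : ℕ} (i : Fin n) {g : C(Sph n, ℂ)} (hg : g ∈ harmonicsUpTo n m) :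
    restrictPoly n (MvPolynomial.X i) * g ∈ harmonicsUpTo n (m + 1) := by
  have : harmonicsUpTo n m ≤ (harmonicsUpTo n (m + 1)).comap
      (LinearMap.mulLeft ℂ (restrictPoly n (MvPolynomial.X i))) := by
    refine iSup₂_le fun l hl => ?_
    rintro _ ⟨p, hp, rfl⟩
    rw [Submodule.mem_comap, LinearMap.mulLeft_apply, ← restrictPoly_mul]
    have h1 : sphericalHarmonics n (l + 1) ≤ harmonicsUpTo n (m + 1) :=
      sphericalHarmonics_le_upTo (by omega)
    have h2 : sphericalHarmonics n (l - 1) ≤ harmonicsUpTo n (m + 1) :=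
      sphericalHarmonics_le_upTo (by omega)
    exact sup_le h1 h2 (restrictPoly_X_mul_mem hp i)
  exact this hg

/-- A monomial is built from 1 by multiplying by coordinates, and each factor raises the harmonic
degree by at most one. This takes the place of dividing polynomials by |x|². -/
theorem restrictPoly_monomial_mem (m : ℕ) : ∀ d : Fin n →₀ ℕ, d.degree = m →
    restrictPoly n (MvPolynomial.monomial d 1) ∈ harmonicsUpTo n m := by
  induction m with
  | zero =>
    intro d hd
    rw [Finsupp.degree_eq_zero_iff] at hd
    subst hd
    refine sphericalHarmonics_le_upTo le_rfl ⟨1, mem_harmonicPolys.2 ⟨?_, by simp⟩, rfl⟩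
    exact MvPolynomial.isHomogeneous_one _ _
  | succ m ih =>
    intro d hd
    have hne : d ≠ 0 := by rintro rfl; simp at hd
    obtain ⟨i, hi⟩ := Finsupp.ne_iff.1 hne
    have hle : Finsupp.single i 1 ≤ d := by
      rw [Finsupp.single_le_iff]; exact Nat.one_le_iff_ne_zero.2 hi
    have hd' : d = Finsupp.single i 1 + (d - Finsupp.single i 1) := (add_tsub_cancel_of_le hle).symm
    have hdeg : (d - Finsupp.single i 1).degree = m := by
      have := congrArg Finsupp.degree hd'
      rw [map_add, Finsupp.degree_single] at this
      omega
    have hm : (MvPolynomial.monomial d 1 : MvPolynomial (Fin n) ℂ) =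
        MvPolynomial.X i * MvPolynomial.monomial (d - Finsupp.single i 1) 1 := by
      rw [MvPolynomial.X, MvPolynomial.monomial_mul, ← hd', one_mul]
    rw [hm, restrictPoly_mul]
    exact X_mul_mem_upTo i (ih _ hdeg)

theorem restrictPoly_mem_upTo {m : ℕ} {p : MvPolynomial (Fin n) ℂ} (hp : p.totalDegree ≤ m) :
    restrictPoly n p ∈ harmonicsUpTo n m := by
  rw [p.as_sum, map_sum]
  refine Submodule.sum_mem _ fun d hd => ?_
  have h1 : MvPolynomial.monomial d (p.coeff d) =
      p.coeff d • (MvPolynomial.monomial d 1 : MvPolynomial (Fin n) ℂ) := by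
    rw [MvPolynomial.smul_monomial, smul_eq_mul, mul_one]
  rw [h1, map_smul]
  refine Submodule.smul_mem _ _ (harmonicsUpTo_mono ?_ (restrictPoly_monomial_mem _ d rfl))
  refine le_trans ?_ hp
  simpa [Finsupp.degree_eq_sum, Finsupp.sum_fintype] using MvPolynomial.le_totalDegree hd

theorem sphEigenvalue_strictMono : StrictMono (sphEigenvalue n) := by
  have h : (2 : ℝ) ≤ n := by exact_mod_cast (Fact.out : 2 ≤ n)
  refine strictMono_nat_of_lt_succ fun k => ?_
  simp only [sphEigenvalue]
  push_cast
  have : (0 : ℝ) ≤ k := k.cast_nonneg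
  nlinarith

/-- Both are eigenfunctions of the symmetric operator Δ_ω, and the eigenvalues k(k+n-2) are distinct
for n ≥ 2. -/
theorem integral_mul_eq_zero {k l : ℕ} (hkl : k ≠ l) {Y Z : C(Sph n, ℂ)}
    (hY : Y ∈ sphericalHarmonics n k) (hZ : Z ∈ sphericalHarmonics n l) :
    ∫ ω, Y ω * Z ω ∂surf n = 0 := by
  obtain ⟨p, hp, rfl⟩ := hY
  obtain ⟨q, hq, rfl⟩ := hZ
  have h := integral_angularLaplacian_mul_comm p q
  simp only [angularLaplacian_eq hp, angularLaplacian_eq hq, polyVal_smul, mul_assoc,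
    mul_left_comm (polyVal p _)] at h
  rw [integral_const_mul, integral_const_mul, ← sub_eq_zero, ← sub_mul] at h
  refine (mul_eq_zero.1 h).resolve_left ?_
  rw [sub_eq_zero]
  intro h
  have := sphEigenvalue_strictMono.injective (neg_injective (Complex.ofReal_injective h))
  exact hkl this

/-- The bilinear pairing `g ↦ ∫ g Y` with a fixed function on the sphere. -/
def pairing (Y : C(Sph n, ℂ)) : C(Sph n, ℂ) →ₗ[ℂ] ℂ where
  toFun g := ∫ ω, g ω * Y ω ∂surf n
  map_add' g h := by
    simp only [ContinuousMap.add_apply, add_mul]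
    exact integral_add (integrable_sphere (by fun_prop)) (integrable_sphere (by fun_prop))
  map_smul' c g := by
    simp only [ContinuousMap.smul_apply, smul_eq_mul, mul_assoc, RingHom.id_apply]
    exact integral_const_mul _ _

/-- On the sphere p is a sum of harmonics of degree below k. This is what removes the low Taylor
terms of plane waves. -/
theorem integral_polyVal_mul_eq_zero {k : ℕ} {p : MvPolynomial (Fin n) ℂ} (hp : p.totalDegree < k)
    {Y : C(Sph n, ℂ)} (hY : Y ∈ sphericalHarmonics n k) :
    ∫ ω : Sph n, polyVal p ω * Y ω ∂surf n = 0 := by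
  have h1 : harmonicsUpTo n p.totalDegree ≤ LinearMap.ker (pairing Y) :=
    iSup₂_le fun l hl g hg => integral_mul_eq_zero (by omega) hg hY
  exact h1 (restrictPoly_mem_upTo le_rfl)

end Harmonics

/-! ### Completeness: expansion in spherical harmonics and Parseval -/

section Expansion

variable {n : ℕ} [Fact (2 ≤ n)]

theorem inner_toL2 (g h : C(Sph n, ℂ)) :
    inner ℂ (toL2 n g) (toL2 n h) = ∫ ω, h ω * starRingEnd ℂ (g ω) ∂surf n :=
  ContinuousMap.inner_toLp (surf n) g h

theorem norm_sq_toL2 (g : C(Sph n, ℂ)) : ‖toL2 n g‖ ^ 2 = ∫ ω, ‖g ω‖ ^ 2 ∂surf n := by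
  have h := inner_toL2 g g
  have h2 : ∀ ω, g ω * starRingEnd ℂ (g ω) = ((‖g ω‖ ^ 2 : ℝ) : ℂ) := fun ω => by
    rw [Complex.mul_conj, Complex.normSq_eq_norm_sq]
  simp only [h2] at h
  rw [integral_complex_ofReal] at h
  rw [← inner_self_eq_norm_sq (𝕜 := ℂ), h]
  exact Complex.ofReal_re _

theorem toL2_mem {k : ℕ} {Y : C(Sph n, ℂ)} (hY : Y ∈ sphericalHarmonics n k) :
    toL2 n Y ∈ sphericalHarmonicsL2 n k := Submodule.mem_map_of_mem hY

theorem harmonicPart_mem (k : ℕ) (g : C(Sph n, ℂ)) :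
    harmonicPart n k g ∈ sphericalHarmonics n k := Subtype.coe_prop _

theorem toL2_harmonicPart (k : ℕ) (g : C(Sph n, ℂ)) :
    toL2 n (harmonicPart n k g) =
      ((sphericalHarmonicsL2 n k).orthogonalProjectionOnto (toL2 n g) : Lp ℂ 2 (surf n)) := by
  have := congrArg Subtype.val ((Submodule.equivMapOfInjective (toL2 n) (toL2_injective n)
    (sphericalHarmonics n k)).apply_symm_apply
    ((sphericalHarmonicsL2 n k).orthogonalProjectionOnto (toL2 n g)))
  exact this

theorem harmonicPart_add (k : ℕ) (g h : C(Sph n, ℂ)) :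
    harmonicPart n k (g + h) = harmonicPart n k g + harmonicPart n k h := by
  apply toL2_injective n
  simp [toL2_harmonicPart]

theorem harmonicPart_smul (k : ℕ) (c : ℂ) (g : C(Sph n, ℂ)) :
    harmonicPart n k (c • g) = c • harmonicPart n k g := by
  apply toL2_injective n
  simp [toL2_harmonicPart]

theorem integral_mul_harmonicPart {k : ℕ} {Y : C(Sph n, ℂ)} (hY : Y ∈ sphericalHarmonics n k)
    (g : C(Sph n, ℂ)) :
    ∫ ω, harmonicPart n k g ω * Y ω ∂surf n = ∫ ω, g ω * Y ω ∂surf n := by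
  have h := Submodule.inner_orthogonalProjectionOnto_eq_of_mem_left
    (K := sphericalHarmonicsL2 n k) ⟨_, toL2_mem (star_mem_sphericalHarmonics hY)⟩ (toL2 n g)
  rw [Submodule.coe_inner, ← toL2_harmonicPart, inner_toL2, inner_toL2] at h
  simpa using h

theorem harmonicPart_of_mem {k : ℕ} {Y : C(Sph n, ℂ)} (hY : Y ∈ sphericalHarmonics n k) :
    harmonicPart n k Y = Y := by
  apply toL2_injective n
  rw [toL2_harmonicPart]
  exact Submodule.starProjection_eq_self_iff.2 (toL2_mem hY)

theorem inner_eq_zero_of_ne {k l : ℕ} (hkl : k ≠ l) {x y : Lp ℂ 2 (surf n)}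
    (hx : x ∈ sphericalHarmonicsL2 n k) (hy : y ∈ sphericalHarmonicsL2 n l) : inner ℂ x y = 0 := by
  obtain ⟨Y, hY, rfl⟩ := hx
  obtain ⟨Z, hZ, rfl⟩ := hy
  rw [inner_toL2]
  exact integral_mul_eq_zero hkl.symm hZ (star_mem_sphericalHarmonics hY)

/-- The restrictions of polynomials form a star subalgebra of `C(S^{n-1})`. -/
def polyStarSubalgebra (n : ℕ) : StarSubalgebra ℂ C(Sph n, ℂ) where
  carrier := Set.range (restrictPoly n)
  mul_mem' := by
    rintro _ _ ⟨p, rfl⟩ ⟨q, rfl⟩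
    exact ⟨p * q, restrictPoly_mul p q⟩
  add_mem' := by
    rintro _ _ ⟨p, rfl⟩ ⟨q, rfl⟩
    exact ⟨p + q, map_add _ _ _⟩
  algebraMap_mem' c := ⟨MvPolynomial.C c, by ext; simp [Algebra.algebraMap_eq_smul_one]⟩
  star_mem' := by
    rintro _ ⟨p, rfl⟩
    exact ⟨polyConj p, by ext; simp⟩

theorem polyStarSubalgebra_separatesPoints : (polyStarSubalgebra n).SeparatesPoints := by
  intro ω θ h
  have h2 : (ω : Eucl n) ≠ θ := fun h' => h (Subtype.ext h')
  obtain ⟨i, hi⟩ : ∃ i, (ω : Eucl n) i ≠ (θ : Eucl n) i := by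
    by_contra hcon
    push Not at hcon
    exact h2 (PiLp.ext hcon)
  refine ⟨restrictPoly n (MvPolynomial.X i), ⟨_, ⟨_, rfl⟩, rfl⟩, ?_⟩
  simpa using hi

/-- By Stone–Weierstrass polynomials are uniformly dense in the continuous functions, which are
dense in L²; on the sphere every polynomial is a finite sum of harmonics. -/
theorem topologicalClosure_iSup_sphericalHarmonicsL2 :
    (⨆ k, sphericalHarmonicsL2 n k).topologicalClosure = ⊤ := by
  have h1 : (LinearMap.range (restrictPoly n)).topologicalClosure = ⊤ := by
    have := ContinuousMap.starSubalgebra_topologicalClosure_eq_top_of_separatesPoints _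
      (polyStarSubalgebra_separatesPoints (n := n))
    rw [Submodule.eq_top_iff']
    intro g
    have hg : g ∈ (polyStarSubalgebra n).topologicalClosure := this ▸ trivial
    exact hg
  have h2 := (ContinuousMap.toLp_denseRange ℂ (surf n) ℂ
    (p := 2) (by simp)).topologicalClosure_map_submodule h1
  rw [eq_top_iff, ← h2]
  refine Submodule.topologicalClosure_mono ?_
  rintro _ ⟨_, ⟨p, rfl⟩, rfl⟩
  have h3 : harmonicsUpTo n p.totalDegree ≤ (⨆ k, sphericalHarmonicsL2 n k).comap (toL2 n) :=
    iSup₂_le fun l _ g hg => Submodule.mem_iSup_of_mem l (toL2_mem hg)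
  exact h3 (restrictPoly_mem_upTo le_rfl)

theorem isHilbertSum_sphericalHarmonicsL2 :
    IsHilbertSum ℂ (fun k => sphericalHarmonicsL2 n k)
      fun k => (sphericalHarmonicsL2 n k).subtypeₗᵢ :=
  IsHilbertSum.mkInternal _ (fun _ _ hkl x y => inner_eq_zero_of_ne hkl x.2 y.2)
    topologicalClosure_iSup_sphericalHarmonicsL2.ge

theorem hasSum_projection (x : Lp ℂ 2 (surf n)) :
    HasSum (fun k => ((sphericalHarmonicsL2 n k).orthogonalProjectionOnto x : Lp ℂ 2 (surf n))) x := by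
  have hV := isHilbertSum_sphericalHarmonicsL2 (n := n)
  set w := hV.linearIsometryEquiv x with hw
  have h := hV.hasSum_linearIsometryEquiv_symm w
  rw [hw, LinearIsometryEquiv.symm_apply_apply, ← hw] at h
  -- Projecting the abstract Hilbert-sum expansion onto degree k kills all the other summands.
  have hk : ∀ k, (sphericalHarmonicsL2 n k).orthogonalProjectionOnto x = w k := by
    intro k
    have h2 := h.mapL ((sphericalHarmonicsL2 n k).orthogonalProjectionOnto)
    refine h2.unique ?_
    convert hasSum_single k fun l hl => ?_
    · exact (Submodule.orthogonalProjectionOnto_mem_subspace_eq_self _).symm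
    · refine Submodule.orthogonalProjectionOnto_apply_of_mem_orthogonal ?_
      rw [Submodule.mem_orthogonal]
      exact fun u hu => inner_eq_zero_of_ne hl.symm hu (w l).2
  simpa only [hk] using! h

theorem hasSum_norm_sq_harmonicPart (g : C(Sph n, ℂ)) :
    HasSum (fun k => ∫ ω, ‖harmonicPart n k g ω‖ ^ 2 ∂surf n) (∫ ω, ‖g ω‖ ^ 2 ∂surf n) := by
  have h := ((hasSum_projection (toL2 n g)).mapL (innerSL ℂ (toL2 n g))).mapL Complex.reCLM
  simp only [innerSL_apply_apply] at h
  rw [← norm_sq_toL2, ← inner_self_eq_norm_sq (𝕜 := ℂ)]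
  refine h.congr_fun ?_
  intro k
  rw [← norm_sq_toL2, toL2_harmonicPart,
    ← Submodule.inner_orthogonalProjectionOnto_eq_of_mem_right]
  exact (inner_self_eq_norm_sq (𝕜 := ℂ) _).symm

theorem harmonicPart_eq_zero_of_pairing {k : ℕ} {g : C(Sph n, ℂ)}
    (h : ∀ Y ∈ sphericalHarmonics n k, ∫ ω, g ω * Y ω ∂surf n = 0) : harmonicPart n k g = 0 := by
  apply toL2_injective n
  rw [toL2_harmonicPart, map_zero, Submodule.orthogonalProjectionOnto_apply_of_mem_orthogonal,
    Submodule.coe_zero]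
  rw [Submodule.mem_orthogonal]
  rintro _ ⟨Y, hY, rfl⟩
  rw [inner_toL2]
  exact h _ (star_mem_sphericalHarmonics hY)

theorem harmonicPart_of_mem_of_ne {k l : ℕ} (hkl : l ≠ k) {Y : C(Sph n, ℂ)}
    (hY : Y ∈ sphericalHarmonics n l) : harmonicPart n k Y = 0 :=
  harmonicPart_eq_zero_of_pairing fun _ hZ => integral_mul_eq_zero hkl hY hZ

theorem eq_zero_of_norm_sq_integral {g : C(Sph n, ℂ)} (h : ∫ ω, ‖g ω‖ ^ 2 ∂surf n = 0) : g = 0 := by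
  rw [← norm_sq_toL2] at h
  apply toL2_injective n
  rw [map_zero]
  simpa using h

theorem eq_zero_of_pairing {g : C(Sph n, ℂ)}
    (h : ∀ k, ∀ Y ∈ sphericalHarmonics n k, ∫ ω, g ω * Y ω ∂surf n = 0) : g = 0 := by
  have h1 := hasSum_norm_sq_harmonicPart g
  simp only [harmonicPart_eq_zero_of_pairing (h _)] at h1
  refine eq_zero_of_norm_sq_integral (h1.unique ?_)
  simp

/-- Identities between continuous functions on the sphere are checked below one degree at a time in
this way. -/
theorem eq_of_pairing {g g' : C(Sph n, ℂ)} (h : ∀ k, ∀ Y ∈ sphericalHarmonics n k,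
    ∫ ω, g ω * Y ω ∂surf n = ∫ ω, g' ω * Y ω ∂surf n) : g = g' := by
  rw [← sub_eq_zero]
  refine eq_zero_of_pairing fun k Y hY => ?_
  have := (pairing Y).map_sub g g'
  simp only [pairing, LinearMap.coe_mk, AddHom.coe_mk] at this
  rw [this, h k Y hY, sub_self]

/-- A function that is orthogonal to all spherical harmonics of degree different from `k` is a
spherical harmonic of degree `k`. -/
theorem mem_sphericalHarmonics_of_pairing {k : ℕ} {g : C(Sph n, ℂ)}
    (h : ∀ l, l ≠ k → ∀ Y ∈ sphericalHarmonics n l, ∫ ω, g ω * Y ω ∂surf n = 0) :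
    g ∈ sphericalHarmonics n k := by
  have : g = harmonicPart n k g := by
    refine eq_of_pairing fun l Y hY => ?_
    by_cases hl : l = k
    · subst hl; exact (integral_mul_harmonicPart hY g).symm
    · rw [h l hl Y hY, integral_mul_eq_zero (Ne.symm hl) (harmonicPart_mem k g) hY]
  exact this ▸ harmonicPart_mem k g

end Expansion

/-! ### Dimension of the space of harmonics of degree k and the sup-norm bound -/

section Dimension

variable {n : ℕ}

theorem coeff_pderiv_pderiv (j : Fin n) (a : Fin n →₀ ℕ) (p : MvPolynomial (Fin n) ℂ) :
    (MvPolynomial.pderiv j (MvPolynomial.pderiv j p)).coeff a =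
      p.coeff (a + Finsupp.single j 2) * (a j + 2) * (a j + 1) := by
  rw [MvPolynomial.coeff_pderiv, MvPolynomial.coeff_pderiv, add_assoc, ← Finsupp.single_add,
    Finsupp.add_apply, Finsupp.single_eq_same, one_add_one_eq_two]
  push_cast
  ring

variable [hn : Fact (2 ≤ n)]

/-- The first coordinate index. -/
def fstIdx (n : ℕ) [hn : Fact (2 ≤ n)] : Fin n := ⟨0, by have := hn.out; omega⟩

/-- The second coordinate index. -/
def sndIdx (n : ℕ) [hn : Fact (2 ≤ n)] : Fin n := ⟨1, by have := hn.out; omega⟩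

theorem fstIdx_ne_sndIdx : fstIdx n ≠ sndIdx n := by simp [fstIdx, sndIdx]

/-- The multi-index of total degree `k` with first entry `e` and with the entries from the third
on prescribed by `v`. -/
def cauchyIdx (n k : ℕ) [Fact (2 ≤ n)] (e : Fin 2)
    (v : {j : Fin n // j ≠ fstIdx n ∧ j ≠ sndIdx n} → Fin (k + 1)) : Fin n →₀ ℕ :=
  Finsupp.equivFunOnFinite.symm fun j =>
    if h : j ≠ fstIdx n ∧ j ≠ sndIdx n then v ⟨j, h⟩
    else if j = fstIdx n then e else k - e - ∑ l, (v l : ℕ)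

/-- The total degree determines the second exponent. Only this surjectivity is needed: a `v` with
too large a sum gives, by truncated subtraction, an index of another degree, which adds a harmless
condition. -/
theorem exists_cauchyIdx {k : ℕ} {a : Fin n →₀ ℕ} (ha : a.degree = k) (h1 : a (fstIdx n) < 2) :
    ∃ e v, cauchyIdx n k e v = a := by
  have hle : ∀ j, a j < k + 1 := fun j => by
    rw [← ha]; exact Nat.lt_succ_of_le (Finsupp.le_degree j a)
  refine ⟨⟨a (fstIdx n), h1⟩, fun j => ⟨a j, hle j⟩, ?_⟩
  ext j
  simp only [cauchyIdx, Finsupp.equivFunOnFinite_symm_apply_apply]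
  split_ifs with h h'
  · rfl
  · rw [h']
  · have hj : j = sndIdx n := by
      by_contra hj
      exact h ⟨h', hj⟩
    have h2 : a.degree = a (fstIdx n) + (a (sndIdx n) +
        ∑ l : {j : Fin n // j ≠ fstIdx n ∧ j ≠ sndIdx n}, a l) := by
      rw [Finsupp.degree_eq_sum, ← Finset.add_sum_erase _ _ (Finset.mem_univ (fstIdx n)),
        ← Finset.add_sum_erase (Finset.univ.erase (fstIdx n)) _
          (Finset.mem_erase.2 ⟨fstIdx_ne_sndIdx.symm, Finset.mem_univ _⟩)]
      congr 2
      exact Finset.sum_subtype _ (by intro x; simp; tauto) _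
    rw [hj]
    omega

/-- Cauchy data for the Laplace equation: Δp = 0 expresses ∂₁²p by the other second derivatives, so
coefficients with first exponent m follow from those with exponent m-2. Exponents 0 and 1 determine
p. -/
theorem harmonic_eq_zero {k : ℕ} {p : MvPolynomial (Fin n) ℂ} (hp : p ∈ harmonicPolys n k)
    (h : ∀ e v, p.coeff (cauchyIdx n k e v) = 0) : p = 0 := by
  obtain ⟨hk, hΔ⟩ := mem_harmonicPolys.1 hp
  have key : ∀ m, ∀ a : Fin n →₀ ℕ, a (fstIdx n) = m → a.degree = k → p.coeff a = 0 := by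
    intro m
    induction m using Nat.strong_induction_on with
    | _ m ih =>
      intro a ham hak
      by_cases hm : m < 2
      · obtain ⟨e, v, rfl⟩ := exists_cauchyIdx hak (ham ▸ hm)
        exact h e v
      · have hle : Finsupp.single (fstIdx n) 2 ≤ a := by
          rw [Finsupp.single_le_iff]; omega
        set a' := a - Finsupp.single (fstIdx n) 2 with ha'
        have haa : a' + Finsupp.single (fstIdx n) 2 = a := tsub_add_cancel_of_le hle
        have hdeg : a'.degree + 2 = k := by
          rw [← hak, ← haa, map_add, Finsupp.degree_single]
        have hfst : a' (fstIdx n) + 2 = m := by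
          rw [← ham, ← haa]; simp
        have h0 := congrArg (MvPolynomial.coeff a') hΔ
        rw [MvPolynomial.coeff_sum, MvPolynomial.coeff_zero, Finset.sum_eq_single (fstIdx n),
          coeff_pderiv_pderiv, haa] at h0
        · have h1 : (a' (fstIdx n) : ℂ) + 2 ≠ 0 := by
            exact_mod_cast Nat.succ_ne_zero (a' (fstIdx n) + 1)
          have h2 : (a' (fstIdx n) : ℂ) + 1 ≠ 0 := Nat.cast_add_one_ne_zero _
          simpa [h1, h2] using h0
        · intro j _ hj
          rw [coeff_pderiv_pderiv, ih (m - 2) (by omega), zero_mul, zero_mul]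
          · simp [hj]; omega
          · rw [map_add, Finsupp.degree_single, hdeg]
        · simp
  ext a
  rw [MvPolynomial.coeff_zero]
  by_cases ha : a.degree = k
  · exact key _ a rfl ha
  · exact hk.coeff_eq_zero ha

theorem card_complement : Fintype.card {j : Fin n // j ≠ fstIdx n ∧ j ≠ sndIdx n} = n - 2 := by
  rw [Fintype.card_subtype]
  have : Finset.univ.filter (fun j => j ≠ fstIdx n ∧ j ≠ sndIdx n) =
      (Finset.univ.erase (fstIdx n)).erase (sndIdx n) := by
    ext j; simp; tauto
  rw [this, Finset.card_erase_of_mem (by simp [fstIdx_ne_sndIdx.symm]),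
    Finset.card_erase_of_mem (by simp)]
  simp
  omega

theorem finrank_harmonicPolys_le (k : ℕ) :
    Module.finrank ℂ (harmonicPolys n k) ≤ 2 * (k + 1) ^ (n - 2) := by
  let Φ : harmonicPolys n k →ₗ[ℂ]
      (Fin 2 × ({j : Fin n // j ≠ fstIdx n ∧ j ≠ sndIdx n} → Fin (k + 1)) → ℂ) :=
    { toFun := fun p q => (p : MvPolynomial (Fin n) ℂ).coeff (cauchyIdx n k q.1 q.2)
      map_add' := fun p q => by ext; simp
      map_smul' := fun c p => by ext; simp }
  have hΦ : Function.Injective Φ := by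
    rw [injective_iff_map_eq_zero]
    intro p hp
    exact Subtype.ext (harmonic_eq_zero p.2 fun e v => congrFun hp (e, v))
  have := LinearMap.finrank_le_finrank_of_injective hΦ
  simpa [card_complement] using this

theorem finrank_sphericalHarmonicsL2_le (k : ℕ) :
    Module.finrank ℂ (sphericalHarmonicsL2 n k) ≤ 2 * (k + 1) ^ (n - 2) := by
  refine le_trans ?_ (finrank_harmonicPolys_le (n := n) k)
  unfold sphericalHarmonicsL2 sphericalHarmonics
  rw [← Submodule.map_comp]
  exact Submodule.finrank_map_le _ _

/-- By Green's identity z is orthogonal to every harmonic with nonzero eigenvalue, that is, of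
positive degree. -/
theorem harmonicPart_zero_of_rotField {z : MvPolynomial (Fin n) ℂ}
    (hz : ∀ i j, ∀ ω : Sph n, polyVal (rotField i j z) ω = 0) :
    restrictPoly n z ∈ sphericalHarmonics n 0 := by
  refine mem_sphericalHarmonics_of_pairing fun l hl Y hY => ?_
  obtain ⟨q, hq, rfl⟩ := hY
  have h := integral_angularLaplacian_mul q z
  simp only [hz, mul_zero, integral_zero, Finset.sum_const_zero, neg_zero, angularLaplacian_eq hq,
    polyVal_smul, mul_assoc] at h
  rw [integral_const_mul] at h
  have hne : ((-sphEigenvalue n l : ℝ) : ℂ) ≠ 0 := by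
    have h0 : sphEigenvalue n 0 = 0 := by simp [sphEigenvalue]
    have := sphEigenvalue_strictMono (n := n) (Nat.pos_of_ne_zero hl)
    rw [h0] at this
    exact_mod_cast (neg_lt_zero.2 this).ne
  simpa [mul_comm] using (mul_eq_zero.1 h).resolve_left hne

theorem exists_const_of_mem_zero {g : C(Sph n, ℂ)} (hg : g ∈ sphericalHarmonics n 0) :
    ∃ c, ∀ ω, g ω = c := by
  obtain ⟨p, hp, rfl⟩ := hg
  refine ⟨p.coeff 0, fun ω => ?_⟩
  have hC := MvPolynomial.totalDegree_eq_zero_iff_eq_C.1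
    (Nat.le_zero.1 (mem_harmonicPolys.1 hp).1.totalDegree_le)
  rw [restrictPoly_apply]
  nth_rw 1 [hC]
  simp

/-- An orthonormal basis of the spherical harmonics of degree `k`, given by harmonic polynomials. -/
theorem exists_orthonormal_polys (k : ℕ) :
    ∃ P : Fin (Module.finrank ℂ (sphericalHarmonicsL2 n k)) → MvPolynomial (Fin n) ℂ,
      (∀ i, P i ∈ harmonicPolys n k) ∧
      (∀ i, ∫ ω : Sph n, ‖polyVal (P i) ω‖ ^ 2 ∂surf n = 1) ∧
      ∀ Y ∈ sphericalHarmonics n k, ∃ c : Fin (Module.finrank ℂ (sphericalHarmonicsL2 n k)) → ℂ,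
        (∀ i, c i = ∫ ω : Sph n, Y ω * polyVal (polyConj (P i)) ω ∂surf n) ∧
        (∀ ω, Y ω = ∑ i, c i * polyVal (P i) ω) ∧
        ∑ i, ‖c i‖ ^ 2 = ∫ ω, ‖Y ω‖ ^ 2 ∂surf n := by
  let b := stdOrthonormalBasis ℂ (sphericalHarmonicsL2 n k)
  have hb : ∀ i, ∃ p ∈ harmonicPolys n k, toL2 n (restrictPoly n p) = b i := by
    intro i
    obtain ⟨_, ⟨p, hp, rfl⟩, h⟩ := (b i).2
    exact ⟨p, hp, h⟩
  choose P hP hPb using hb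
  refine ⟨P, hP, fun i => ?_, fun Y hY => ?_⟩
  · have h1 := norm_sq_toL2 (restrictPoly n (P i))
    rw [hPb, show ‖(b i : Lp ℂ 2 (surf n))‖ = 1 from b.norm_eq_one i, one_pow] at h1
    exact h1.symm
  · set y : sphericalHarmonicsL2 n k := ⟨toL2 n Y, toL2_mem hY⟩ with hy
    have hc : ∀ i, inner ℂ (b i) y = ∫ ω : Sph n, Y ω * polyVal (polyConj (P i)) ω ∂surf n := by
      intro i
      rw [Submodule.coe_inner, ← hPb, inner_toL2]
      simp
    refine ⟨fun i => inner ℂ (b i) y, hc, fun ω => ?_, ?_⟩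
    · have h1 : Y = ∑ i, inner ℂ (b i) y • restrictPoly n (P i) := by
        apply toL2_injective n
        rw [map_sum]
        simp only [map_smul, hPb]
        have := congrArg Subtype.val (b.sum_repr' y)
        simpa using this.symm
      conv_lhs => rw [h1]
      simp
    · rw [b.sum_sq_norm_inner_right, ← norm_sq_toL2]
      rfl

/-- A rotation field acts on the harmonics of degree k by a skew-Hermitian matrix A in the basis P,
so the derivative of Σ |Pᵢ|² cancels in pairs. This is the infinitesimal form of its rotation
invariance. -/
theorem sum_rotField_mul_conj_eq_zero {k d : ℕ} {P : Fin d → MvPolynomial (Fin n) ℂ}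
    (hP : ∀ i, P i ∈ harmonicPolys n k)
    (hexp : ∀ Y ∈ sphericalHarmonics n k, ∀ ω, Y ω =
      ∑ i, (∫ ω : Sph n, Y ω * polyVal (polyConj (P i)) ω ∂surf n) * polyVal (P i) ω)
    (a b : Fin n) (ω : Sph n) : polyVal (rotField a b (∑ i, P i * polyConj (P i))) ω = 0 := by
  set A : Fin d → Fin d → ℂ := fun i j =>
    ∫ ω : Sph n, polyVal (rotField a b (P i)) ω * polyVal (polyConj (P j)) ω ∂surf n with hA
  have hskew : ∀ i j, A i j = -starRingEnd ℂ (A j i) := by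
    intro i j
    simp only [hA]
    rw [integral_rotField_mul, ← integral_conj]
    simp only [rotField_polyConj, polyVal_polyConj, map_mul, Complex.conj_conj, mul_comm]
  have hrot : ∀ i, polyVal (rotField a b (P i)) ω = ∑ j, A i j * polyVal (P j) ω := fun i =>
    hexp _ ⟨_, rotField_mem (hP i) a b, rfl⟩ ω
  simp only [rotField_sum, rotField_mul, rotField_polyConj, polyVal_sum, polyVal_add, polyVal_mul,
    polyVal_polyConj, hrot, map_sum, map_mul, Finset.sum_add_distrib, Finset.sum_mul,
    Finset.mul_sum]
  rw [Finset.sum_comm (γ := Fin d), ← Finset.sum_add_distrib]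
  refine Finset.sum_eq_zero fun i _ => ?_
  rw [← Finset.sum_add_distrib]
  refine Finset.sum_eq_zero fun j _ => ?_
  rw [hskew j i]
  ring

/-- Sharp pointwise bound for spherical harmonics. -/
theorem norm_sq_apply_le {k : ℕ} {Y : C(Sph n, ℂ)} (hY : Y ∈ sphericalHarmonics n k) (ω : Sph n) :
    ‖Y ω‖ ^ 2 ≤ 2 * (k + 1 : ℝ) ^ (n - 2) / (surf n).real univ * ∫ ω, ‖Y ω‖ ^ 2 ∂surf n := by
  obtain ⟨P, hP, hnorm, hexp⟩ := exists_orthonormal_polys (n := n) k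
  have hσ : 0 < (surf n).real univ := by
    rw [measureReal_def, ENNReal.toReal_pos_iff]
    exact ⟨Measure.measure_univ_pos.2 (Measure.toSphere_ne_zero _), measure_lt_top _ _⟩
  have hz := harmonicPart_zero_of_rotField fun a b => sum_rotField_mul_conj_eq_zero hP
    (fun Y hY ω => by
      obtain ⟨c, hc, h, -⟩ := hexp Y hY
      simp only [← hc]; exact h ω) a b
  obtain ⟨z, hz⟩ := exists_const_of_mem_zero hz
  have hz' : ∀ ω : Sph n, ∑ i, ‖polyVal (P i) ω‖ ^ 2 = z.re := by
    intro ω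
    rw [← hz ω]
    simp only [restrictPoly_apply, polyVal_sum, polyVal_mul, polyVal_polyConj, Complex.mul_conj,
      Complex.normSq_eq_norm_sq, Complex.re_sum, Complex.ofReal_re]
  -- Integrating the constant Σ |Pᵢ|² over the sphere counts the orthonormal basis, so its value is
  -- the dimension divided by the surface area.
  have hd : (Module.finrank ℂ (sphericalHarmonicsL2 n k) : ℝ) = (surf n).real univ * z.re := by
    have h1 : ∫ ω : Sph n, ∑ i, ‖polyVal (P i) ω‖ ^ 2 ∂surf n = (surf n).real univ * z.re := by
      simp only [hz']; simp
    rw [integral_finsetSum _ fun i _ => integrable_sphere (by fun_prop)] at h1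
    simpa [hnorm] using h1
  have hdim : (Module.finrank ℂ (sphericalHarmonicsL2 n k) : ℝ) ≤ 2 * (k + 1 : ℝ) ^ (n - 2) := by
    exact_mod_cast finrank_sphericalHarmonicsL2_le (n := n) k
  obtain ⟨c, -, hYω, hc⟩ := hexp Y hY
  have h1 : ‖Y ω‖ ≤ ∑ i, ‖c i‖ * ‖polyVal (P i) ω‖ := by
    rw [hYω]
    refine (norm_sum_le _ _).trans_eq ?_
    simp only [norm_mul]
  calc ‖Y ω‖ ^ 2 ≤ (∑ i, ‖c i‖ * ‖polyVal (P i) ω‖) ^ 2 := by gcongr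
    _ ≤ (∑ i, ‖c i‖ ^ 2) * ∑ i, ‖polyVal (P i) ω‖ ^ 2 := Finset.sum_mul_sq_le_sq_mul_sq _ _ _
    _ = z.re * ∫ ω, ‖Y ω‖ ^ 2 ∂surf n := by rw [hz', hc, mul_comm]
    _ ≤ _ := by
        gcongr
        rw [le_div_iff₀ hσ, mul_comm, ← hd]
        exact hdim

end Dimension

/-! ### Plane waves against harmonics: preservation of degree and decay at low frequency -/

section PlaneWaves

variable {n : ℕ}

/-- The linear polynomial `x ↦ x · y`. -/
def linPoly (y : Eucl n) : MvPolynomial (Fin n) ℂ :=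
  ∑ i, MvPolynomial.C ((y i : ℝ) : ℂ) * MvPolynomial.X i

theorem polyVal_linPoly (x y : Eucl n) : polyVal (linPoly y) x = ((inner ℝ x y : ℝ) : ℂ) := by
  simp only [linPoly, polyVal_sum, polyVal_mul, polyVal_C, polyVal_X, PiLp.inner_apply]
  push_cast
  simp

theorem totalDegree_linPoly_pow (y : Eucl n) (m : ℕ) : (linPoly y ^ m).totalDegree ≤ m := by
  have h : (linPoly y).IsHomogeneous 1 := MvPolynomial.IsHomogeneous.sum _ _ _ fun i _ => by
    simpa using (MvPolynomial.isHomogeneous_C (Fin n) ((y i : ℝ) : ℂ)).mul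
      (MvPolynomial.isHomogeneous_X ℂ i)
  simpa using (h.pow m).totalDegree_le

theorem pderiv_linPoly (y : Eucl n) (i : Fin n) :
    MvPolynomial.pderiv i (linPoly y) = MvPolynomial.C ((y i : ℝ) : ℂ) := by
  simp [linPoly, MvPolynomial.pderiv_X, Pi.single_apply]

theorem polyVal_rotField_rotField_linPoly (x y : Eucl n) (m : ℕ) {i j : Fin n} (hij : i ≠ j) :
    polyVal (rotField i j (rotField i j (linPoly y ^ m))) x =
      m * (m - 1 : ℕ) * (inner ℝ x y : ℝ) ^ (m - 2) * (x i * y j - x j * y i) ^ 2 -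
        m * (inner ℝ x y : ℝ) ^ (m - 1) * (x i * y i + x j * y j) := by
  have h1 : rotField i j (linPoly y ^ m) = (m : MvPolynomial (Fin n) ℂ) * linPoly y ^ (m - 1) *
      (MvPolynomial.C ((y j : ℝ) : ℂ) * MvPolynomial.X i -
        MvPolynomial.C ((y i : ℝ) : ℂ) * MvPolynomial.X j) := by
    simp only [rotField, MvPolynomial.pderiv_pow, pderiv_linPoly]; ring
  rw [h1]
  simp only [rotField, MvPolynomial.pderiv_mul, MvPolynomial.pderiv_pow, pderiv_linPoly, map_sub,
    MvPolynomial.pderiv_C, MvPolynomial.pderiv_X_self, MvPolynomial.pderiv_X_of_ne hij,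
    MvPolynomial.pderiv_X_of_ne hij.symm, Derivation.map_natCast]
  have hc : ∀ a : ℕ, polyVal (a : MvPolynomial (Fin n) ℂ) x = a := fun a => by simp [polyVal]
  have h0 : polyVal (0 : MvPolynomial (Fin n) ℂ) x = 0 := by simp [polyVal]
  have h1 : polyVal (1 : MvPolynomial (Fin n) ℂ) x = 1 := by simp [polyVal]
  simp only [polyVal_sub, polyVal_add, polyVal_mul, polyVal_pow, polyVal_C, polyVal_X,
    polyVal_linPoly, hc, h0, h1, Nat.sub_sub, one_add_one_eq_two]
  ring

/-- Zonal kernels have the same angular Laplacian in either variable, since the explicit formula for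
each rotation field is symmetric in x and y. -/
theorem polyVal_angularLaplacian_linPoly_comm (x y : Eucl n) (m : ℕ) :
    polyVal (angularLaplacian (linPoly y ^ m)) x = polyVal (angularLaplacian (linPoly x ^ m)) y := by
  simp only [angularLaplacian, polyVal_sum]
  refine Finset.sum_congr rfl fun i _ => Finset.sum_congr rfl fun j hj => ?_
  have hij : i ≠ j := (Finset.mem_Ioi.1 hj).ne
  rw [polyVal_rotField_rotField_linPoly _ _ _ hij, polyVal_rotField_rotField_linPoly _ _ _ hij,
    real_inner_comm]
  ring

theorem continuous_polyVal_angularLaplacian_linPoly (m : ℕ) :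
    Continuous fun q : Eucl n × Eucl n => polyVal (angularLaplacian (linPoly q.2 ^ m)) q.1 := by
  simp only [angularLaplacian, polyVal_sum]
  refine continuous_finsetSum _ fun i _ => continuous_finsetSum _ fun j hj => ?_
  simp only [polyVal_rotField_rotField_linPoly _ _ _ (Finset.mem_Ioi.1 hj).ne]
  fun_prop

variable [Fact (2 ≤ n)]

theorem integrable_sphere_prod {E : Type*} [NormedAddCommGroup E] {f : Sph n × Sph n → E}
    (hf : Continuous f) : Integrable f ((surf n).prod (surf n)) :=
  hf.integrable_of_hasCompactSupport (HasCompactSupport.of_compactSpace f)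

/-- The Laplacian of the zonal kernel can be moved onto Y or onto Z, so the integral times either
eigenvalue is the same number. -/
theorem integral_inner_pow_mul_eq_zero {k l : ℕ} (hkl : k ≠ l) {Y Z : C(Sph n, ℂ)}
    (hY : Y ∈ sphericalHarmonics n k) (hZ : Z ∈ sphericalHarmonics n l) (m : ℕ) :
    ∫ q : Sph n × Sph n, ((inner ℝ (q.1 : Eucl n) (q.2 : Eucl n) : ℝ) : ℂ) ^ m * (Y q.1 * Z q.2)
      ∂(surf n).prod (surf n) = 0 := by
  obtain ⟨p, hp, rfl⟩ := hY
  obtain ⟨r, hr, rfl⟩ := hZ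
  have hcont : Continuous fun q : Sph n × Sph n =>
      polyVal (angularLaplacian (linPoly (q.2 : Eucl n) ^ m)) (q.1 : Eucl n) *
        (polyVal p q.1 * polyVal r q.2) := by
    have := (continuous_polyVal_angularLaplacian_linPoly (n := n) m).comp
      (f := fun q : Sph n × Sph n => ((q.1 : Eucl n), (q.2 : Eucl n))) (by fun_prop)
    simp only [Function.comp_def] at this
    fun_prop
  have h1 : ∫ q : Sph n × Sph n, polyVal (angularLaplacian (linPoly (q.2 : Eucl n) ^ m)) (q.1 : Eucl n) *
        (polyVal p q.1 * polyVal r q.2) ∂(surf n).prod (surf n) = ((-sphEigenvalue n k : ℝ) : ℂ) *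
      ∫ q : Sph n × Sph n, ((inner ℝ (q.1 : Eucl n) (q.2 : Eucl n) : ℝ) : ℂ) ^ m *
        (polyVal p q.1 * polyVal r q.2) ∂(surf n).prod (surf n) := by
    rw [integral_prod_symm _ (integrable_sphere_prod hcont),
      integral_prod_symm _ (integrable_sphere_prod (by fun_prop)), ← integral_const_mul]
    refine integral_congr_ae (Filter.Eventually.of_forall fun θ => ?_)
    simp only [← mul_assoc]
    rw [integral_mul_const, integral_mul_const, integral_angularLaplacian_mul_comm,
      angularLaplacian_eq hp, ← mul_assoc, ← integral_const_mul]
    congr 2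
    ext ω
    rw [polyVal_smul, polyVal_pow, polyVal_linPoly]; ring
  have h2 : ∫ q : Sph n × Sph n, polyVal (angularLaplacian (linPoly (q.2 : Eucl n) ^ m)) (q.1 : Eucl n) *
        (polyVal p q.1 * polyVal r q.2) ∂(surf n).prod (surf n) = ((-sphEigenvalue n l : ℝ) : ℂ) *
      ∫ q : Sph n × Sph n, ((inner ℝ (q.1 : Eucl n) (q.2 : Eucl n) : ℝ) : ℂ) ^ m *
        (polyVal p q.1 * polyVal r q.2) ∂(surf n).prod (surf n) := by
    rw [integral_prod _ (integrable_sphere_prod hcont),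
      integral_prod _ (integrable_sphere_prod (by fun_prop)), ← integral_const_mul]
    refine integral_congr_ae (Filter.Eventually.of_forall fun ω => ?_)
    simp only [polyVal_angularLaplacian_linPoly_comm (ω : Eucl n), mul_left_comm _ (polyVal p _)]
    rw [integral_const_mul, integral_const_mul, integral_angularLaplacian_mul_comm,
      angularLaplacian_eq hr, mul_left_comm]
    congr 1
    rw [← integral_const_mul]
    refine integral_congr_ae (Filter.Eventually.of_forall fun θ => ?_)
    simp only
    rw [polyVal_smul, polyVal_pow, polyVal_linPoly, real_inner_comm]; ring
  rw [h1, ← sub_eq_zero, ← sub_mul] at h2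
  refine (mul_eq_zero.1 h2).resolve_left ?_
  rw [sub_eq_zero]
  intro h
  exact hkl (sphEigenvalue_strictMono.injective (neg_injective (Complex.ofReal_injective h)))

/-- The exponential series is integrated term by term; each power of the inner product contributes
zero. -/
theorem integral_exp_inner_mul_eq_zero {k l : ℕ} (hkl : k ≠ l) {Y Z : C(Sph n, ℂ)}
    (hY : Y ∈ sphericalHarmonics n k) (hZ : Z ∈ sphericalHarmonics n l) (z : ℂ) :
    ∫ q : Sph n × Sph n, Complex.exp (z * (inner ℝ (q.1 : Eucl n) (q.2 : Eucl n) : ℝ)) *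
      (Y q.1 * Z q.2) ∂(surf n).prod (surf n) = 0 := by
  set F : ℕ → Sph n × Sph n → ℂ := fun m q =>
    (z * (inner ℝ (q.1 : Eucl n) (q.2 : Eucl n) : ℝ)) ^ m / m.factorial * (Y q.1 * Z q.2) with hF
  have hFi : ∀ m, Integrable (F m) ((surf n).prod (surf n)) := fun m =>
    integrable_sphere_prod (by fun_prop)
  have hF0 : ∀ m, ∫ q, F m q ∂(surf n).prod (surf n) = 0 := by
    intro m
    have h := integral_inner_pow_mul_eq_zero hkl hY hZ m
    have : ∀ q, F m q = z ^ m / m.factorial *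
        (((inner ℝ (q.1 : Eucl n) (q.2 : Eucl n) : ℝ) : ℂ) ^ m * (Y q.1 * Z q.2)) := fun q => by
      simp only [hF]; rw [mul_pow]; ring
    simp only [this]
    rw [integral_const_mul, h, mul_zero]
  have hbound : ∀ m, ∫ q, ‖F m q‖ ∂(surf n).prod (surf n) ≤
      ‖z‖ ^ m / m.factorial * ∫ q, ‖Y q.1 * Z q.2‖ ∂(surf n).prod (surf n) := by
    intro m
    rw [← integral_const_mul]
    refine integral_mono (hFi m).norm (integrable_sphere_prod (by fun_prop)) fun q => ?_
    simp only [hF, norm_mul, norm_div, norm_pow, Complex.norm_natCast, Complex.norm_real]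
    gcongr
    refine mul_le_of_le_one_right (norm_nonneg _) ?_
    refine (norm_inner_le_norm _ _).trans ?_
    simp
  have hs : Summable fun m => ∫ q, ‖F m q‖ ∂(surf n).prod (surf n) :=
    Summable.of_nonneg_of_le (fun m => integral_nonneg fun _ => norm_nonneg _) hbound
      ((Real.summable_pow_div_factorial ‖z‖).mul_right _)
  have h := hasSum_integral_of_summable_integral_norm hFi hs
  simp only [hF0] at h
  have h2 := h.unique hasSum_zero
  rw [← h2]
  refine integral_congr_ae (Filter.Eventually.of_forall fun q => ?_)
  simp only [hF]
  rw [tsum_mul_right, Complex.exp_eq_exp_ℂ, NormedSpace.exp_eq_tsum_div]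

/-- The Fourier transform of the measure `g dω` on the sphere. -/
def sphFourier (g : C(Sph n, ℂ)) (ξ : Eucl n) : ℂ :=
  ∫ ω : Sph n, Complex.exp (((-2 * Real.pi * inner ℝ (ω : Eucl n) ξ : ℝ) : ℂ) * Complex.I) * g ω ∂surf n

theorem continuous_integral_sphere {X : Type*} [TopologicalSpace X] [FirstCountableTopology X]
    [LocallyCompactSpace X] {f : X → Sph n → ℂ} (hf : Continuous f.uncurry) :
    Continuous fun x => ∫ ω, f x ω ∂surf n := by
  have := continuous_parametric_integral_of_continuous (μ := surf n) hf (isCompact_univ)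
  simpa only [Measure.restrict_univ] using! this

@[fun_prop]
theorem continuous_sphFourier (g : C(Sph n, ℂ)) : Continuous (sphFourier g) :=
  continuous_integral_sphere (by simp only [Function.uncurry_def]; fun_prop)

/-- The restriction of `sphFourier g` to the sphere of radius `ρ`. -/
def sphFourierOn (g : C(Sph n, ℂ)) (ρ : ℝ) : C(Sph n, ℂ) where
  toFun θ := sphFourier g (ρ • (θ : Eucl n))

/-- The qualitative part of the Funk–Hecke formula: the plane wave kernel pairs Y to zero with every
other degree, so by completeness the result has degree k. No Bessel functions are needed. -/
theorem sphFourierOn_mem {k : ℕ} {Y : C(Sph n, ℂ)} (hY : Y ∈ sphericalHarmonics n k) (ρ : ℝ) :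
    sphFourierOn Y ρ ∈ sphericalHarmonics n k := by
  refine mem_sphericalHarmonics_of_pairing fun l hl Z hZ => ?_
  have h := integral_exp_inner_mul_eq_zero hl.symm hY hZ (((-2 * Real.pi * ρ : ℝ) : ℂ) * Complex.I)
  rw [integral_prod_symm _ (integrable_sphere_prod (by fun_prop))] at h
  rw [← h]
  refine integral_congr_ae (Filter.Eventually.of_forall fun θ => ?_)
  simp only [sphFourierOn, ContinuousMap.coe_mk, sphFourier, ← mul_assoc]
  rw [integral_mul_const]
  congr 2
  ext ω
  congr 2
  rw [inner_smul_right]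
  push_cast; ring

/-- Cauchy–Schwarz against the constant 1. -/
theorem norm_integral_sphere_le (g : C(Sph n, ℂ)) :
    ∫ ω, ‖g ω‖ ∂surf n ≤ Real.sqrt ((surf n).real univ) * ‖toL2 n g‖ := by
  set a : C(Sph n, ℂ) := ⟨fun ω => ((‖g ω‖ : ℝ) : ℂ), by fun_prop⟩ with ha
  have h := norm_inner_le_norm (𝕜 := ℂ) (toL2 n 1) (toL2 n a)
  have h1 : ‖toL2 n 1‖ = Real.sqrt ((surf n).real univ) := by
    rw [eq_comm, Real.sqrt_eq_iff_mul_self_eq measureReal_nonneg (norm_nonneg _), ← pow_two,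
      norm_sq_toL2]
    simp
  have h2 : ‖toL2 n a‖ = ‖toL2 n g‖ := by
    rw [← sq_eq_sq₀ (norm_nonneg _) (norm_nonneg _), norm_sq_toL2, norm_sq_toL2]
    simp [ha]
  rw [inner_toL2, h1, h2] at h
  refine le_trans (le_of_eq ?_) h
  simp only [ha, ContinuousMap.coe_mk, ContinuousMap.one_apply, map_one, mul_one]
  rw [integral_complex_ofReal, Complex.norm_real, Real.norm_of_nonneg]
  exact integral_nonneg fun _ => norm_nonneg _

theorem norm_sphFourier_le (g : C(Sph n, ℂ)) (ξ : Eucl n) :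
    ‖sphFourier g ξ‖ ≤ ∫ ω, ‖g ω‖ ∂surf n := by
  refine (norm_integral_le_integral_norm _).trans_eq ?_
  simp [Complex.norm_exp]

/-- Y is orthogonal to the Taylor terms of the plane wave of degree below k, so only the remainder
of the exponential series contributes. The smallness of ξ bounds that remainder by twice its leading
term. -/
theorem norm_sphFourier_le_factorial {k : ℕ} {Y : C(Sph n, ℂ)} (hY : Y ∈ sphericalHarmonics n k)
    {ξ : Eucl n} (hξ : 2 * Real.pi * ‖ξ‖ / (k + 1) ≤ 1 / 2) :
    ‖sphFourier Y ξ‖ ≤ (2 * Real.pi * ‖ξ‖) ^ k / k.factorial * 2 * ∫ ω, ‖Y ω‖ ∂surf n := by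
  set x : Sph n → ℂ := fun ω =>
    ((-2 * Real.pi * inner ℝ (ω : Eucl n) ξ : ℝ) : ℂ) * Complex.I with hx
  have hxc : Continuous x := by fun_prop
  have hxn : ∀ ω, ‖x ω‖ ≤ 2 * Real.pi * ‖ξ‖ := by
    intro ω
    simp only [hx, norm_mul, Complex.norm_I, mul_one, Complex.norm_real, norm_neg,
      Real.norm_ofNat, Real.norm_of_nonneg Real.pi_pos.le]
    gcongr
    refine (norm_inner_le_norm _ _).trans ?_
    simp
  have h0 : ∫ ω, (∑ m ∈ Finset.range k, x ω ^ m / m.factorial) * Y ω ∂surf n = 0 := by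
    simp only [Finset.sum_mul]
    rw [integral_finsetSum _ fun m _ => integrable_sphere (by fun_prop)]
    refine Finset.sum_eq_zero fun m hm => ?_
    have h1 := integral_polyVal_mul_eq_zero
      ((totalDegree_linPoly_pow ξ m).trans_lt (Finset.mem_range.1 hm)) hY
    have h2 : ∀ ω, x ω ^ m / m.factorial * Y ω =
        (((-2 * Real.pi : ℝ) : ℂ) * Complex.I) ^ m / m.factorial *
          (polyVal (linPoly ξ ^ m) (ω : Eucl n) * Y ω) := by
      intro ω
      simp only [hx, polyVal_pow, polyVal_linPoly]
      push_cast
      ring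
    simp only [h2]
    rw [integral_const_mul, h1, mul_zero]
  have h1 : sphFourier Y ξ = ∫ ω, (Complex.exp (x ω) -
      ∑ m ∈ Finset.range k, x ω ^ m / m.factorial) * Y ω ∂surf n := by
    simp only [sub_mul]
    rw [integral_sub (integrable_sphere (by fun_prop)) (integrable_sphere (by fun_prop)), h0,
      sub_zero]
    rfl
  rw [h1, ← integral_const_mul]
  refine (norm_integral_le_integral_norm _).trans (integral_mono
    (integrable_sphere (by fun_prop)) (integrable_sphere (by fun_prop)) fun ω => ?_)
  simp only [norm_mul]
  gcongr
  refine (Complex.exp_bound' (le_trans ?_ hξ)).trans ?_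
  · push_cast
    gcongr
    exact hxn ω
  · gcongr
    exact hxn ω

/-- For k ≥ 1 the hypothesis gives 2π|ξ| ≤ k/6, and k^k/k! ≤ e^k ≤ 3^k, so the remainder is at most
(3/6)^k. -/
theorem norm_sphFourier_le_two_pow {k : ℕ} {Y : C(Sph n, ℂ)} (hY : Y ∈ sphericalHarmonics n k)
    {ξ : Eucl n} (hξ : 2 * Real.pi * ‖ξ‖ ≤ (k + 1) / 12) :
    ‖sphFourier Y ξ‖ ≤ (1 / 2) ^ k * 2 * ∫ ω, ‖Y ω‖ ∂surf n := by
  have hT : 0 ≤ 2 * Real.pi * ‖ξ‖ := by positivity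
  refine (norm_sphFourier_le_factorial hY ?_).trans ?_
  · rw [div_le_iff₀ (by positivity)]; linarith [(k.cast_nonneg : (0 : ℝ) ≤ k)]
  · have hI : 0 ≤ ∫ ω, ‖Y ω‖ ∂surf n := integral_nonneg fun _ => norm_nonneg _
    gcongr
    rcases Nat.eq_zero_or_pos k with rfl | hk
    · simp
    · have hk1 : (1 : ℝ) ≤ k := by exact_mod_cast hk
      have h1 : (k : ℝ) ^ k / k.factorial ≤ Real.exp k :=
        Real.pow_div_factorial_le_exp _ k.cast_nonneg k
      have h2 : Real.exp k ≤ 3 ^ k := by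
        rw [← Real.exp_one_pow]
        gcongr
        linarith [Real.exp_one_lt_d9]
      calc (2 * Real.pi * ‖ξ‖) ^ k / k.factorial ≤ ((1 / 6) * k) ^ k / k.factorial := by
            exact div_le_div_of_nonneg_right (pow_le_pow_left₀ hT (by linarith) k) (by positivity)
        _ = (1 / 6) ^ k * ((k : ℝ) ^ k / k.factorial) := by rw [mul_pow]; ring
        _ ≤ (1 / 6) ^ k * 3 ^ k := by gcongr; exact h1.trans h2
        _ = (1 / 2) ^ k := by rw [← mul_pow]; norm_num

/-- Rapid decay of `sphFourier Y` in the degree of the spherical harmonic `Y`. -/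
theorem exists_norm_sphFourier_le (n N : ℕ) [Fact (2 ≤ n)] : ∃ C : ℝ, 0 ≤ C ∧
    ∀ (k : ℕ) (Y : C(Sph n, ℂ)), Y ∈ sphericalHarmonics n k → ∀ ξ : Eucl n,
      ‖sphFourier Y ξ‖ ≤ C * ((1 + ‖ξ‖) / (k + 1)) ^ N * ‖toL2 n Y‖ := by
  obtain ⟨B, hB⟩ : ∃ B : ℝ, ∀ k : ℕ, ((k : ℝ) + 1) ^ N * (1 / 2) ^ k ≤ B := by
    have h := (tendsto_pow_const_mul_const_pow_of_abs_lt_one N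
      (r := 1 / 2) (by rw [abs_of_pos] <;> norm_num)).comp (Filter.tendsto_add_atTop_nat 1)
    obtain ⟨B, hB⟩ := h.bddAbove_range
    refine ⟨B * 2, fun k => ?_⟩
    have := hB ⟨k, rfl⟩
    simp only [Function.comp] at this
    push_cast at this
    rw [pow_succ] at this
    linarith
  have hB0 : 0 ≤ B := le_trans (by positivity) (hB 0)
  set σ := Real.sqrt ((surf n).real univ) with hσ
  have hσ0 : 0 ≤ σ := Real.sqrt_nonneg _
  refine ⟨(2 * B + (24 * Real.pi) ^ N) * σ, by positivity, fun k Y hY ξ => ?_⟩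
  have hL1 := norm_integral_sphere_le Y
  have hk : (0 : ℝ) < k + 1 := by positivity
  have hmain : ∀ a : ℝ, ‖sphFourier Y ξ‖ ≤ a * ∫ ω, ‖Y ω‖ ∂surf n → 0 ≤ a →
      a ≤ (2 * B + (24 * Real.pi) ^ N) * ((1 + ‖ξ‖) / (k + 1)) ^ N →
      ‖sphFourier Y ξ‖ ≤ (2 * B + (24 * Real.pi) ^ N) * σ * ((1 + ‖ξ‖) / (k + 1)) ^ N *
        ‖toL2 n Y‖ := by
    intro a h1 h2 h3
    calc _ ≤ a * (σ * ‖toL2 n Y‖) := h1.trans (by gcongr)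
      _ ≤ (2 * B + (24 * Real.pi) ^ N) * ((1 + ‖ξ‖) / (k + 1)) ^ N * (σ * ‖toL2 n Y‖) := by gcongr
      _ = _ := by ring
  -- At low frequency 2^{-k} beats (k+1)^{-N}. Otherwise 24π(1+|ξ|)/(k+1) ≥ 1, and the trivial bound
  -- suffices.
  by_cases hξ : 2 * Real.pi * ‖ξ‖ ≤ (k + 1) / 12
  · refine hmain _ (norm_sphFourier_le_two_pow hY hξ) (by positivity) ?_
    have h1 : (1 / 2 : ℝ) ^ k ≤ B * (1 / (k + 1)) ^ N := by
      rw [one_div_pow ((k : ℝ) + 1), mul_one_div, le_div_iff₀ (by positivity), mul_comm]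
      exact hB k
    have h2 : (1 / ((k : ℝ) + 1)) ^ N ≤ ((1 + ‖ξ‖) / (k + 1)) ^ N := by
      gcongr; linarith [norm_nonneg ξ]
    have h3 : (0 : ℝ) ≤ (24 * Real.pi) ^ N * ((1 + ‖ξ‖) / (k + 1)) ^ N := by positivity
    nlinarith [mul_le_mul_of_nonneg_left h2 hB0]
  · refine hmain 1 (by simpa using norm_sphFourier_le Y ξ) zero_le_one ?_
    push Not at hξ
    have h1 : 1 ≤ 24 * Real.pi * ((1 + ‖ξ‖) / (k + 1)) := by
      rw [← mul_div_assoc, le_div_iff₀ hk]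
      nlinarith [Real.pi_pos]
    have h2 := one_le_pow₀ h1 (n := N)
    rw [mul_pow] at h2
    have h3 : (0 : ℝ) ≤ 2 * B * ((1 + ‖ξ‖) / (k + 1)) ^ N := by positivity
    linarith

end PlaneWaves

/-! ### The Agmon–Hörmander bound -/

section Gaussian

variable {n : ℕ} [Fact (2 ≤ n)]

theorem integrable_gaussian {a : ℝ} (ha : 0 < a) :
    Integrable fun x : Eucl n => Real.exp (-a * ‖x‖ ^ 2) := by
  have h := (GaussianFourier.integrable_cexp_neg_mul_sq_norm_add (V := Eucl n) (b := (a : ℂ))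
    (by simpa using ha) 0 0).norm
  refine h.congr (Filter.Eventually.of_forall fun x => ?_)
  simp only [inner_zero_left, Complex.ofReal_zero, mul_zero, add_zero, Complex.norm_exp]
  congr 1
  rw [← Complex.ofReal_pow, ← Complex.ofReal_neg, ← Complex.ofReal_mul, Complex.ofReal_re]

theorem lintegral_gaussian {a : ℝ} (ha : 0 < a) (y : Eucl n) :
    ∫⁻ x : Eucl n, ENNReal.ofReal (Real.exp (-a * ‖x - y‖ ^ 2)) =
      ENNReal.ofReal ((Real.pi / a) ^ (n / 2 : ℝ)) := by
  rw [lintegral_sub_right_eq_self (fun x : Eucl n => ENNReal.ofReal (Real.exp (-a * ‖x‖ ^ 2))) y,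
    ← ofReal_integral_eq_lintegral_ofReal (integrable_gaussian ha)
      (Filter.Eventually.of_forall fun x => (Real.exp_pos _).le),
    GaussianFourier.integral_rexp_neg_mul_sq_norm ha]
  simp

/-- The sphere is thickened to the shell 1 < r ≤ 1 + 1/R. A radial shift of size 1/R changes the
exponent by a bounded amount once its constant π is halved, so 1/R times the integral is controlled
by a Gaussian integral over ℝⁿ. -/
theorem lintegral_sphere_gaussian_le {R : ℝ} (hR : 0 < R) (ω : Sph n) :
    ∫⁻ θ : Sph n, ENNReal.ofReal (Real.exp (-Real.pi * R ^ 2 * ‖(θ : Eucl n) - ω‖ ^ 2)) ∂surf n ≤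
      ENNReal.ofReal (Real.exp Real.pi * R * (2 / R ^ 2) ^ (n / 2 : ℝ)) := by
  have hpi := Real.pi_pos
  set J := ∫⁻ θ : Sph n,
    ENNReal.ofReal (Real.exp (-Real.pi * R ^ 2 * ‖(θ : Eucl n) - ω‖ ^ 2)) ∂surf n with hJ
  have h1 := lintegral_gaussian (n := n) (a := Real.pi / 2 * R ^ 2) (by positivity) ω
  rw [lintegral_polar (by fun_prop)] at h1
  have hpt : ∀ r ∈ Ioc (1 : ℝ) (1 + 1 / R), ∀ θ : Sph n,
      ENNReal.ofReal (Real.exp (-Real.pi)) *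
        ENNReal.ofReal (Real.exp (-Real.pi * R ^ 2 * ‖(θ : Eucl n) - ω‖ ^ 2)) ≤
      ENNReal.ofReal (Real.exp (-(Real.pi / 2 * R ^ 2) * ‖r • (θ : Eucl n) - ω‖ ^ 2)) := by
    intro r hr θ
    rw [← ENNReal.ofReal_mul (Real.exp_pos _).le, ← Real.exp_add]
    gcongr
    have h2 : ‖r • (θ : Eucl n) - ω‖ ≤ ‖(θ : Eucl n) - ω‖ + 1 / R := by
      have : r • (θ : Eucl n) - ω = ((θ : Eucl n) - ω) + (r - 1) • (θ : Eucl n) := by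
        rw [sub_smul, one_smul]; abel
      rw [this]
      refine (norm_add_le _ _).trans ?_
      rw [norm_smul, norm_eq_of_mem_sphere, mul_one, Real.norm_of_nonneg (by linarith [hr.1])]
      linarith [hr.2]
    have h3 : ‖r • (θ : Eucl n) - ω‖ ^ 2 ≤ 2 * ‖(θ : Eucl n) - ω‖ ^ 2 + 2 * (1 / R) ^ 2 := by
      have := pow_le_pow_left₀ (norm_nonneg _) h2 2
      nlinarith [sq_nonneg (‖(θ : Eucl n) - ω‖ - 1 / R)]
    have h4 : R ^ 2 * (1 / R) ^ 2 = 1 := by field_simp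
    have h5 := mul_le_mul_of_nonneg_left h3 (by positivity : 0 ≤ Real.pi / 2 * R ^ 2)
    nlinarith
  have h2 : ENNReal.ofReal (1 / R) * (ENNReal.ofReal (Real.exp (-Real.pi)) * J) ≤
      ENNReal.ofReal ((Real.pi / (Real.pi / 2 * R ^ 2)) ^ (n / 2 : ℝ)) := by
    rw [← h1]
    calc ENNReal.ofReal (1 / R) * (ENNReal.ofReal (Real.exp (-Real.pi)) * J)
        = ∫⁻ r in Ioc (1 : ℝ) (1 + 1 / R), ENNReal.ofReal (Real.exp (-Real.pi)) * J := by
          rw [setLIntegral_const, Real.volume_Ioc, add_sub_cancel_left, mul_comm]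
      _ ≤ ∫⁻ r in Ioc (1 : ℝ) (1 + 1 / R), ENNReal.ofReal (r ^ (n - 1)) * ∫⁻ θ : Sph n,
            ENNReal.ofReal (Real.exp (-(Real.pi / 2 * R ^ 2) * ‖r • (θ : Eucl n) - ω‖ ^ 2)) ∂surf n := by
          refine setLIntegral_mono' measurableSet_Ioc fun r hr => ?_
          refine le_trans ?_ (le_mul_of_one_le_left zero_le ?_)
          · rw [hJ, ← lintegral_const_mul _ (by fun_prop)]
            exact lintegral_mono fun θ => hpt r hr θ
          · rw [ENNReal.one_le_ofReal]
            exact one_le_pow₀ hr.1.le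
      _ ≤ _ := lintegral_mono_set fun r hr => lt_trans one_pos hr.1
  have h3 : Real.pi / (Real.pi / 2 * R ^ 2) = 2 / R ^ 2 := by field_simp
  rw [h3] at h2
  calc J = ENNReal.ofReal (Real.exp Real.pi * R) *
        (ENNReal.ofReal (1 / R) * (ENNReal.ofReal (Real.exp (-Real.pi)) * J)) := by
        rw [← mul_assoc, ← mul_assoc, ← ENNReal.ofReal_mul (by positivity),
          ← ENNReal.ofReal_mul (by positivity)]
        have : Real.exp Real.pi * R * (1 / R) * Real.exp (-Real.pi) = 1 := by
          rw [Real.exp_neg]; field_simp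
        rw [this, ENNReal.ofReal_one, one_mul]
    _ ≤ _ := by
        rw [ENNReal.ofReal_mul (by positivity : 0 ≤ Real.exp Real.pi * R)]
        gcongr

theorem sq_div_rpow {R : ℝ} (hR : 0 < R) : (2 / R ^ 2) ^ (n / 2 : ℝ) = 2 ^ (n / 2 : ℝ) / R ^ n := by
  rw [Real.div_rpow (by norm_num) (by positivity), ← Real.rpow_natCast R 2, ← Real.rpow_mul hR.le,
    ← Real.rpow_natCast R n]
  congr 2
  push_cast; ring

theorem integral_sphere_gaussian_le {R : ℝ} (hR : 0 < R) (ω : Sph n) :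
    R ^ n * ∫ θ : Sph n, Real.exp (-Real.pi * R ^ 2 * ‖(θ : Eucl n) - ω‖ ^ 2) ∂surf n ≤
      Real.exp Real.pi * 2 ^ (n / 2 : ℝ) * R := by
  have h := lintegral_sphere_gaussian_le hR ω
  rw [← ofReal_integral_eq_lintegral_ofReal (integrable_sphere (by fun_prop))
    (Filter.Eventually.of_forall fun x => (Real.exp_pos _).le),
    ENNReal.ofReal_le_ofReal_iff (by positivity), sq_div_rpow hR] at h
  calc _ ≤ R ^ n * (Real.exp Real.pi * R * (2 ^ (n / 2 : ℝ) / R ^ n)) := by gcongr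
    _ = _ := by field_simp

theorem norm_integral_gaussian_exp {R : ℝ} (hR : 0 < R) (y : Eucl n) :
    ‖∫ ξ : Eucl n, Complex.exp (((-2 * Real.pi * inner ℝ ξ y : ℝ) : ℂ) * Complex.I) *
      (Real.exp (-(Real.pi / R ^ 2) * ‖ξ‖ ^ 2) : ℝ)‖ =
      R ^ n * Real.exp (-Real.pi * R ^ 2 * ‖y‖ ^ 2) := by
  have hb : 0 < Real.pi / R ^ 2 := by positivity
  have h := fourier_gaussian_innerProductSpace (V := Eucl n) (b := ((Real.pi / R ^ 2 : ℝ) : ℂ))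
    (by simpa only [Complex.ofReal_re] using hb) y
  rw [Real.fourier_eq'] at h
  have h2 : ∀ ξ : Eucl n, Complex.exp (((-2 * Real.pi * inner ℝ ξ y : ℝ) : ℂ) * Complex.I) *
      (Real.exp (-(Real.pi / R ^ 2) * ‖ξ‖ ^ 2) : ℝ) =
      Complex.exp (((-2 * Real.pi * inner ℝ ξ y : ℝ) : ℂ) * Complex.I) •
        Complex.exp (-((Real.pi / R ^ 2 : ℝ) : ℂ) * (‖ξ‖ : ℂ) ^ 2) := by
    intro ξ
    rw [smul_eq_mul]
    push_cast
    rfl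
  simp only [h2, h]
  have h3 : (Real.pi : ℂ) / ((Real.pi / R ^ 2 : ℝ) : ℂ) = ((R ^ 2 : ℝ) : ℂ) := by
    rw [← Complex.ofReal_div]
    congr 1
    have := Real.pi_pos
    field_simp
  rw [h3, norm_mul, Complex.norm_cpow_eq_rpow_re_of_pos (by positivity), Complex.norm_exp]
  congr 1
  · rw [← Real.rpow_natCast R 2, ← Real.rpow_mul hR.le, ← Real.rpow_natCast R n]
    congr 1
    simp
    norm_cast
    ring
  · congr 1
    have : (-(Real.pi : ℂ) ^ 2 * (‖y‖ : ℂ) ^ 2 / ((Real.pi / R ^ 2 : ℝ) : ℂ)) =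
        ((-Real.pi * R ^ 2 * ‖y‖ ^ 2 : ℝ) : ℂ) := by
      have h0 : (Real.pi : ℂ) ≠ 0 := by exact_mod_cast Real.pi_pos.ne'
      have h1 : (R : ℂ) ≠ 0 := by exact_mod_cast hR.ne'
      push_cast
      field_simp
    rw [this, Complex.ofReal_re]

theorem sphFourier_mul_conj (g : C(Sph n, ℂ)) (ξ : Eucl n) :
    ((‖sphFourier g ξ‖ ^ 2 : ℝ) : ℂ) = ∫ q : Sph n × Sph n,
      Complex.exp (((-2 * Real.pi * inner ℝ ξ ((q.1 : Eucl n) - q.2) : ℝ) : ℂ) * Complex.I) *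
        (g q.1 * starRingEnd ℂ (g q.2)) ∂(surf n).prod (surf n) := by
  rw [← Complex.normSq_eq_norm_sq, ← Complex.mul_conj]
  conv_lhs => rw [sphFourier, ← integral_conj, ← integral_prod_mul]
  refine integral_congr_ae (Filter.Eventually.of_forall fun q => ?_)
  simp only [map_mul, ← Complex.exp_conj, Complex.conj_ofReal, Complex.conj_I]
  rw [mul_mul_mul_comm, ← Complex.exp_add, inner_sub_right, real_inner_comm, real_inner_comm ξ]
  congr 2
  push_cast
  ring

theorem integrable_gaussian_mul_sq (g : C(Sph n, ℂ)) {a : ℝ} (ha : 0 < a) :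
    Integrable fun ξ : Eucl n => Real.exp (-a * ‖ξ‖ ^ 2) * ‖sphFourier g ξ‖ ^ 2 := by
  refine ((integrable_gaussian ha).mul_const ((∫ ω, ‖g ω‖ ∂surf n) ^ 2)).mono'
    (Continuous.aestronglyMeasurable (by fun_prop)) (Filter.Eventually.of_forall fun ξ => ?_)
  rw [Real.norm_of_nonneg (by positivity)]
  gcongr
  exact norm_sphFourier_le g ξ

/-- The Agmon-Hörmander bound, with a Gaussian weight. -/
theorem integral_gaussian_sphFourier_le (g : C(Sph n, ℂ)) {R : ℝ} (hR : 0 < R) :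
    ∫ ξ : Eucl n, Real.exp (-(Real.pi / R ^ 2) * ‖ξ‖ ^ 2) * ‖sphFourier g ξ‖ ^ 2 ≤
      Real.exp Real.pi * 2 ^ (n / 2 : ℝ) * R * ‖toL2 n g‖ ^ 2 := by
  have ha : 0 < Real.pi / R ^ 2 := by have := Real.pi_pos; positivity
  set G : Eucl n → ℝ := fun ξ => Real.exp (-(Real.pi / R ^ 2) * ‖ξ‖ ^ 2) with hG
  have hGi : Integrable G := integrable_gaussian ha
  have hGc : Continuous G := by fun_prop
  set Φ : Eucl n → Sph n × Sph n → ℂ := fun ξ q =>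
    (G ξ : ℂ) * (Complex.exp (((-2 * Real.pi * inner ℝ ξ ((q.1 : Eucl n) - q.2) : ℝ) : ℂ) *
      Complex.I) * (g q.1 * starRingEnd ℂ (g q.2))) with hΦ
  have hΦi : Integrable (Function.uncurry Φ) (volume.prod ((surf n).prod (surf n))) := by
    have h1 : Integrable (fun q : Sph n × Sph n => ‖g q.1 * starRingEnd ℂ (g q.2)‖)
      ((surf n).prod (surf n)) := integrable_sphere_prod (by fun_prop)
    refine (hGi.mul_prod h1).mono' ?_ (Filter.Eventually.of_forall fun z => ?_)
    · refine Continuous.aestronglyMeasurable ?_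
      simp only [hΦ, Function.uncurry_def]
      fun_prop
    · simp only [hΦ, Function.uncurry_def, norm_mul, Complex.norm_exp_ofReal_mul_I, one_mul,
        Complex.norm_real]
      rw [Real.norm_of_nonneg (Real.exp_pos _).le]
  -- Expanding the square and applying Fubini leaves a double integral over the sphere, whose kernel
  -- is the Fourier transform of the Gaussian at the difference of the two points.
  have h1 : ((∫ ξ : Eucl n, G ξ * ‖sphFourier g ξ‖ ^ 2 : ℝ) : ℂ) =
      ∫ q : Sph n × Sph n, (∫ ξ, Φ ξ q) ∂(surf n).prod (surf n) := by
    rw [← integral_integral_swap hΦi, ← integral_complex_ofReal]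
    refine integral_congr_ae (Filter.Eventually.of_forall fun ξ => ?_)
    simp only [hΦ]
    rw [integral_const_mul, ← sphFourier_mul_conj, Complex.ofReal_mul]
  set K : Sph n → Sph n → ℝ := fun ω θ =>
    R ^ n * Real.exp (-Real.pi * R ^ 2 * ‖(ω : Eucl n) - θ‖ ^ 2) with hK
  have h2 : ∀ q : Sph n × Sph n, ‖∫ ξ, Φ ξ q‖ = K q.1 q.2 * (‖g q.1‖ * ‖g q.2‖) := by
    intro q
    have : ∀ ξ, Φ ξ q = (Complex.exp (((-2 * Real.pi * inner ℝ ξ ((q.1 : Eucl n) - q.2) : ℝ) : ℂ) *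
      Complex.I) * (G ξ : ℂ)) * (g q.1 * starRingEnd ℂ (g q.2)) := fun ξ => by
        simp only [hΦ]; ring
    simp only [this]
    rw [integral_mul_const, norm_mul, norm_integral_gaussian_exp hR, norm_mul, RCLike.norm_conj]
  have hKc : Continuous fun q : Sph n × Sph n => K q.1 q.2 := by simp only [hK]; fun_prop
  have hKle : ∀ ω, ∫ θ, K ω θ ∂surf n ≤ Real.exp Real.pi * 2 ^ (n / 2 : ℝ) * R := by
    intro ω
    simp only [hK]
    rw [integral_const_mul]
    refine le_trans (le_of_eq ?_) (integral_sphere_gaussian_le hR ω)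
    simp only [norm_sub_rev]
  have hKs : ∀ ω θ, K ω θ = K θ ω := fun ω θ => by simp only [hK, norm_sub_rev]
  have hhalf : ∫ q : Sph n × Sph n, K q.1 q.2 * ‖g q.1‖ ^ 2 ∂(surf n).prod (surf n) ≤
      Real.exp Real.pi * 2 ^ (n / 2 : ℝ) * R * ‖toL2 n g‖ ^ 2 := by
    rw [integral_prod _ (integrable_sphere_prod (by fun_prop)), norm_sq_toL2, ← integral_const_mul]
    refine integral_mono (integrable_sphere_prod (f := fun q : Sph n × Sph n =>
      K q.1 q.2 * ‖g q.1‖ ^ 2) (by fun_prop)).integral_prod_left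
      (integrable_sphere (by fun_prop)) fun ω => ?_
    simp only
    rw [integral_mul_const]
    gcongr
    exact hKle ω
  have hhalf' : ∫ q : Sph n × Sph n, K q.1 q.2 * ‖g q.2‖ ^ 2 ∂(surf n).prod (surf n) ≤
      Real.exp Real.pi * 2 ^ (n / 2 : ℝ) * R * ‖toL2 n g‖ ^ 2 := by
    rw [← integral_prod_swap]
    simp only [Prod.fst_swap, Prod.snd_swap, hKs]
    simpa only [hKs] using! hhalf
  have h3 : ∫ ξ : Eucl n, G ξ * ‖sphFourier g ξ‖ ^ 2 ≤
      ∫ q : Sph n × Sph n, K q.1 q.2 * (‖g q.1‖ * ‖g q.2‖) ∂(surf n).prod (surf n) := by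
    have h4 := congrArg norm h1
    rw [Complex.norm_real, Real.norm_of_nonneg (integral_nonneg fun ξ => by positivity)] at h4
    rw [h4]
    refine (norm_integral_le_integral_norm _).trans_eq ?_
    simp only [h2]
  refine h3.trans ?_
  -- Schur's test for a symmetric positive kernel, through 2ab ≤ a² + b².
  have h5 : ∫ q : Sph n × Sph n, K q.1 q.2 * (‖g q.1‖ * ‖g q.2‖) ∂(surf n).prod (surf n) ≤
      ∫ q : Sph n × Sph n, (K q.1 q.2 * ‖g q.1‖ ^ 2 / 2 + K q.1 q.2 * ‖g q.2‖ ^ 2 / 2)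
        ∂(surf n).prod (surf n) := by
    refine integral_mono (integrable_sphere_prod (by fun_prop))
      (integrable_sphere_prod (by fun_prop)) fun q => ?_
    have hK0 : 0 ≤ K q.1 q.2 := by simp only [hK]; positivity
    have := mul_le_mul_of_nonneg_left (two_mul_le_add_sq ‖g q.1‖ ‖g q.2‖) hK0
    simp only
    nlinarith
  rw [integral_add (integrable_sphere_prod (by fun_prop)) (integrable_sphere_prod (by fun_prop)),
    integral_div, integral_div] at h5
  linarith

end Gaussian

/-! ### The restriction estimate with weight |ξ|^{-b} -/

section RieszWeight

variable {n : ℕ} [Fact (2 ≤ n)]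

theorem lintegral_ball_rpow {b ρ : ℝ} (hb : b < n) (hρ : 0 ≤ ρ) :
    ∫⁻ ξ : Eucl n in {ξ | ‖ξ‖ ≤ ρ}, ENNReal.ofReal (‖ξ‖ ^ (-b)) =
      ENNReal.ofReal ((surf n).real univ * (ρ ^ (n - b) / (n - b))) := by
  have hn : 1 ≤ n := le_trans one_le_two Fact.out
  have hs : MeasurableSet {ξ : Eucl n | ‖ξ‖ ≤ ρ} := measurableSet_le (by fun_prop) (by fun_prop)
  rw [← lintegral_indicator hs, lintegral_polar (Measurable.indicator (by fun_prop) hs)]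
  have h1 : ∀ r ∈ Ioi (0 : ℝ), ENNReal.ofReal (r ^ (n - 1)) * ∫⁻ ω : Sph n,
      {ξ : Eucl n | ‖ξ‖ ≤ ρ}.indicator (fun ξ => ENNReal.ofReal (‖ξ‖ ^ (-b))) (r • (ω : Eucl n))
        ∂surf n = (Iic ρ).indicator (fun r => ENNReal.ofReal (r ^ (n - 1 - b))) r *
          surf n univ := by
    intro r hr
    have hr0 : 0 < r := hr
    have h2 : ∀ ω : Sph n, ‖r • (ω : Eucl n)‖ = r := fun ω => by
      rw [norm_smul, norm_eq_of_mem_sphere, mul_one, Real.norm_of_nonneg hr0.le]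
    simp only [indicator_apply, mem_ofPred_eq, h2, mem_Iic]
    split_ifs
    · rw [lintegral_const, ← mul_assoc, ← ENNReal.ofReal_mul (by positivity), ← Real.rpow_natCast,
        ← Real.rpow_add hr0, Nat.cast_sub hn, Nat.cast_one, ← sub_eq_add_neg]
    · simp
  rw [setLIntegral_congr_fun measurableSet_Ioi h1, lintegral_mul_const _
    (Measurable.indicator (by fun_prop) measurableSet_Iic), setLIntegral_indicator measurableSet_Iic,
    inter_comm, Ioi_inter_Iic]
  have hint : IntervalIntegrable (fun r : ℝ => r ^ (n - 1 - b)) volume 0 ρ :=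
    intervalIntegral.intervalIntegrable_rpow' (by linarith)
  rw [← ofReal_integral_eq_lintegral_ofReal, ← intervalIntegral.integral_of_le hρ,
    integral_rpow (Or.inl (by linarith)), mul_comm,
    ENNReal.ofReal_mul measureReal_nonneg, ofReal_measureReal]
  · congr 2
    rw [Real.zero_rpow (by linarith), sub_zero, show (n : ℝ) - 1 - b + 1 = n - b by ring]
  · rw [intervalIntegrable_iff_integrableOn_Ioc_of_le hρ] at hint
    exact hint
  · exact (ae_restrict_mem measurableSet_Ioc).mono fun r hr => Real.rpow_nonneg hr.1.le _

theorem exists_pow_mul_quarter_pow_le (N : ℕ) :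
    ∃ B : ℝ, 0 ≤ B ∧ ∀ k : ℕ, ((k : ℝ) + 1) ^ N * (1 / 4) ^ k ≤ B := by
  have h := (tendsto_pow_const_mul_const_pow_of_abs_lt_one N
    (r := 1 / 4) (by rw [abs_of_pos] <;> norm_num)).comp (Filter.tendsto_add_atTop_nat 1)
  obtain ⟨B, hB⟩ := h.bddAbove_range
  have h2 : ∀ k : ℕ, ((k : ℝ) + 1) ^ N * (1 / 4) ^ k ≤ B * 4 := fun k => by
    have := hB ⟨k, rfl⟩
    simp only [Function.comp] at this
    push_cast at this
    rw [pow_succ] at this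
    linarith
  exact ⟨B * 4, le_trans (by positivity) (h2 0), h2⟩

/-- The radius (k+1)/(24π) is the range of `norm_sphFourier_le_two_pow`. The weight integrates to a
multiple of (k+1)^{n-b}, and the factor 4^{-k} absorbs (k+1)^{n-1}, leaving (k+1)^{1-b}. -/
theorem exists_low_frequency_le {b : ℝ} (hbn : b < n) : ∃ C : ℝ, 0 ≤ C ∧
    ∀ (k : ℕ) (Y : C(Sph n, ℂ)), Y ∈ sphericalHarmonics n k →
      ∫⁻ ξ : Eucl n in {ξ | ‖ξ‖ ≤ (k + 1) / (24 * Real.pi)},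
        ENNReal.ofReal (‖ξ‖ ^ (-b)) * ‖sphFourier Y ξ‖ₑ ^ 2 ≤
          ENNReal.ofReal (C * (k + 1 : ℝ) ^ (1 - b) * ‖toL2 n Y‖ ^ 2) := by
  have hpi := Real.pi_pos
  have hn : 1 ≤ n := le_trans one_le_two Fact.out
  have hnb : 0 < n - b := by linarith
  obtain ⟨B, hB0, hB⟩ := exists_pow_mul_quarter_pow_le (n - 1)
  set σ := (surf n).real univ with hσ
  have hσ0 : 0 ≤ σ := measureReal_nonneg
  set c := 1 / (24 * Real.pi) with hc
  have hc0 : 0 < c := by positivity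
  refine ⟨σ * (c ^ (n - b) / (n - b)) * (4 * σ) * B, by positivity, fun k Y hY => ?_⟩
  have hk : (0 : ℝ) < k + 1 := by positivity
  have hρ : ((k : ℝ) + 1) / (24 * Real.pi) = c * (k + 1) := by rw [hc]; ring
  have hs : MeasurableSet {ξ : Eucl n | ‖ξ‖ ≤ (k + 1) / (24 * Real.pi)} :=
    measurableSet_le (by fun_prop) (by fun_prop)
  have hpt : ∀ ξ ∈ {ξ : Eucl n | ‖ξ‖ ≤ (k + 1) / (24 * Real.pi)},
      ENNReal.ofReal (‖ξ‖ ^ (-b)) * ‖sphFourier Y ξ‖ₑ ^ 2 ≤ ENNReal.ofReal (‖ξ‖ ^ (-b)) *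
        ENNReal.ofReal ((1 / 4) ^ k * (4 * σ) * ‖toL2 n Y‖ ^ 2) := by
    intro ξ hξ
    gcongr
    rw [← ofReal_norm, ← ENNReal.ofReal_pow (norm_nonneg _)]
    refine ENNReal.ofReal_le_ofReal ?_
    have h1 : 2 * Real.pi * ‖ξ‖ ≤ (k + 1) / 12 := by
      have : ‖ξ‖ ≤ (k + 1) / (24 * Real.pi) := hξ
      rw [le_div_iff₀ (by positivity)] at this
      linarith
    have h2 := (norm_sphFourier_le_two_pow hY h1).trans
      (mul_le_mul_of_nonneg_left (norm_integral_sphere_le Y) (by positivity))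
    refine (pow_le_pow_left₀ (norm_nonneg _) h2 2).trans_eq ?_
    rw [mul_pow, mul_pow, mul_pow, Real.sq_sqrt hσ0, ← pow_mul, mul_comm k 2, pow_mul]
    norm_num
    ring
  refine (setLIntegral_mono' hs hpt).trans ?_
  rw [lintegral_mul_const _ (by fun_prop), lintegral_ball_rpow hbn (by positivity),
    ← ENNReal.ofReal_mul (by positivity)]
  refine ENNReal.ofReal_le_ofReal ?_
  rw [hρ, Real.mul_rpow hc0.le hk.le]
  have h3 : ((k : ℝ) + 1) ^ ((n : ℝ) - b) * (1 / 4) ^ k ≤ B * (k + 1 : ℝ) ^ (1 - b) := by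
    have : ((k : ℝ) + 1) ^ ((n : ℝ) - b) = ((k : ℝ) + 1) ^ (n - 1) * (k + 1 : ℝ) ^ (1 - b) := by
      rw [← Real.rpow_natCast, ← Real.rpow_add hk, Nat.cast_sub hn]
      congr 1
      push_cast; ring
    rw [this, mul_right_comm]
    gcongr
    exact hB k
  calc _ = σ * (c ^ (n - b) / (n - b)) * (4 * σ) * (((k : ℝ) + 1) ^ ((n : ℝ) - b) * (1 / 4) ^ k) *
        ‖toL2 n Y‖ ^ 2 := by ring
    _ ≤ σ * (c ^ (n - b) / (n - b)) * (4 * σ) * (B * (k + 1 : ℝ) ^ (1 - b)) * ‖toL2 n Y‖ ^ 2 := by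
        gcongr
    _ = _ := by ring

/-- On the shell |ξ| ~ 2^j ρ the weight is at most (2^j ρ)^{-b} and the Agmon–Hörmander bound costs
a multiple of 2^j ρ. The shells sum geometrically with ratio 2^{1-b} < 1. No harmonicity is
involved. -/
theorem exists_high_frequency_le {b : ℝ} (hb : 1 < b) : ∃ C : ℝ, 0 ≤ C ∧
    ∀ (g : C(Sph n, ℂ)) (ρ : ℝ), 0 < ρ →
      ∫⁻ ξ : Eucl n in {ξ | ‖ξ‖ ≤ ρ}ᶜ,
        ENNReal.ofReal (‖ξ‖ ^ (-b)) * ‖sphFourier g ξ‖ₑ ^ 2 ≤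
          ENNReal.ofReal (C * ρ ^ (1 - b) * ‖toL2 n g‖ ^ 2) := by
  have hpi := Real.pi_pos
  set K := Real.exp Real.pi * 2 ^ (n / 2 : ℝ) with hK
  have hK0 : 0 < K := by positivity
  set t : ℝ := 2 ^ (1 - b) with ht
  have ht0 : 0 < t := by positivity
  have ht1 : t < 1 := Real.rpow_lt_one_of_one_lt_of_neg one_lt_two (by linarith)
  refine ⟨2 * Real.exp Real.pi * K * (1 - t)⁻¹, ?_, fun g ρ hρ => ?_⟩
  · have := sub_pos.2 ht1
    positivity
  -- The factor e^π compensates the Gaussian at scale 2^{j+1} ρ, which is at least e^{-π} on the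
  -- shell.
  set w : ℕ → ℝ := fun j => (2 ^ j * ρ) ^ (-b) * Real.exp Real.pi with hw
  set G : ℕ → Eucl n → ℝ := fun j ξ =>
    Real.exp (-(Real.pi / (2 ^ (j + 1) * ρ) ^ 2) * ‖ξ‖ ^ 2) * ‖sphFourier g ξ‖ ^ 2 with hG
  have hw0 : ∀ j, 0 ≤ w j := fun j => by positivity
  have hs : MeasurableSet {ξ : Eucl n | ‖ξ‖ ≤ ρ}ᶜ :=
    (measurableSet_le (by fun_prop) (by fun_prop)).compl
  have hpt : ∀ ξ ∈ {ξ : Eucl n | ‖ξ‖ ≤ ρ}ᶜ, ENNReal.ofReal (‖ξ‖ ^ (-b)) * ‖sphFourier g ξ‖ₑ ^ 2 ≤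
      ∑' j, ENNReal.ofReal (w j) * ENNReal.ofReal (G j ξ) := by
    intro ξ hξ
    have hξ' : ρ < ‖ξ‖ := not_le.1 hξ
    obtain ⟨j, hj1, hj2⟩ := exists_nat_pow_near ((one_le_div hρ).2 hξ'.le) one_lt_two
    rw [le_div_iff₀ hρ] at hj1
    rw [div_lt_iff₀ hρ] at hj2
    refine le_trans ?_ (ENNReal.le_tsum j)
    rw [← ofReal_norm, ← ENNReal.ofReal_pow (norm_nonneg _), ← ENNReal.ofReal_mul (hw0 j),
      ← ENNReal.ofReal_mul (by positivity)]
    refine ENNReal.ofReal_le_ofReal ?_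
    simp only [hw, hG]
    rw [← mul_assoc, mul_assoc _ (Real.exp Real.pi), ← Real.exp_add]
    gcongr
    refine (Real.rpow_le_rpow_of_nonpos (by positivity) hj1 (by linarith)).trans ?_
    refine le_mul_of_one_le_right (by positivity) (Real.one_le_exp ?_)
    have h1 : ‖ξ‖ ^ 2 ≤ (2 ^ (j + 1) * ρ) ^ 2 := by gcongr
    have h2 : Real.pi / (2 ^ (j + 1) * ρ) ^ 2 * ‖ξ‖ ^ 2 ≤ Real.pi := by
      rw [div_mul_eq_mul_div, div_le_iff₀ (by positivity)]
      gcongr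
    linarith
  have hGm : ∀ j, Measurable fun ξ => ENNReal.ofReal (G j ξ) := fun j => by
    simp only [hG]
    exact (Continuous.measurable (by fun_prop)).ennreal_ofReal
  have hGi : ∀ j, ∫⁻ ξ, ENNReal.ofReal (G j ξ) ≤
      ENNReal.ofReal (K * (2 ^ (j + 1) * ρ) * ‖toL2 n g‖ ^ 2) := by
    intro j
    have hR : 0 < 2 ^ (j + 1) * ρ := by positivity
    rw [← ofReal_integral_eq_lintegral_ofReal (integrable_gaussian_mul_sq g (by positivity))
      (Filter.Eventually.of_forall fun ξ => by positivity)]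
    exact ENNReal.ofReal_le_ofReal (integral_gaussian_sphFourier_le g hR)
  have hterm : ∀ j, w j * (K * (2 ^ (j + 1) * ρ) * ‖toL2 n g‖ ^ 2) =
      2 * Real.exp Real.pi * K * ρ ^ (1 - b) * ‖toL2 n g‖ ^ 2 * t ^ j := by
    intro j
    have h2j : (0 : ℝ) < 2 ^ j := by positivity
    have h1 : ρ ^ (1 - b) = ρ ^ (-b) * ρ := by
      rw [← Real.rpow_add_one hρ.ne']; congr 1; ring
    have h2 : t ^ j = ((2 : ℝ) ^ j) ^ (-b) * 2 ^ j := by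
      rw [← Real.rpow_add_one h2j.ne', ht, ← Real.rpow_natCast, ← Real.rpow_natCast,
        ← Real.rpow_mul (by norm_num), ← Real.rpow_mul (by norm_num)]
      congr 1; ring
    simp only [hw]
    rw [Real.mul_rpow h2j.le hρ.le, h1, h2, pow_succ]
    ring
  calc ∫⁻ ξ : Eucl n in {ξ | ‖ξ‖ ≤ ρ}ᶜ, ENNReal.ofReal (‖ξ‖ ^ (-b)) * ‖sphFourier g ξ‖ₑ ^ 2
      ≤ ∫⁻ ξ : Eucl n in {ξ | ‖ξ‖ ≤ ρ}ᶜ, ∑' j, ENNReal.ofReal (w j) * ENNReal.ofReal (G j ξ) :=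
        setLIntegral_mono' hs hpt
    _ ≤ ∫⁻ ξ : Eucl n, ∑' j, ENNReal.ofReal (w j) * ENNReal.ofReal (G j ξ) :=
        setLIntegral_le_lintegral _ _
    _ = ∑' j, ENNReal.ofReal (w j) * ∫⁻ ξ : Eucl n, ENNReal.ofReal (G j ξ) := by
        rw [lintegral_tsum fun j => ((hGm j).const_mul _).aemeasurable]
        exact tsum_congr fun j => lintegral_const_mul _ (hGm j)
    _ ≤ ∑' j, ENNReal.ofReal (2 * Real.exp Real.pi * K * ρ ^ (1 - b) * ‖toL2 n g‖ ^ 2 * t ^ j) := by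
        refine ENNReal.tsum_le_tsum fun j => ?_
        rw [← hterm, ENNReal.ofReal_mul (hw0 j)]
        gcongr
        exact hGi j
    _ = ENNReal.ofReal (∑' j, 2 * Real.exp Real.pi * K * ρ ^ (1 - b) * ‖toL2 n g‖ ^ 2 * t ^ j) :=
        (ENNReal.ofReal_tsum_of_nonneg (fun j => by positivity)
          ((summable_geometric_of_lt_one ht0.le ht1).mul_left _)).symm
    _ = _ := by
        rw [tsum_mul_left, tsum_geometric_of_lt_one ht0.le ht1]
        congr 1
        ring

/-- The weighted restriction estimate for spherical harmonics of degree `k`. -/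
theorem exists_lintegral_sphFourier_le {b : ℝ} (hb : 1 < b) (hbn : b < n) : ∃ C : ℝ, 0 ≤ C ∧
    ∀ (k : ℕ) (Y : C(Sph n, ℂ)), Y ∈ sphericalHarmonics n k →
      ∫⁻ ξ : Eucl n, ENNReal.ofReal (‖ξ‖ ^ (-b)) * ‖sphFourier Y ξ‖ₑ ^ 2 ≤
          ENNReal.ofReal (C * (k + 1 : ℝ) ^ (1 - b) * ‖toL2 n Y‖ ^ 2) := by
  obtain ⟨C₁, hC₁, h₁⟩ := exists_low_frequency_le hbn
  obtain ⟨C₂, hC₂, h₂⟩ := exists_high_frequency_le (n := n) hb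
  have hpi := Real.pi_pos
  refine ⟨C₁ + C₂ * (24 * Real.pi)⁻¹ ^ (1 - b), by positivity, fun k Y hY => ?_⟩
  have hs : MeasurableSet {ξ : Eucl n | ‖ξ‖ ≤ (k + 1) / (24 * Real.pi)} :=
    measurableSet_le (by fun_prop) (by fun_prop)
  rw [← lintegral_add_compl _ hs]
  refine (add_le_add (h₁ k Y hY) (h₂ Y _ (by positivity))).trans ?_
  rw [← ENNReal.ofReal_add (by positivity) (by positivity)]
  refine ENNReal.ofReal_le_ofReal (le_of_eq ?_)
  rw [div_eq_mul_inv, Real.mul_rpow (by positivity) (by positivity)]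
  ring

end RieszWeight

/-! ### Duality with the sphere and rapid decay of harmonic components -/

section FourierSphere

variable {n : ℕ} [Fact (2 ≤ n)]

/-- Fubini: restriction of the Fourier transform to a sphere is dual to extension from the sphere.
-/
theorem integral_fourier_mul {u : Eucl n → ℂ} (hu : Integrable u) (Y : C(Sph n, ℂ)) (ρ : ℝ) :
    ∫ θ : Sph n, 𝓕 u (ρ • (θ : Eucl n)) * Y θ ∂surf n = ∫ x, u x * sphFourier Y (ρ • x) := by
  set Φ : Sph n → Eucl n → ℂ := fun θ x =>
    Complex.exp (((-2 * Real.pi * inner ℝ (θ : Eucl n) (ρ • x) : ℝ) : ℂ) * Complex.I) * Y θ * u x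
    with hΦ
  have hi : Integrable (Function.uncurry Φ) ((surf n).prod volume) := by
    refine ((integrable_sphere (f := fun θ => ‖Y θ‖) (by fun_prop)).mul_prod hu.norm).mono' ?_
      (Filter.Eventually.of_forall fun z => ?_)
    · simp only [hΦ, Function.uncurry_def]
      refine AEStronglyMeasurable.mul (Continuous.aestronglyMeasurable (by fun_prop)) ?_
      exact hu.aestronglyMeasurable.comp_snd
    · simp only [hΦ, Function.uncurry_def, norm_mul, Complex.norm_exp_ofReal_mul_I, one_mul, le_refl]
  calc ∫ θ : Sph n, 𝓕 u (ρ • (θ : Eucl n)) * Y θ ∂surf n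
      = ∫ θ : Sph n, (∫ x, Φ θ x) ∂surf n := by
        refine integral_congr_ae (Filter.Eventually.of_forall fun θ => ?_)
        simp only [hΦ, Real.fourier_eq', smul_eq_mul]
        rw [← integral_mul_const]
        refine integral_congr_ae (Filter.Eventually.of_forall fun x => ?_)
        simp only [inner_smul_right, real_inner_comm x]
        ring
    _ = ∫ x, (∫ θ : Sph n, Φ θ x ∂surf n) := integral_integral_swap hi
    _ = _ := by
        refine integral_congr_ae (Filter.Eventually.of_forall fun x => ?_)
        simp only [hΦ]
        rw [integral_mul_const, mul_comm]
        rfl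

/-- The function on `ℝⁿ` that restricts to `G r` on the sphere of radius `r`. -/
def onSphere (G : ℝ → C(Sph n, ℂ)) (x : Eucl n) : ℂ :=
  if hx : x = 0 then 0 else G ‖x‖ ⟨‖x‖⁻¹ • x, by simp [norm_smul, hx]⟩

theorem onSphere_smul (G : ℝ → C(Sph n, ℂ)) {r : ℝ} (hr : 0 < r) (ω : Sph n) :
    onSphere G (r • (ω : Eucl n)) = G r ω := by
  have hω : (ω : Eucl n) ≠ 0 := fun h => by
    have := norm_eq_of_mem_sphere ω
    rw [h, norm_zero] at this
    exact zero_ne_one this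
  have h1 : ‖r • (ω : Eucl n)‖ = r := by
    rw [norm_smul, norm_eq_of_mem_sphere, mul_one, Real.norm_of_nonneg hr.le]
  rw [onSphere, dif_neg (smul_ne_zero hr.ne' hω)]
  congr 1
  · rw [h1]
  · ext1
    simp only [h1, smul_smul, inv_mul_cancel₀ hr.ne', one_smul]

theorem exists_eq_smul {x : Eucl n} (hx : x ≠ 0) : ∃ ω : Sph n, x = ‖x‖ • (ω : Eucl n) :=
  ⟨⟨‖x‖⁻¹ • x, by simp [norm_smul, hx]⟩, by simp [smul_smul, hx]⟩

theorem norm_onSphere_le (G : ℝ → C(Sph n, ℂ)) (x : Eucl n) : ‖onSphere G x‖ ≤ ‖G ‖x‖‖ := by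
  rw [onSphere]
  split_ifs with h
  · simp
  · exact ContinuousMap.norm_coe_le_norm _ _

theorem continuousOn_onSphere {G : ℝ → C(Sph n, ℂ)} (hG : Continuous G) :
    ContinuousOn (onSphere G) {0}ᶜ := by
  rw [continuousOn_iff_continuous_domRestrict]
  have h : ({0}ᶜ : Set (Eucl n)).domRestrict (onSphere G) = fun x : ({0}ᶜ : Set (Eucl n)) =>
      G ‖(x : Eucl n)‖ ⟨‖(x : Eucl n)‖⁻¹ • (x : Eucl n), by
        simp [norm_smul, show (x : Eucl n) ≠ 0 from x.2]⟩ := by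
    ext x
    exact dif_neg x.2
  rw [h]
  refine ContinuousEval.continuous_eval.comp (Continuous.prodMk (by fun_prop) ?_)
  have h2 : Continuous fun x : ({0}ᶜ : Set (Eucl n)) => ‖(x : Eucl n)‖⁻¹ :=
    Continuous.inv₀ (by fun_prop) fun x => norm_ne_zero_iff.2 x.2
  exact Continuous.subtype_mk (h2.smul continuous_subtype_val) _

theorem measurable_onSphere {G : ℝ → C(Sph n, ℂ)} (hG : Continuous G) :
    Measurable (onSphere G) := by
  refine measurable_of_measurable_on_compl_singleton 0 ?_
  exact (continuousOn_iff_continuous_domRestrict.1 (continuousOn_onSphere hG)).measurable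

theorem continuous_restrictSphere (f : 𝓢(Eucl n, ℂ)) : Continuous (restrictSphere f) := by
  refine ContinuousMap.continuous_of_continuous_uncurry _ ?_
  exact f.continuous.comp (by fun_prop)

/-- The projection is continuous for the L² norm and lands in a finite-dimensional space, from which
every linear map is continuous, in particular the one back to the sup norm. -/
theorem continuous_harmonicPart (k : ℕ) : Continuous (harmonicPart n k) := by
  have h1 : Continuous (toL2 n) := (ContinuousMap.toLp (E := ℂ) 2 (surf n) ℂ).continuous
  have h2 := LinearMap.continuous_of_finiteDimensional
    ((sphericalHarmonics n k).subtype ∘ₗ (Submodule.equivMapOfInjective (toL2 n)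
      (toL2_injective n) (sphericalHarmonics n k)).symm.toLinearMap :
        sphericalHarmonicsL2 n k →ₗ[ℂ] C(Sph n, ℂ))
  exact h2.comp ((sphericalHarmonicsL2 n k).orthogonalProjectionOnto.continuous.comp h1)

theorem norm_sq_toL2_harmonicPart (k : ℕ) (g : C(Sph n, ℂ)) :
    ((‖toL2 n (harmonicPart n k g)‖ ^ 2 : ℝ) : ℂ) =
      ∫ ω, g ω * star (harmonicPart n k g) ω ∂surf n := by
  rw [← integral_mul_harmonicPart (star_mem_sphericalHarmonics (harmonicPart_mem k g)),
    norm_sq_toL2, ← integral_complex_ofReal]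
  refine integral_congr_ae (Filter.Eventually.of_forall fun ω => ?_)
  simp [← Complex.normSq_eq_norm_sq, Complex.mul_conj]

theorem schwartz_eq_fourier (f : 𝓢(Eucl n, ℂ)) (x : Eucl n) :
    f x = 𝓕 (⇑(𝓕 f : 𝓢(Eucl n, ℂ))) (-x) := by
  have h : f = 𝓕⁻ (𝓕 f) := (FourierTransform.fourierInv_fourier_eq f).symm
  conv_lhs => rw [h]
  rw [SchwartzMap.fourierInv_coe, Real.fourierInv_eq_fourier_neg]

/-- The square of the norm of a harmonic component as a frequency integral. -/
theorem norm_sq_harmonicPart_eq (f : 𝓢(Eucl n, ℂ)) (k : ℕ) (r : ℝ) :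
    ((‖toL2 n (harmonicPart n k (restrictSphere f r))‖ ^ 2 : ℝ) : ℂ) =
      ∫ ξ, (𝓕 f) ξ * sphFourier (star (harmonicPart n k (restrictSphere f r))) ((-r) • ξ) := by
  rw [norm_sq_toL2_harmonicPart, ← integral_fourier_mul (𝓕 f).integrable]
  refine integral_congr_ae (Filter.Eventually.of_forall fun ω => ?_)
  simp only [restrictSphere, ContinuousMap.coe_mk]
  rw [schwartz_eq_fourier, neg_smul]

theorem norm_toL2_star (g : C(Sph n, ℂ)) : ‖toL2 n (star g)‖ = ‖toL2 n g‖ := by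
  rw [← sq_eq_sq₀ (norm_nonneg _) (norm_nonneg _), norm_sq_toL2, norm_sq_toL2]
  simp

theorem integrable_schwartz_mul_pow (f : 𝓢(Eucl n, ℂ)) (N : ℕ) :
    Integrable fun x => ‖f x‖ * (1 + ‖x‖) ^ N := by
  have h : ∀ x : Eucl n, ‖f x‖ * (1 + ‖x‖) ^ N =
      ∑ m ∈ Finset.range (N + 1), ((N.choose m : ℝ)) * (‖x‖ ^ m * ‖f x‖) := by
    intro x
    rw [add_comm, add_pow, Finset.mul_sum]
    refine Finset.sum_congr rfl fun m _ => ?_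
    rw [one_pow]; ring
  simp only [h]
  exact integrable_finsetSum _ fun m _ => (f.integrable_pow_mul volume m).const_mul _

/-- Pairing the component with itself and using the decay of `sphFourier` in k bounds its squared
norm by a multiple of its norm; one factor cancels. Decay in k is paid for by growth in r. -/
theorem exists_norm_toL2_harmonicPart_le (f : 𝓢(Eucl n, ℂ)) (N : ℕ) : ∃ C : ℝ, 0 ≤ C ∧
    ∀ (k : ℕ) (r : ℝ), ‖toL2 n (harmonicPart n k (restrictSphere f r))‖ ≤
      C * ((1 + |r|) / (k + 1)) ^ N := by
  obtain ⟨C, hC, h⟩ := exists_norm_sphFourier_le n N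
  have hint := integrable_schwartz_mul_pow (𝓕 f) N
  refine ⟨C * ∫ ξ, ‖(𝓕 f) ξ‖ * (1 + ‖ξ‖) ^ N,
    mul_nonneg hC (integral_nonneg fun ξ => by positivity), fun k r => ?_⟩
  set Y := harmonicPart n k (restrictSphere f r) with hY
  have hk : (0 : ℝ) < k + 1 := by positivity
  have h1 : ‖toL2 n Y‖ ^ 2 ≤ C * (∫ ξ, ‖(𝓕 f) ξ‖ * (1 + ‖ξ‖) ^ N) * ((1 + |r|) / (k + 1)) ^ N *
      ‖toL2 n Y‖ := by
    have h2 := congrArg norm (norm_sq_harmonicPart_eq f k r)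
    rw [Complex.norm_real, Real.norm_of_nonneg (by positivity), ← hY] at h2
    rw [h2]
    refine (norm_integral_le_integral_norm _).trans ?_
    have h3 : C * (∫ ξ, ‖(𝓕 f) ξ‖ * (1 + ‖ξ‖) ^ N) * ((1 + |r|) / (k + 1)) ^ N * ‖toL2 n Y‖ =
        ∫ ξ, (‖(𝓕 f) ξ‖ * (1 + ‖ξ‖) ^ N) * (C * ((1 + |r|) / (k + 1)) ^ N * ‖toL2 n Y‖) := by
      rw [integral_mul_const]; ring
    rw [h3]
    refine integral_mono_of_nonneg (Filter.Eventually.of_forall fun ξ => norm_nonneg _)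
      (hint.mul_const _) (Filter.Eventually.of_forall fun ξ => ?_)
    simp only [norm_mul]
    have h4 := h k _ (star_mem_sphericalHarmonics (harmonicPart_mem k (restrictSphere f r)))
      ((-r) • ξ)
    rw [← hY, norm_toL2_star, norm_smul, norm_neg, Real.norm_eq_abs] at h4
    have h5 : (1 + |r| * ‖ξ‖) / ((k : ℝ) + 1) ≤ (1 + ‖ξ‖) * ((1 + |r|) / (k + 1)) := by
      rw [← mul_div_assoc]
      gcongr
      nlinarith [abs_nonneg r, norm_nonneg ξ]
    calc _ ≤ ‖(𝓕 f) ξ‖ * (C * ((1 + |r| * ‖ξ‖) / (k + 1)) ^ N * ‖toL2 n Y‖) := by gcongr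
      _ ≤ ‖(𝓕 f) ξ‖ * (C * ((1 + ‖ξ‖) * ((1 + |r|) / (k + 1))) ^ N * ‖toL2 n Y‖) := by gcongr
      _ = _ := by rw [mul_pow]; ring
  rcases (norm_nonneg (toL2 n Y)).eq_or_lt with h0 | h0
  · rw [← h0]
    have : 0 ≤ ∫ ξ, ‖(𝓕 f) ξ‖ * (1 + ‖ξ‖) ^ N := integral_nonneg fun ξ => by positivity
    positivity
  · rw [pow_two] at h1
    exact le_of_mul_le_mul_right h1 h0

theorem exists_norm_harmonic_le (n : ℕ) [Fact (2 ≤ n)] : ∃ C : ℝ, 0 < C ∧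
    ∀ (k : ℕ) (Y : C(Sph n, ℂ)), Y ∈ sphericalHarmonics n k →
      ‖Y‖ ^ 2 ≤ C * (k + 1 : ℝ) ^ (n - 2) * ‖toL2 n Y‖ ^ 2 := by
  have hσ : 0 < (surf n).real univ := by
    rw [measureReal_def, ENNReal.toReal_pos_iff]
    exact ⟨Measure.measure_univ_pos.2 (Measure.toSphere_ne_zero _), measure_lt_top _ _⟩
  refine ⟨2 / (surf n).real univ, by positivity, fun k Y hY => ?_⟩
  have h : ‖Y‖ ≤ Real.sqrt (2 / (surf n).real univ * (k + 1 : ℝ) ^ (n - 2) * ‖toL2 n Y‖ ^ 2) := by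
    rw [ContinuousMap.norm_le _ (Real.sqrt_nonneg _)]
    intro ω
    refine Real.le_sqrt_of_sq_le ?_
    rw [norm_sq_toL2]
    refine (norm_sq_apply_le hY ω).trans_eq ?_
    ring
  calc ‖Y‖ ^ 2 ≤ _ := pow_le_pow_left₀ (norm_nonneg _) h 2
    _ = _ := Real.sq_sqrt (by positivity)

/-- Multiplication of a Schwartz function by `(1 + |x|²)^M`. -/
def weightMul (M : ℕ) (f : 𝓢(Eucl n, ℂ)) : 𝓢(Eucl n, ℂ) :=
  SchwartzMap.smulLeftCLM ℂ (fun x : Eucl n => (1 + ‖x‖ ^ 2) ^ M) f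

theorem weightMul_apply (M : ℕ) (f : 𝓢(Eucl n, ℂ)) (x : Eucl n) :
    weightMul M f x = (((1 + ‖x‖ ^ 2) ^ M : ℝ) : ℂ) * f x := by
  have h : (fun x : Eucl n => (1 + ‖x‖ ^ 2) ^ M).HasTemperateGrowth := by fun_prop
  rw [weightMul, SchwartzMap.smulLeftCLM_apply_apply h, Complex.real_smul]

theorem restrictSphere_weightMul (M : ℕ) (f : 𝓢(Eucl n, ℂ)) (r : ℝ) :
    restrictSphere (weightMul M f) r = (((1 + r ^ 2) ^ M : ℝ) : ℂ) • restrictSphere f r := by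
  ext ω
  simp [restrictSphere, weightMul_apply, norm_smul]

/-- Rapid decay of the harmonic components of a Schwartz function, both in the degree and in the
radius. -/
theorem exists_norm_harmonicPart_le (f : 𝓢(Eucl n, ℂ)) (N : ℕ) : ∃ C : ℝ, 0 ≤ C ∧
    ∀ (k : ℕ) (r : ℝ), ‖harmonicPart n k (restrictSphere f r)‖ ≤
      C * ((k + 1 : ℝ) ^ N)⁻¹ * ((1 + |r|) ^ N)⁻¹ := by
  obtain ⟨A, hA, hA'⟩ := exists_norm_harmonic_le n
  -- The n additional powers of k+1 pay for passing from L² to the sup norm. The radial weight of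
  -- exponent M + N commutes with the projection, absorbs the growth (1+|r|)^M and leaves N powers
  -- of decay in r.
  set M := N + n with hM
  obtain ⟨C, hC, h⟩ := exists_norm_toL2_harmonicPart_le (weightMul (M + N) f) M
  refine ⟨(A + 1) * C * 2 ^ (M + N), by positivity, fun k r => ?_⟩
  set Y := harmonicPart n k (restrictSphere f r) with hY
  have hk : (1 : ℝ) ≤ k + 1 := by linarith [(k.cast_nonneg : (0 : ℝ) ≤ k)]
  have hk0 : (0 : ℝ) < k + 1 := by positivity
  have hr : (0 : ℝ) < 1 + |r| := by positivity
  have h1 : (1 + r ^ 2) ^ (M + N) * ‖toL2 n Y‖ ≤ C * ((1 + |r|) / (k + 1)) ^ M := by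
    have := h k r
    rw [restrictSphere_weightMul, harmonicPart_smul, map_smul, norm_smul, Complex.norm_real,
      Real.norm_of_nonneg (by positivity)] at this
    exact this
  have h2 : (1 + |r|) ^ (M + N) ≤ 2 ^ (M + N) * (1 + r ^ 2) ^ (M + N) := by
    rw [← mul_pow]
    gcongr
    nlinarith [sq_abs r, sq_nonneg (|r| - 1)]
  have h3 : ‖Y‖ ≤ (A + 1) * (k + 1 : ℝ) ^ n * ‖toL2 n Y‖ := by
    refine le_of_sq_le_sq (b := (A + 1) * (k + 1 : ℝ) ^ n * ‖toL2 n Y‖) ?_ (by positivity)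
    refine (hA' k Y (harmonicPart_mem k _)).trans ?_
    rw [mul_pow, mul_pow]
    have h4 : (k + 1 : ℝ) ^ (n - 2) ≤ ((k + 1 : ℝ) ^ n) ^ 2 := by
      rw [← pow_mul]
      exact pow_le_pow_right₀ hk (by omega)
    have h5 : A ≤ (A + 1) ^ 2 := by nlinarith
    gcongr
  have h6 : ‖toL2 n Y‖ * (1 + |r|) ^ (M + N) ≤
      2 ^ (M + N) * (C * ((1 + |r|) / (k + 1)) ^ M) := by
    calc _ ≤ ‖toL2 n Y‖ * (2 ^ (M + N) * (1 + r ^ 2) ^ (M + N)) := by gcongr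
      _ = 2 ^ (M + N) * ((1 + r ^ 2) ^ (M + N) * ‖toL2 n Y‖) := by ring
      _ ≤ _ := by gcongr
  have h7 : ‖toL2 n Y‖ ≤ 2 ^ (M + N) * C * ((k + 1 : ℝ) ^ M)⁻¹ * ((1 + |r|) ^ N)⁻¹ := by
    rw [← le_div_iff₀ (by positivity)] at h6
    refine h6.trans_eq ?_
    rw [div_pow, pow_add (1 + |r|)]
    field_simp
    rw [hM]
    ring
  refine h3.trans ?_
  calc _ ≤ (A + 1) * (k + 1 : ℝ) ^ n *
        (2 ^ (M + N) * C * ((k + 1 : ℝ) ^ M)⁻¹ * ((1 + |r|) ^ N)⁻¹) := by gcongr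
    _ = _ := by
        rw [hM, pow_add (k + 1 : ℝ) N n]
        field_simp

end FourierSphere

/-! ### Angular multipliers and their commutation with the Fourier transform -/

section Multiplier

variable {n : ℕ} [Fact (2 ≤ n)]

/-- Sequences of at most polynomial growth. -/
def PolyGrowth (m : ℕ → ℂ) : Prop := ∃ A : ℝ, 0 ≤ A ∧ ∃ N : ℕ, ∀ k, ‖m k‖ ≤ A * (k + 1 : ℝ) ^ N

/-- The operator acting on the harmonic component of degree `k` as multiplication by `m k`. -/
def angularMult (m : ℕ → ℂ) (g : C(Sph n, ℂ)) : C(Sph n, ℂ) :=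
  ∑' k, m k • harmonicPart n k g

theorem summable_succ_sq_inv : Summable fun k : ℕ => (((k : ℝ) + 1) ^ 2)⁻¹ := by
  have := (summable_nat_add_iff 1).2 (Real.summable_nat_pow_inv (p := 2).2 one_lt_two)
  simpa using this

theorem PolyGrowth.exists_norm_le {m : ℕ → ℂ} (hm : PolyGrowth m) (f : 𝓢(Eucl n, ℂ)) (M : ℕ) :
    ∃ C : ℝ, 0 ≤ C ∧ ∀ (k : ℕ) (r : ℝ), ‖m k • harmonicPart n k (restrictSphere f r)‖ ≤
      C * (((k : ℝ) + 1) ^ 2)⁻¹ * ((1 + |r|) ^ M)⁻¹ := by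
  obtain ⟨A, hA, N, h⟩ := hm
  obtain ⟨C, hC, h'⟩ := exists_norm_harmonicPart_le f (N + 2 + M)
  refine ⟨A * C, mul_nonneg hA hC, fun k r => ?_⟩
  have hk : (1 : ℝ) ≤ k + 1 := by linarith [(k.cast_nonneg : (0 : ℝ) ≤ k)]
  have hr : (1 : ℝ) ≤ 1 + |r| := by linarith [abs_nonneg r]
  rw [norm_smul]
  calc _ ≤ A * (k + 1 : ℝ) ^ N *
        (C * ((k + 1 : ℝ) ^ (N + 2 + M))⁻¹ * ((1 + |r|) ^ (N + 2 + M))⁻¹) := by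
        gcongr
        · exact h k
        · exact h' k r
    _ ≤ A * (k + 1 : ℝ) ^ N * (C * ((k + 1 : ℝ) ^ (N + 2))⁻¹ * ((1 + |r|) ^ M)⁻¹) := by
        have h1 : (k + 1 : ℝ) ^ (N + 2) ≤ (k + 1 : ℝ) ^ (N + 2 + M) :=
          pow_le_pow_right₀ hk (by omega)
        have h2 : (1 + |r|) ^ M ≤ (1 + |r|) ^ (N + 2 + M) := pow_le_pow_right₀ hr (by omega)
        gcongr
    _ = _ := by
        rw [pow_add]
        field_simp

theorem PolyGrowth.summable {m : ℕ → ℂ} (hm : PolyGrowth m) (f : 𝓢(Eucl n, ℂ)) (r : ℝ) :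
    Summable fun k => m k • harmonicPart n k (restrictSphere f r) := by
  obtain ⟨C, hC, h⟩ := hm.exists_norm_le f 0
  refine Summable.of_norm_bounded (summable_succ_sq_inv.mul_left C) fun k => ?_
  simpa using h k r

theorem PolyGrowth.continuous {m : ℕ → ℂ} (hm : PolyGrowth m) (f : 𝓢(Eucl n, ℂ)) :
    Continuous fun r => angularMult m (restrictSphere f r) := by
  obtain ⟨C, hC, h⟩ := hm.exists_norm_le f 0
  refine continuous_tsum (fun k => ?_) (summable_succ_sq_inv.mul_left C) fun k r => ?_
  · exact ((continuous_harmonicPart k).comp (continuous_restrictSphere f)).const_smul (m k)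
  · simpa using h k r

theorem PolyGrowth.exists_norm_angularMult_le {m : ℕ → ℂ} (hm : PolyGrowth m) (f : 𝓢(Eucl n, ℂ))
    (M : ℕ) : ∃ C : ℝ, 0 ≤ C ∧ ∀ r : ℝ, ‖angularMult m (restrictSphere f r)‖ ≤
      C * ((1 + |r|) ^ M)⁻¹ := by
  obtain ⟨C, hC, h⟩ := hm.exists_norm_le f M
  refine ⟨C * ∑' k : ℕ, (((k : ℝ) + 1) ^ 2)⁻¹,
    mul_nonneg hC (tsum_nonneg fun k => by positivity), fun r => ?_⟩
  refine tsum_of_norm_bounded ?_ fun k => h k r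
  exact (summable_succ_sq_inv.hasSum.mul_left C).mul_right _

/-- The projection onto the spherical harmonics of degree `k` as a continuous linear map. -/
def harmonicPartL (n k : ℕ) [Fact (2 ≤ n)] : C(Sph n, ℂ) →L[ℂ] C(Sph n, ℂ) where
  toFun := harmonicPart n k
  map_add' g h := harmonicPart_add k g h
  map_smul' c g := harmonicPart_smul k c g
  cont := continuous_harmonicPart k

theorem PolyGrowth.harmonicPart_angularMult {m : ℕ → ℂ} (hm : PolyGrowth m) (f : 𝓢(Eucl n, ℂ))
    (r : ℝ) (l : ℕ) : harmonicPart n l (angularMult m (restrictSphere f r)) =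
      m l • harmonicPart n l (restrictSphere f r) := by
  change harmonicPartL n l _ = _
  rw [angularMult, (harmonicPartL n l).map_tsum (hm.summable f r), tsum_eq_single l]
  · rw [map_smul]
    exact congrArg _ (harmonicPart_of_mem (harmonicPart_mem l _))
  · intro k hk
    rw [map_smul]
    change m k • harmonicPart n l _ = 0
    rw [harmonicPart_of_mem_of_ne hk (harmonicPart_mem k _)]
    exact smul_zero (A := C(Sph n, ℂ)) (m k)

theorem PolyGrowth.integral_angularMult_mul {m : ℕ → ℂ} (hm : PolyGrowth m) (f : 𝓢(Eucl n, ℂ))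
    (r : ℝ) {l : ℕ} {Y : C(Sph n, ℂ)} (hY : Y ∈ sphericalHarmonics n l) :
    ∫ ω, angularMult m (restrictSphere f r) ω * Y ω ∂surf n =
      m l * ∫ ω, restrictSphere f r ω * Y ω ∂surf n := by
  rw [← integral_mul_harmonicPart hY, hm.harmonicPart_angularMult,
    ← integral_mul_harmonicPart hY (restrictSphere f r), ← integral_const_mul]
  refine integral_congr_ae (Filter.Eventually.of_forall fun ω => ?_)
  simp [mul_assoc]

theorem PolyGrowth.integrable_onSphere {m : ℕ → ℂ} (hm : PolyGrowth m) (f : 𝓢(Eucl n, ℂ)) :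
    Integrable (onSphere fun r => angularMult m (restrictSphere f r)) := by
  obtain ⟨C, hC, h⟩ := hm.exists_norm_angularMult_le f (n + 1)
  have hi : Integrable fun x : Eucl n => C * (1 + ‖x‖) ^ (-((n : ℝ) + 1)) :=
    (integrable_one_add_norm (by simp)).const_mul C
  refine hi.mono' (measurable_onSphere (hm.continuous f)).aestronglyMeasurable
    (Filter.Eventually.of_forall fun x => ?_)
  refine (norm_onSphere_le _ x).trans ((h ‖x‖).trans_eq ?_)
  rw [abs_norm, Real.rpow_neg (by positivity)]
  norm_cast

theorem integrable_mul_sphFourier {v : Eucl n → ℂ} (hv : Integrable v) (Y : C(Sph n, ℂ)) (ρ : ℝ) :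
    Integrable fun x => v x * sphFourier Y (ρ • x) :=
  hv.mul_bdd (c := ∫ ω, ‖Y ω‖ ∂surf n) (Continuous.aestronglyMeasurable (by fun_prop))
    (Filter.Eventually.of_forall fun x => norm_sphFourier_le _ _)

/-- In polar coordinates `sphFourier Y` is a harmonic of degree l on every sphere, so only m l
survives there. -/
theorem PolyGrowth.integral_onSphere_mul_sphFourier {m : ℕ → ℂ} (hm : PolyGrowth m)
    (f : 𝓢(Eucl n, ℂ)) {l : ℕ} {Y : C(Sph n, ℂ)} (hY : Y ∈ sphericalHarmonics n l) (ρ : ℝ) :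
    ∫ x, onSphere (fun r => angularMult m (restrictSphere f r)) x * sphFourier Y (ρ • x) =
      m l * ∫ x, f x * sphFourier Y (ρ • x) := by
  rw [integral_polar (integrable_mul_sphFourier (hm.integrable_onSphere f) Y ρ),
    integral_polar (integrable_mul_sphFourier f.integrable Y ρ), ← integral_const_mul]
  refine setIntegral_congr_fun measurableSet_Ioi fun r hr => ?_
  have h3 : ∀ ω : Sph n, sphFourier Y (ρ • (r • (ω : Eucl n))) = sphFourierOn Y (ρ * r) ω := by
    intro ω
    rw [smul_smul]
    rfl
  have h4 := hm.integral_angularMult_mul f r (sphFourierOn_mem hY (ρ * r))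
  simp only [h3, onSphere_smul _ hr]
  rw [h4, mul_smul_comm]
  rfl

/-- Angular multipliers commute with the Fourier transform. -/
theorem PolyGrowth.fourier_onSphere {m : ℕ → ℂ} (hm : PolyGrowth m) (f : 𝓢(Eucl n, ℂ)) (ρ : ℝ)
    (θ : Sph n) : 𝓕 (onSphere fun r => angularMult m (restrictSphere f r)) (ρ • (θ : Eucl n)) =
      angularMult m (restrictSphere (𝓕 f) ρ) θ := by
  set u := onSphere fun r => angularMult m (restrictSphere f r) with hu
  have hui : Integrable u := hm.integrable_onSphere f
  have hc : Continuous (𝓕 u) :=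
    VectorFourier.fourierIntegral_continuous Real.continuous_fourierChar
      (by exact continuous_inner) hui
  let U : C(Sph n, ℂ) := ⟨fun θ => 𝓕 u (ρ • (θ : Eucl n)), hc.comp (by fun_prop)⟩
  suffices h : U = angularMult m (restrictSphere (𝓕 f) ρ) from congrArg (fun g => g θ) h
  -- Paired with a harmonic of degree l, both sides reduce to m l times the pairing of f with
  -- `sphFourier Y`.
  refine eq_of_pairing fun l Y hY => ?_
  rw [hm.integral_angularMult_mul _ _ hY]
  have h1 : ∫ ω, U ω * Y ω ∂surf n = ∫ x, u x * sphFourier Y (ρ • x) :=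
    integral_fourier_mul hui Y ρ
  have h2 : ∫ ω, restrictSphere (𝓕 f) ρ ω * Y ω ∂surf n = ∫ x, f x * sphFourier Y (ρ • x) := by
    rw [← integral_fourier_mul f.integrable Y ρ]
    rfl
  rw [h1, h2, hm.integral_onSphere_mul_sphFourier f hY]

theorem polyGrowth_single (k : ℕ) : PolyGrowth (Pi.single k 1) := by
  refine ⟨1, zero_le_one, 0, fun l => ?_⟩
  rw [Pi.single_apply]
  split_ifs <;> simp

theorem angularMult_single (k : ℕ) (g : C(Sph n, ℂ)) :
    angularMult (Pi.single k 1) g = harmonicPart n k g := by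
  rw [angularMult, tsum_eq_single k]
  · rw [Pi.single_eq_same]
    exact one_smul ℂ _
  · intro l hl
    rw [Pi.single_eq_of_ne hl]
    exact zero_smul ℂ (harmonicPart n l g)

theorem angularMult_one (f : 𝓢(Eucl n, ℂ)) (r : ℝ) :
    angularMult (fun _ => 1) (restrictSphere f r) = restrictSphere f r := by
  have h : PolyGrowth fun _ => 1 := ⟨1, zero_le_one, 0, fun l => by simp⟩
  refine eq_of_pairing fun l Y hY => ?_
  rw [h.integral_angularMult_mul f r hY, one_mul]

/-- The symbol of `Λ_ω^s`. -/
def angularSymbol (n : ℕ) (s : ℝ) (k : ℕ) : ℂ := (((1 + sphEigenvalue n k) ^ (s / 2) : ℝ) : ℂ)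

theorem sphEigenvalue_nonneg (n : ℕ) [hn : Fact (2 ≤ n)] (k : ℕ) : 0 ≤ sphEigenvalue n k := by
  have : (2 : ℝ) ≤ n := by exact_mod_cast hn.out
  exact mul_nonneg k.cast_nonneg (by linarith [(k.cast_nonneg : (0 : ℝ) ≤ k)])

/-- With the lower bound below, this makes Λ_ω comparable to multiplication by k+1 in degree k. -/
theorem one_add_sphEigenvalue_le (n : ℕ) [hn : Fact (2 ≤ n)] (k : ℕ) :
    1 + sphEigenvalue n k ≤ n * (k + 1 : ℝ) ^ 2 := by
  have : (2 : ℝ) ≤ n := by exact_mod_cast hn.out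
  have hk : (0 : ℝ) ≤ k := k.cast_nonneg
  rw [sphEigenvalue]
  nlinarith [mul_nonneg hk hk, mul_nonneg hk (by linarith : (0 : ℝ) ≤ n - 2),
    mul_nonneg (mul_nonneg hk hk) (by linarith : (0 : ℝ) ≤ n - 2)]

theorem le_one_add_sphEigenvalue (n : ℕ) [hn : Fact (2 ≤ n)] (k : ℕ) :
    (2 : ℝ)⁻¹ * (k + 1 : ℝ) ^ 2 ≤ 1 + sphEigenvalue n k := by
  have : (2 : ℝ) ≤ n := by exact_mod_cast hn.out
  have hk : (0 : ℝ) ≤ k := k.cast_nonneg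
  rw [sphEigenvalue]
  nlinarith [mul_nonneg hk (by linarith : (0 : ℝ) ≤ n - 2), sq_nonneg ((k : ℝ) - 1)]

theorem polyGrowth_angularSymbol (n : ℕ) [hn : Fact (2 ≤ n)] (s : ℝ) :
    PolyGrowth (angularSymbol n s) := by
  obtain ⟨N, hN⟩ := exists_nat_ge (s / 2)
  refine ⟨(n : ℝ) ^ N, by positivity, 2 * N, fun k => ?_⟩
  have h := sphEigenvalue_nonneg n k
  rw [angularSymbol, Complex.norm_real, Real.norm_of_nonneg (by positivity)]
  calc (1 + sphEigenvalue n k) ^ (s / 2) ≤ (1 + sphEigenvalue n k) ^ (N : ℝ) :=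
        Real.rpow_le_rpow_of_exponent_le (by linarith) hN
    _ = (1 + sphEigenvalue n k) ^ N := Real.rpow_natCast _ _
    _ ≤ (n * (k + 1 : ℝ) ^ 2) ^ N := by
        gcongr
        exact one_add_sphEigenvalue_le n k
    _ = _ := by rw [mul_pow, pow_mul]

/-- The origin, where the conventions f 0 and 0 may differ, is a null set. -/
theorem angularPow_ae_eq (s : ℝ) (f : 𝓢(Eucl n, ℂ)) :
    angularPow s f =ᵐ[volume]
      onSphere fun r => angularMult (angularSymbol n s) (restrictSphere f r) := by
  have hn : 0 < n := lt_of_lt_of_le two_pos (Fact.out : 2 ≤ n)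
  have : Nonempty (Fin n) := ⟨⟨0, hn⟩⟩
  have h0 : ∀ᵐ x : Eucl n, x ≠ 0 := by simp [ae_iff]
  filter_upwards [h0] with x hx
  rw [angularPow, dif_neg hx, onSphere, dif_neg hx, angularMult]
  exact ContinuousMap.tsum_apply ((polyGrowth_angularSymbol n s).summable f ‖x‖) _

end Multiplier

/-! ### Plancherel for Fourier integrals, and Cauchy–Schwarz -/

section Plancherel

variable {V : Type*} [NormedAddCommGroup V] [InnerProductSpace ℝ V] [FiniteDimensional ℝ V]
  [MeasurableSpace V] [BorelSpace V]

theorem integral_mul_fourierInv_eq {g h : V → ℂ} (hg : Integrable g) (hh : Integrable h) :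
    ∫ x, 𝓕⁻ g x * h x = ∫ x, g x * 𝓕⁻ h x := by
  have hL : Continuous fun p : V × V => (-innerₗ V : V →ₗ[ℝ] V →ₗ[ℝ] ℝ) p.1 p.2 := by
    simp only [LinearMap.neg_apply, innerₗ_apply_apply]
    exact (continuous_inner (𝕜 := ℝ)).neg
  have h1 := VectorFourier.integral_fourierIntegral_smul_eq_flip (μ := volume) (ν := volume)
    (L := (-innerₗ V : V →ₗ[ℝ] V →ₗ[ℝ] ℝ)) Real.continuous_fourierChar hL hg hh
  have h2 : (-innerₗ V : V →ₗ[ℝ] V →ₗ[ℝ] ℝ).flip = -innerₗ V := by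
    ext x y
    simp [real_inner_comm]
  rw [h2] at h1
  exact h1

theorem continuous_fourierInv {h : V → ℂ} (hh : Integrable h) : Continuous (𝓕⁻ h) := by
  have hL : Continuous fun p : V × V => (-innerₗ V : V →ₗ[ℝ] V →ₗ[ℝ] ℝ) p.1 p.2 := by
    simp only [LinearMap.neg_apply, innerₗ_apply_apply]
    exact (continuous_inner (𝕜 := ℝ)).neg
  exact VectorFourier.fourierIntegral_continuous Real.continuous_fourierChar hL hh

/-- Plancherel's theorem for the inverse Fourier integral of functions in `L¹ ∩ L²`. -/
theorem eLpNorm_fourierInv_eq {h : V → ℂ} (h1 : Integrable h) (h2 : MemLp h 2) :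
    eLpNorm (𝓕⁻ h) 2 volume = eLpNorm h 2 volume := by
  set H := h2.toLp h with hH
  -- The L² transform is defined abstractly. It agrees with the integral because both can be moved
  -- onto a smooth compactly supported test function.
  have hae : ∀ᵐ x : V, (𝓕⁻ H : Lp ℂ 2 (volume : Measure V)) x = 𝓕⁻ h x := by
    refine ae_eq_of_integral_contDiff_smul_eq ?_ (continuous_fourierInv h1).locallyIntegrable ?_
    · exact (Lp.memLp _).locallyIntegrable (by norm_num)
    intro φ hφ hφc
    have hφ' : ContDiff ℝ (⊤ : ℕ∞) fun x => (φ x : ℂ) := Complex.ofRealCLM.contDiff.comp hφ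
    have hc : HasCompactSupport fun x => (φ x : ℂ) := hφc.comp_left Complex.ofReal_zero
    set g : 𝓢(V, ℂ) := hc.toSchwartzMap hφ' with hg
    have hgφ : ∀ x, g x = (φ x : ℂ) := fun x => rfl
    have h3 := congrArg (fun T => T g) (Lp.fourierInv_toTemperedDistribution_eq H)
    simp only [Lp.toTemperedDistribution_apply, TemperedDistribution.fourierInv_apply] at h3
    have h4 : ∫ x, (𝓕⁻ g) x • H x = ∫ x, (𝓕⁻ g) x * h x := by
      refine integral_congr_ae ?_
      filter_upwards [h2.coeFn_toLp] with x hx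
      rw [hH, hx, smul_eq_mul]
    have h5 := integral_mul_fourierInv_eq g.integrable h1
    rw [h4, SchwartzMap.fourierInv_coe, h5] at h3
    simpa only [hgφ, Complex.real_smul, smul_eq_mul] using h3.symm
  rw [← eLpNorm_congr_ae hae, ← eLpNorm_congr_ae h2.coeFn_toLp]
  have h6 : ‖(𝓕⁻ H : Lp ℂ 2 (volume : Measure V))‖ = ‖H‖ := by
    rw [← Lp.norm_fourier_eq, FourierTransform.fourier_fourierInv_eq]
  rw [Lp.norm_def, Lp.norm_def] at h6
  exact (ENNReal.toReal_eq_toReal_iff' (Lp.eLpNorm_ne_top _) (Lp.eLpNorm_ne_top _)).1 h6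

theorem eLpNorm_two_sq {X : Type*} [MeasurableSpace X] {μ : Measure X} (g : X → ℂ) :
    eLpNorm g 2 μ ^ 2 = ∫⁻ x, ‖g x‖ₑ ^ 2 ∂μ := by
  have h := eLpNorm_nnreal_pow_eq_lintegral (f := g) (μ := μ) (p := 2) two_ne_zero
  simp only [NNReal.coe_ofNat, ENNReal.rpow_ofNat] at h
  exact h

/-- The Cauchy-Schwarz inequality. -/
theorem sq_lintegral_mul_le {X : Type*} [MeasurableSpace X] {μ : Measure X} {f g : X → ℝ≥0∞}
    (hf : AEMeasurable f μ) (hg : AEMeasurable g μ) :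
    (∫⁻ x, f x * g x ∂μ) ^ 2 ≤ (∫⁻ x, f x ^ 2 ∂μ) * ∫⁻ x, g x ^ 2 ∂μ := by
  have h := ENNReal.lintegral_mul_le_Lp_mul_Lq μ Real.HolderConjugate.two_two hf hg
  simp only [ENNReal.rpow_ofNat] at h
  calc _ ≤ ((∫⁻ x, f x ^ 2 ∂μ) ^ (1 / 2 : ℝ) * (∫⁻ x, g x ^ 2 ∂μ) ^ (1 / 2 : ℝ)) ^ 2 := by
        gcongr
        exact h
    _ = _ := by
        rw [mul_pow, ← ENNReal.rpow_natCast, ← ENNReal.rpow_natCast, ← ENNReal.rpow_mul,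
          ← ENNReal.rpow_mul]
        norm_num

theorem sq_tsum_mul_le (f g : ℕ → ℝ≥0∞) :
    (∑' k, f k * g k) ^ 2 ≤ (∑' k, f k ^ 2) * ∑' k, g k ^ 2 := by
  have h := sq_lintegral_mul_le (μ := Measure.count) (f := f) (g := g)
    (measurable_of_countable f).aemeasurable (measurable_of_countable g).aemeasurable
  simpa only [lintegral_count] using h

end Plancherel

/-! ### Weighted L² norms as sums over degrees -/

section Weighted

variable {n : ℕ} [Fact (2 ≤ n)]

/-- The exponent condition handles the unit ball, and rapid decay of v its complement. -/
theorem lintegral_rpow_mul_lt_top {a : ℝ} (ha : -(n : ℝ) < a) {v : Eucl n → ℝ}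
    (hv : ∀ M : ℕ, ∃ C : ℝ, 0 ≤ C ∧ ∀ x, v x ≤ C * ((1 + ‖x‖) ^ M)⁻¹) :
    ∫⁻ x, ENNReal.ofReal (‖x‖ ^ a * v x) < ∞ := by
  obtain ⟨N, hN⟩ := exists_nat_ge |a|
  obtain ⟨C, hC, h⟩ := hv (N + (n + 1))
  have hs : MeasurableSet {x : Eucl n | ‖x‖ ≤ 1} := measurableSet_le (by fun_prop) (by fun_prop)
  rw [← lintegral_add_compl _ hs, ENNReal.add_lt_top]
  constructor
  · calc _ ≤ ∫⁻ x : Eucl n in {x | ‖x‖ ≤ 1},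
          ENNReal.ofReal C * ENNReal.ofReal (‖x‖ ^ (-(-a))) := by
          refine lintegral_mono fun x => ?_
          rw [← ENNReal.ofReal_mul hC, neg_neg, mul_comm C]
          refine ENNReal.ofReal_le_ofReal (mul_le_mul_of_nonneg_left ((h x).trans ?_)
            (by positivity))
          refine mul_le_of_le_one_right hC (inv_le_one_of_one_le₀ (one_le_pow₀ ?_))
          linarith [norm_nonneg x]
      _ < ∞ := by
          rw [lintegral_const_mul _ (by fun_prop), lintegral_ball_rpow (by linarith) zero_le_one]
          exact ENNReal.mul_lt_top ENNReal.ofReal_lt_top ENNReal.ofReal_lt_top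
  · have hi : Integrable fun x : Eucl n => C * (1 + ‖x‖) ^ (-((n : ℝ) + 1)) :=
      (integrable_one_add_norm (by simp)).const_mul C
    calc _ ≤ ∫⁻ x : Eucl n in {x | ‖x‖ ≤ 1}ᶜ,
          ENNReal.ofReal (C * (1 + ‖x‖) ^ (-((n : ℝ) + 1))) := by
          refine lintegral_mono_ae ((ae_restrict_iff' hs.compl).2 (Filter.Eventually.of_forall
            fun x hx => ENNReal.ofReal_le_ofReal ?_))
          have hx1 : 1 ≤ ‖x‖ := (not_le.1 (show ¬ ‖x‖ ≤ 1 from hx)).le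
          have h1 : ‖x‖ ^ a ≤ (1 + ‖x‖) ^ N := by
            rw [← Real.rpow_natCast]
            calc ‖x‖ ^ a ≤ ‖x‖ ^ (N : ℝ) :=
                  Real.rpow_le_rpow_of_exponent_le hx1 ((le_abs_self a).trans hN)
              _ ≤ _ := by gcongr; linarith
          calc ‖x‖ ^ a * v x ≤ ‖x‖ ^ a * (C * ((1 + ‖x‖) ^ (N + (n + 1)))⁻¹) := by
                gcongr
                exact h x
            _ ≤ (1 + ‖x‖) ^ N * (C * ((1 + ‖x‖) ^ (N + (n + 1)))⁻¹) := by gcongr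
            _ = C * (1 + ‖x‖) ^ (-((n : ℝ) + 1)) := by
                rw [Real.rpow_neg (by positivity), pow_add]
                have : (1 + ‖x‖) ^ ((n : ℝ) + 1) = (1 + ‖x‖) ^ (n + 1) := by norm_cast
                rw [this]
                field_simp
      _ ≤ ∫⁻ x : Eucl n, ENNReal.ofReal (C * (1 + ‖x‖) ^ (-((n : ℝ) + 1))) :=
          setLIntegral_le_lintegral _ _
      _ < ∞ := hi.lintegral_lt_top

theorem PolyGrowth.norm_onSphere_le {m : ℕ → ℂ} (hm : PolyGrowth m) (g : 𝓢(Eucl n, ℂ)) (M : ℕ) :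
    ∃ C : ℝ, 0 ≤ C ∧ ∀ x, ‖onSphere (fun r => angularMult m (restrictSphere g r)) x‖ ≤
      C * ((1 + ‖x‖) ^ M)⁻¹ := by
  obtain ⟨C, hC, h⟩ := hm.exists_norm_angularMult_le g M
  refine ⟨C, hC, fun x => (AngularSobolev.norm_onSphere_le _ x).trans ?_⟩
  simpa using h ‖x‖

theorem PolyGrowth.norm_sq_onSphere_le {m : ℕ → ℂ} (hm : PolyGrowth m) (g : 𝓢(Eucl n, ℂ))
    (M : ℕ) : ∃ C : ℝ, 0 ≤ C ∧
      ∀ x, ‖onSphere (fun r => angularMult m (restrictSphere g r)) x‖ ^ 2 ≤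
        C * ((1 + ‖x‖) ^ M)⁻¹ := by
  obtain ⟨C, hC, h⟩ := hm.norm_onSphere_le g M
  refine ⟨C ^ 2, by positivity, fun x => (pow_le_pow_left₀ (norm_nonneg _) (h x) 2).trans ?_⟩
  rw [mul_pow]
  gcongr
  refine pow_le_of_le_one (by positivity) (inv_le_one_of_one_le₀ (one_le_pow₀ ?_)) two_ne_zero
  linarith [norm_nonneg x]

theorem enorm_sq_rpow_mul {a t : ℝ} (ht : 0 ≤ t) (z : ℂ) :
    ‖((t ^ a : ℝ) : ℂ) * z‖ₑ ^ 2 = ENNReal.ofReal (t ^ (2 * a)) * ‖z‖ₑ ^ 2 := by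
  rw [enorm_mul, mul_pow, ← ofReal_norm, Complex.norm_real, Real.norm_of_nonneg (by positivity),
    ← ENNReal.ofReal_pow (by positivity), ← Real.rpow_natCast, ← Real.rpow_mul ht]
  norm_num [mul_comm]

theorem lintegral_onSphere {G : ℝ → C(Sph n, ℂ)} (hG : Continuous G) {w : ℝ → ℝ≥0∞}
    (hw : Measurable w) : ∫⁻ x, w ‖x‖ * ‖onSphere G x‖ₑ ^ 2 =
      ∫⁻ r in Ioi (0 : ℝ), ENNReal.ofReal (r ^ (n - 1)) *
        (w r * ENNReal.ofReal (‖toL2 n (G r)‖ ^ 2)) := by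
  have hm := measurable_onSphere hG
  rw [lintegral_polar (by fun_prop)]
  refine setLIntegral_congr_fun measurableSet_Ioi fun r hr => ?_
  simp only [onSphere_smul G hr, norm_smul, norm_eq_of_mem_sphere, mul_one,
    Real.norm_of_nonneg (le_of_lt hr)]
  rw [lintegral_const_mul _ (by fun_prop), norm_sq_toL2,
    ofReal_integral_eq_lintegral_ofReal (integrable_sphere (by fun_prop))
      (Filter.Eventually.of_forall fun ω => by positivity)]
  simp only [ENNReal.ofReal_pow (norm_nonneg _), ofReal_norm]

/-- The weighted energy of the harmonic component of degree `k` of a Schwartz function. -/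
def harmonicEnergy (a : ℝ) (g : 𝓢(Eucl n, ℂ)) (k : ℕ) : ℝ≥0∞ :=
  ∫⁻ ξ, ENNReal.ofReal (‖ξ‖ ^ a) *
    ‖onSphere (fun ρ => harmonicPart n k (restrictSphere g ρ)) ξ‖ₑ ^ 2

theorem continuous_harmonicPart_restrictSphere (g : 𝓢(Eucl n, ℂ)) (k : ℕ) :
    Continuous fun ρ => harmonicPart n k (restrictSphere g ρ) :=
  (continuous_harmonicPart k).comp (continuous_restrictSphere g)

theorem measurable_norm_toL2_harmonicPart (g : 𝓢(Eucl n, ℂ)) (k : ℕ) :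
    Measurable fun ρ => ‖toL2 n (harmonicPart n k (restrictSphere g ρ))‖ := by
  have h : Continuous fun r => toL2 n (harmonicPart n k (restrictSphere g r)) :=
    (ContinuousMap.toLp (E := ℂ) 2 (surf n) ℂ).continuous.comp
      (continuous_harmonicPart_restrictSphere g k)
  exact h.norm.measurable

theorem tsum_norm_sq_harmonicPart (g : C(Sph n, ℂ)) :
    ENNReal.ofReal (‖toL2 n g‖ ^ 2) =
      ∑' k, ENNReal.ofReal (‖toL2 n (harmonicPart n k g)‖ ^ 2) := by
  have h := hasSum_norm_sq_harmonicPart g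
  simp only [← norm_sq_toL2] at h
  rw [← h.tsum_eq, ENNReal.ofReal_tsum_of_nonneg (fun k => by positivity) h.summable]

/-- Parseval on each sphere, then Tonelli in the radius and the degree; the weight is radial, so it
does not mix degrees. -/
theorem PolyGrowth.lintegral_eq_tsum {m : ℕ → ℂ} (hm : PolyGrowth m) (g : 𝓢(Eucl n, ℂ)) (a : ℝ) :
    ∫⁻ ξ, ENNReal.ofReal (‖ξ‖ ^ a) *
        ‖onSphere (fun ρ => angularMult m (restrictSphere g ρ)) ξ‖ₑ ^ 2 =
      ∑' k, ‖m k‖ₑ ^ 2 * harmonicEnergy a g k := by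
  have hw : Measurable fun r : ℝ => ENNReal.ofReal (r ^ a) := by fun_prop
  rw [lintegral_onSphere (w := fun r => ENNReal.ofReal (r ^ a)) (hm.continuous g) hw]
  have hmeas : ∀ k, Measurable fun r : ℝ => ENNReal.ofReal (r ^ (n - 1)) *
      (ENNReal.ofReal (r ^ a) *
        ENNReal.ofReal (‖toL2 n (harmonicPart n k (restrictSphere g r))‖ ^ 2)) := fun k =>
    Measurable.mul (by fun_prop) (hw.mul
      ((measurable_norm_toL2_harmonicPart g k).pow_const 2).ennreal_ofReal)
  have h1 : ∀ k, ‖m k‖ₑ ^ 2 * harmonicEnergy a g k = ∫⁻ r in Ioi (0 : ℝ),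
      ‖m k‖ₑ ^ 2 * (ENNReal.ofReal (r ^ (n - 1)) * (ENNReal.ofReal (r ^ a) *
        ENNReal.ofReal (‖toL2 n (harmonicPart n k (restrictSphere g r))‖ ^ 2))) := by
    intro k
    rw [harmonicEnergy, lintegral_onSphere (w := fun r => ENNReal.ofReal (r ^ a))
      (continuous_harmonicPart_restrictSphere g k) hw, lintegral_const_mul _ (hmeas k)]
  simp only [h1]
  rw [← lintegral_tsum]
  · refine lintegral_congr fun r => ?_
    rw [tsum_norm_sq_harmonicPart, ← ENNReal.tsum_mul_left, ← ENNReal.tsum_mul_left]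
    refine tsum_congr fun k => ?_
    rw [hm.harmonicPart_angularMult, map_smul, norm_smul, mul_pow,
      ENNReal.ofReal_mul (by positivity), ENNReal.ofReal_pow (norm_nonneg _), ofReal_norm]
    ring
  · exact fun k => ((hmeas k).const_mul _).aemeasurable

theorem ae_ne_zero : ∀ᵐ x : Eucl n, x ≠ 0 := by
  have : Nonempty (Fin n) := ⟨⟨0, lt_of_lt_of_le two_pos (Fact.out : 2 ≤ n)⟩⟩
  simp [ae_iff]

theorem PolyGrowth.lintegral_lt_top {m : ℕ → ℂ} (hm : PolyGrowth m) (g : 𝓢(Eucl n, ℂ)) {a : ℝ}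
    (ha : -(n : ℝ) < a) : ∫⁻ ξ, ENNReal.ofReal (‖ξ‖ ^ a) *
      ‖onSphere (fun ρ => angularMult m (restrictSphere g ρ)) ξ‖ₑ ^ 2 < ∞ := by
  have h := lintegral_rpow_mul_lt_top ha (hm.norm_sq_onSphere_le g)
  refine lt_of_eq_of_lt (lintegral_congr fun x => ?_) h
  rw [ENNReal.ofReal_mul (by positivity), ENNReal.ofReal_pow (norm_nonneg _), ofReal_norm]

theorem tsum_harmonicEnergy_eq_lintegral (a s : ℝ) (g : 𝓢(Eucl n, ℂ)) :
    ∑' k, ENNReal.ofReal ((1 + sphEigenvalue n k) ^ s) * harmonicEnergy a g k =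
      ∫⁻ ξ, ENNReal.ofReal (‖ξ‖ ^ a) *
        ‖onSphere (fun ρ => angularMult (angularSymbol n s) (restrictSphere g ρ)) ξ‖ₑ ^ 2 := by
  rw [(polyGrowth_angularSymbol n s).lintegral_eq_tsum]
  refine tsum_congr fun k => ?_
  have hk := sphEigenvalue_nonneg n k
  have := enorm_sq_rpow_mul (a := s / 2) (t := 1 + sphEigenvalue n k) (by positivity) 1
  rw [mul_one, enorm_one, one_pow, mul_one, mul_div_cancel₀ s two_ne_zero] at this
  rw [angularSymbol, this]

/-- The `L²` norm of `D^a Λ_ω^s f` in terms of the harmonic components of the Fourier transform. -/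
theorem eLpNorm_fracD_angularPow_sq {a : ℝ} (ha : -(n : ℝ) < 2 * a) (s : ℝ) (f : 𝓢(Eucl n, ℂ)) :
    eLpNorm (fracD a (angularPow s f)) 2 volume ^ 2 =
      ENNReal.ofReal ((2 * Real.pi) ^ (2 * a)) *
        ∑' k, ENNReal.ofReal ((1 + sphEigenvalue n k) ^ s) * harmonicEnergy (2 * a) (𝓕 f) k := by
  have hm := polyGrowth_angularSymbol n s
  set W := onSphere fun ρ => angularMult (angularSymbol n s) (restrictSphere (𝓕 f) ρ) with hW
  have hWm : Measurable W := measurable_onSphere (hm.continuous (𝓕 f))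
  have hn2 : (0 : ℝ) < n := by
    have : 2 ≤ n := Fact.out
    positivity
  set h : Eucl n → ℂ := fun ξ => (((2 * Real.pi * ‖ξ‖) ^ a : ℝ) : ℂ) * W ξ with hh
  have h1 : (fun ξ : Eucl n => (((2 * Real.pi * ‖ξ‖) ^ a : ℝ) : ℂ) * 𝓕 (angularPow s f) ξ)
      =ᵐ[volume] h := by
    filter_upwards [ae_ne_zero] with ξ hξ
    have h2 : 𝓕 (angularPow s f) =
        𝓕 (onSphere fun r => angularMult (angularSymbol n s) (restrictSphere f r)) := by
      ext y
      rw [Real.fourier_eq, Real.fourier_eq]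
      refine integral_congr_ae ?_
      filter_upwards [angularPow_ae_eq s f] with x hx
      rw [hx]
    obtain ⟨ω, hω⟩ := exists_eq_smul hξ
    have h3 := hm.fourier_onSphere f ‖ξ‖ ω
    rw [← hω] at h3
    rw [h2, h3, hh, hW]
    have h4 := onSphere_smul (fun ρ => angularMult (angularSymbol n s) (restrictSphere (𝓕 f) ρ))
      (norm_pos_iff.2 hξ) ω
    rw [← hω] at h4
    simp only [h4]
  have h5 : fracD a (angularPow s f) = 𝓕⁻ h := by
    ext y
    rw [fracD, Real.fourierInv_eq, Real.fourierInv_eq]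
    refine integral_congr_ae ?_
    filter_upwards [h1] with x hx
    rw [hx]
  have hhm : Measurable h := by fun_prop
  have h6 : ∫⁻ ξ, ‖h ξ‖ₑ ^ 2 = ENNReal.ofReal ((2 * Real.pi) ^ (2 * a)) *
      ∫⁻ ξ, ENNReal.ofReal (‖ξ‖ ^ (2 * a)) * ‖W ξ‖ₑ ^ 2 := by
    rw [← lintegral_const_mul _ (by fun_prop)]
    refine lintegral_congr fun ξ => ?_
    rw [hh]
    simp only
    rw [enorm_sq_rpow_mul (by positivity), Real.mul_rpow (by positivity) (norm_nonneg _),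
      ENNReal.ofReal_mul (by positivity), mul_assoc]
  have hL1 : Integrable h := by
    refine ⟨hhm.aestronglyMeasurable, ?_⟩
    -- Integrability needs only a > -n: either a ≥ 0, or a > 2a > -n.
    have h7 := lintegral_rpow_mul_lt_top (a := a) (by
      by_cases h0 : 0 ≤ a <;> linarith) (hm.norm_onSphere_le (𝓕 f))
    rw [← hW] at h7
    rw [HasFiniteIntegral]
    refine lt_of_eq_of_lt ?_ (ENNReal.mul_lt_top
      (ENNReal.ofReal_lt_top (r := (2 * Real.pi) ^ a)) h7)
    rw [← lintegral_const_mul _ (by fun_prop)]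
    refine lintegral_congr fun ξ => ?_
    rw [hh]
    simp only
    rw [← ofReal_norm, norm_mul, Complex.norm_real, Real.norm_of_nonneg (by positivity),
      Real.mul_rpow (by positivity) (norm_nonneg _), ← ENNReal.ofReal_mul (by positivity),
      mul_assoc]
  have hL2 : MemLp h 2 := by
    refine ⟨hhm.aestronglyMeasurable, ?_⟩
    have h8 : eLpNorm h 2 volume ^ 2 < ∞ := by
      rw [eLpNorm_two_sq, h6]
      exact ENNReal.mul_lt_top ENNReal.ofReal_lt_top (hm.lintegral_lt_top (𝓕 f) ha)
    exact (ENNReal.pow_lt_top_iff.1 h8).resolve_right (by norm_num)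
  rw [h5, eLpNorm_fourierInv_eq hL1 hL2, eLpNorm_two_sq, h6, tsum_harmonicEnergy_eq_lintegral]

end Weighted

/-! ### Restriction estimate and its dual for a single degree -/

section Estimates

variable {n : ℕ} [Fact (2 ≤ n)]

theorem lintegral_rpow_comp_smul (b : ℝ) {c : ℝ} (hc : c ≠ 0) {G : Eucl n → ℝ≥0∞}
    (hG : Measurable G) : ∫⁻ ξ, ENNReal.ofReal (‖ξ‖ ^ (-b)) * G (c • ξ) =
      ENNReal.ofReal (|c| ^ (b - n)) * ∫⁻ ξ, ENNReal.ofReal (‖ξ‖ ^ (-b)) * G ξ := by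
  have hc' : 0 < |c| := abs_pos.2 hc
  set H : Eucl n → ℝ≥0∞ := fun x =>
    ENNReal.ofReal (|c| ^ b) * (ENNReal.ofReal (‖x‖ ^ (-b)) * G x) with hH
  have hHm : Measurable H := by fun_prop
  have h1 : ∀ ξ : Eucl n, ENNReal.ofReal (‖ξ‖ ^ (-b)) * G (c • ξ) = H (c • ξ) := by
    intro ξ
    rw [hH]
    simp only [norm_smul, Real.norm_eq_abs]
    rw [Real.mul_rpow hc'.le (norm_nonneg _), ← mul_assoc, ← ENNReal.ofReal_mul (by positivity),
      ← mul_assoc, ← Real.rpow_add hc']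
    simp
  have h2 := Measure.map_addHaar_smul (volume : Measure (Eucl n)) hc
  have h3 : ∫⁻ ξ, H (c • ξ) = ∫⁻ x, H x ∂(Measure.map (c • ·) volume) :=
    (lintegral_map hHm (measurable_const_smul c)).symm
  simp only [h1]
  rw [h3, h2, lintegral_smul_measure, hH, lintegral_const_mul _ (by fun_prop), smul_eq_mul,
    ← mul_assoc, ← ENNReal.ofReal_mul (by positivity)]
  congr 2
  rw [finrank_euclideanSpace_fin, abs_inv, abs_pow, Real.rpow_sub hc', Real.rpow_natCast]
  field_simp

/-- Cauchy–Schwarz after splitting |ξ|^e into |ξ|^{e+b/2} and |ξ|^{-b/2}. The case e = 0 serves the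
first and third inequalities, e = -b the second. -/
theorem sq_lintegral_weight_mul_le (e b : ℝ) {A B : Eucl n → ℝ≥0∞} (hA : Measurable A)
    (hB : Measurable B) : (∫⁻ ξ, ENNReal.ofReal (‖ξ‖ ^ e) * (A ξ * B ξ)) ^ 2 ≤
      (∫⁻ ξ, ENNReal.ofReal (‖ξ‖ ^ (2 * e + b)) * A ξ ^ 2) *
        ∫⁻ ξ, ENNReal.ofReal (‖ξ‖ ^ (-b)) * B ξ ^ 2 := by
  have h1 : ∫⁻ ξ, ENNReal.ofReal (‖ξ‖ ^ e) * (A ξ * B ξ) =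
      ∫⁻ ξ, (ENNReal.ofReal (‖ξ‖ ^ (e + b / 2)) * A ξ) *
        (ENNReal.ofReal (‖ξ‖ ^ (-b / 2)) * B ξ) := by
    refine lintegral_congr_ae ?_
    filter_upwards [ae_ne_zero] with ξ hξ
    have h2 : ‖ξ‖ ^ e = ‖ξ‖ ^ (e + b / 2) * ‖ξ‖ ^ (-b / 2) := by
      rw [← Real.rpow_add (norm_pos_iff.2 hξ)]
      congr 1
      ring
    rw [h2, ENNReal.ofReal_mul (by positivity)]
    ring
  have h3 : ∀ (a : ℝ) (ξ : Eucl n) (y : ℝ≥0∞), (ENNReal.ofReal (‖ξ‖ ^ a) * y) ^ 2 =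
      ENNReal.ofReal (‖ξ‖ ^ (2 * a)) * y ^ 2 := by
    intro a ξ y
    rw [mul_pow, ← ENNReal.ofReal_pow (by positivity), ← Real.rpow_natCast,
      ← Real.rpow_mul (norm_nonneg _), mul_comm a]
    norm_num
  rw [h1]
  refine (sq_lintegral_mul_le (by fun_prop) (by fun_prop)).trans_eq ?_
  simp only [h3]
  congr 3 <;> ring_nf

theorem fourier_onSphere_harmonicPart (f : 𝓢(Eucl n, ℂ)) (k : ℕ) {ξ : Eucl n} (hξ : ξ ≠ 0) :
    onSphere (fun ρ => harmonicPart n k (restrictSphere (𝓕 f) ρ)) ξ =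
      𝓕 (onSphere fun r => harmonicPart n k (restrictSphere f r)) ξ := by
  obtain ⟨ω, hω⟩ := exists_eq_smul hξ
  have h := (polyGrowth_single k).fourier_onSphere f ‖ξ‖ ω
  simp only [angularMult_single] at h
  rw [hω, onSphere_smul _ (norm_pos_iff.2 hξ), h]

theorem integrable_onSphere_harmonicPart (f : 𝓢(Eucl n, ℂ)) (k : ℕ) :
    Integrable (onSphere fun r => harmonicPart n k (restrictSphere f r)) := by
  have h := (polyGrowth_single k).integrable_onSphere f
  simpa only [angularMult_single] using h

theorem measurable_onSphere_harmonicPart (f : 𝓢(Eucl n, ℂ)) (k : ℕ) :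
    Measurable (onSphere fun r => harmonicPart n k (restrictSphere f r)) :=
  measurable_onSphere (continuous_harmonicPart_restrictSphere f k)

/-- The weighted Fourier restriction estimate on a sphere of arbitrary radius. -/
theorem exists_sq_lintegral_mul_sphFourier_le {b : ℝ} (hb : 1 < b) (hbn : b < n) : ∃ C : ℝ, 0 ≤ C ∧
    ∀ (e : ℝ) (g : 𝓢(Eucl n, ℂ)) (k : ℕ) (Y : C(Sph n, ℂ)), Y ∈ sphericalHarmonics n k →
      ∀ c : ℝ, c ≠ 0 →
        (∫⁻ ξ, ENNReal.ofReal (‖ξ‖ ^ e) *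
          (‖onSphere (fun ρ => harmonicPart n k (restrictSphere g ρ)) ξ‖ₑ *
            ‖sphFourier Y (c • ξ)‖ₑ)) ^ 2 ≤
          harmonicEnergy (2 * e + b) g k *
            ENNReal.ofReal (C * (k + 1 : ℝ) ^ (1 - b) * |c| ^ (b - n) * ‖toL2 n Y‖ ^ 2) := by
  obtain ⟨C, hC, h⟩ := exists_lintegral_sphFourier_le (n := n) hb hbn
  refine ⟨C, hC, fun e g k Y hY c hc => ?_⟩
  have hF := measurable_onSphere_harmonicPart g k
  refine (sq_lintegral_weight_mul_le e b hF.enorm (B := fun ξ => ‖sphFourier Y (c • ξ)‖ₑ)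
    (Continuous.measurable (by fun_prop))).trans ?_
  refine mul_le_mul' le_rfl ?_
  have hm : Measurable fun ξ => ‖sphFourier Y ξ‖ₑ ^ 2 := Continuous.measurable (by fun_prop)
  rw [lintegral_rpow_comp_smul b hc hm]
  calc _ ≤ ENNReal.ofReal (|c| ^ (b - n)) *
        ENNReal.ofReal (C * (k + 1 : ℝ) ^ (1 - b) * ‖toL2 n Y‖ ^ 2) := by
        gcongr
        exact h k Y hY
    _ = _ := by
        rw [← ENNReal.ofReal_mul (by positivity)]
        congr 1
        ring

/-- Pointwise bound for a harmonic component by its weighted energy on the Fourier side. -/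
theorem exists_norm_sq_harmonicPart_le {b : ℝ} (hb : 1 < b) (hbn : b < n) : ∃ C : ℝ, 0 ≤ C ∧
    ∀ (f : 𝓢(Eucl n, ℂ)) (k : ℕ) (r : ℝ), 0 < r →
      ENNReal.ofReal (‖toL2 n (harmonicPart n k (restrictSphere f r))‖ ^ 2) ≤
        ENNReal.ofReal (C * (k + 1 : ℝ) ^ (1 - b) * r ^ (b - n)) *
          harmonicEnergy b (𝓕 f) k := by
  obtain ⟨C, hC, h⟩ := exists_sq_lintegral_mul_sphFourier_le (n := n) hb hbn
  refine ⟨C, hC, fun f k r hr => ?_⟩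
  set Y := harmonicPart n k (restrictSphere f r) with hY
  have hmem : star Y ∈ sphericalHarmonics n k := star_mem_sphericalHarmonics (harmonicPart_mem k _)
  have h1 := norm_sq_harmonicPart_eq f k r
  -- The function integrated against the transform of f has pure degree k, so only the degree-k
  -- component of that transform matters and its energy alone appears.
  have h2 := (polyGrowth_single k).integral_onSphere_mul_sphFourier (𝓕 f) hmem (-r)
  rw [Pi.single_eq_same, one_mul] at h2
  simp only [angularMult_single] at h2
  rw [← hY, ← h2] at h1
  have h3 : ENNReal.ofReal (‖toL2 n Y‖ ^ 2) ≤ ∫⁻ ξ, ENNReal.ofReal (‖ξ‖ ^ (0 : ℝ)) *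
      (‖onSphere (fun ρ => harmonicPart n k (restrictSphere (𝓕 f) ρ)) ξ‖ₑ *
        ‖sphFourier (star Y) ((-r) • ξ)‖ₑ) := by
    have h4 : ENNReal.ofReal (‖toL2 n Y‖ ^ 2) = ‖((‖toL2 n Y‖ ^ 2 : ℝ) : ℂ)‖ₑ := by
      rw [← ofReal_norm, Complex.norm_real, Real.norm_of_nonneg (by positivity)]
    rw [h4, h1]
    refine (enorm_integral_le_lintegral_enorm _).trans_eq ?_
    simp [enorm_mul]
  have h5 := h 0 (𝓕 f) k (star Y) hmem (-r) (neg_ne_zero.2 hr.ne')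
  rw [norm_toL2_star, abs_neg, abs_of_pos hr, mul_zero, zero_add] at h5
  rcases (sq_nonneg ‖toL2 n Y‖).eq_or_lt with h0 | h0
  · rw [← h0, ENNReal.ofReal_zero]
    exact zero_le
  · have h6 : ENNReal.ofReal (‖toL2 n Y‖ ^ 2) ≠ 0 := (ENNReal.ofReal_pos.2 h0).ne'
    rw [← ENNReal.mul_le_mul_iff_right h6 ENNReal.ofReal_ne_top, ← pow_two]
    refine (pow_le_pow_left' h3 2).trans (h5.trans_eq ?_)
    rw [ENNReal.ofReal_mul (by positivity)]
    ring

theorem enorm_fourier_onSphere_le (f : 𝓢(Eucl n, ℂ)) (k : ℕ) {ξ : Eucl n} (hξ : ξ ≠ 0) :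
    ‖onSphere (fun ρ => harmonicPart n k (restrictSphere (𝓕 f) ρ)) ξ‖ₑ ≤
      ∫⁻ r in Ioi (0 : ℝ), ENNReal.ofReal (r ^ (n - 1)) *
        ‖sphFourier (harmonicPart n k (restrictSphere f r)) (r • ξ)‖ₑ := by
  have hi := integrable_onSphere_harmonicPart f k
  rw [fourier_onSphere_harmonicPart f k hξ, Real.fourier_eq', integral_polar]
  · refine (enorm_integral_le_lintegral_enorm _).trans_eq ?_
    refine setLIntegral_congr_fun measurableSet_Ioi fun r hr => ?_
    have hr' : 0 ≤ r ^ (n - 1) := pow_nonneg (le_of_lt hr) _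
    simp only [onSphere_smul _ hr]
    rw [enorm_smul, Real.enorm_of_nonneg hr']
    congr 2
    rw [sphFourier]
    refine integral_congr_ae (Filter.Eventually.of_forall fun ω => ?_)
    simp only [real_inner_smul_left, inner_smul_right, smul_eq_mul]
  · refine hi.bdd_mul (c := 1) (Continuous.aestronglyMeasurable (by fun_prop))
      (Filter.Eventually.of_forall fun x => ?_)
    exact (Complex.norm_exp_ofReal_mul_I _).le

theorem continuous_sphFourier_harmonicPart (f : 𝓢(Eucl n, ℂ)) (k : ℕ) :
    Continuous fun p : Eucl n × ℝ =>
      sphFourier (harmonicPart n k (restrictSphere f p.2)) (p.2 • p.1) := by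
  have h := continuous_harmonicPart_restrictSphere f k
  refine continuous_integral_sphere ?_
  simp only [Function.uncurry_def]
  refine Continuous.mul (by fun_prop) ?_
  exact ContinuousEval.continuous_eval.comp (Continuous.prodMk (h.comp (by fun_prop)) (by fun_prop))

theorem rpow_half_sq (x : ℝ≥0∞) : (x ^ (1 / 2 : ℝ)) ^ 2 = x := by
  rw [← ENNReal.rpow_natCast, ← ENNReal.rpow_mul]
  norm_num

theorem le_of_sq_le_sq_ennreal {x y : ℝ≥0∞} (h : x ^ 2 ≤ y ^ 2) : x ≤ y :=
  (ENNReal.pow_right_strictMono two_ne_zero).le_iff_le.1 h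

/-- Bound for the energy of negative order by a weighted radial integral. -/
theorem exists_harmonicEnergy_neg_le {b : ℝ} (hb : 1 < b) (hbn : b < n) : ∃ C : ℝ, 0 ≤ C ∧
    ∀ (f : 𝓢(Eucl n, ℂ)) (k : ℕ), harmonicEnergy (-b) (𝓕 f) k ≤
      ENNReal.ofReal (C * (k + 1 : ℝ) ^ ((1 - b) / 2)) * harmonicEnergy (-b) (𝓕 f) k ^ (1 / 2 : ℝ) *
        ∫⁻ r in Ioi (0 : ℝ), ENNReal.ofReal (r ^ (n - 1)) * ENNReal.ofReal (r ^ ((b - n) / 2)) *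
          ENNReal.ofReal ‖toL2 n (harmonicPart n k (restrictSphere f r))‖ := by
  obtain ⟨C, hC, h⟩ := exists_sq_lintegral_mul_sphFourier_le (n := n) hb hbn
  refine ⟨Real.sqrt C, Real.sqrt_nonneg C, fun f k => ?_⟩
  set N := harmonicEnergy (-b) (𝓕 f) k with hN
  set F := onSphere (fun ρ => harmonicPart n k (restrictSphere (𝓕 f) ρ)) with hF
  set Y := fun r => harmonicPart n k (restrictSphere f r) with hY
  have hFm : Measurable F := measurable_onSphere_harmonicPart (𝓕 f) k
  have hS := continuous_sphFourier_harmonicPart f k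
  have hYm : Measurable fun r => ENNReal.ofReal ‖toL2 n (Y r)‖ :=
    (measurable_norm_toL2_harmonicPart f k).ennreal_ofReal
  have hSm : Measurable fun p : Eucl n × ℝ => ‖sphFourier (Y p.2) (p.2 • p.1)‖ₑ :=
    hS.enorm.measurable
  have hk : (0 : ℝ) < k + 1 := by positivity
  -- One of the two factors ‖F ξ‖ is expanded as a Fourier integral in polar coordinates. The other
  -- stays and returns as N^{1/2}; it is not divided out here, so that the sum over k can be taken
  -- inside the radial integral without Minkowski's inequality.
  calc N ≤ ∫⁻ ξ, ∫⁻ r in Ioi (0 : ℝ), ENNReal.ofReal (‖ξ‖ ^ (-b)) * ‖F ξ‖ₑ *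
        (ENNReal.ofReal (r ^ (n - 1)) * ‖sphFourier (Y r) (r • ξ)‖ₑ) := by
        refine lintegral_mono_ae ?_
        filter_upwards [ae_ne_zero] with ξ hξ
        have hm1 : Measurable fun r : ℝ =>
            ENNReal.ofReal (r ^ (n - 1)) * ‖sphFourier (Y r) (r • ξ)‖ₑ :=
          Measurable.mul (by fun_prop) (hSm.comp (by fun_prop : Measurable fun r => (ξ, r)))
        rw [lintegral_const_mul _ hm1, pow_two, ← mul_assoc]
        gcongr
        exact enorm_fourier_onSphere_le f k hξ
    _ = ∫⁻ r in Ioi (0 : ℝ), ∫⁻ ξ, ENNReal.ofReal (‖ξ‖ ^ (-b)) * ‖F ξ‖ₑ *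
        (ENNReal.ofReal (r ^ (n - 1)) * ‖sphFourier (Y r) (r • ξ)‖ₑ) := by
        refine lintegral_lintegral_swap (Measurable.aemeasurable ?_)
        exact Measurable.mul (by fun_prop) (Measurable.mul (by fun_prop) hSm)
    _ = ∫⁻ r in Ioi (0 : ℝ), ENNReal.ofReal (r ^ (n - 1)) *
        ∫⁻ ξ, ENNReal.ofReal (‖ξ‖ ^ (-b)) * (‖F ξ‖ₑ * ‖sphFourier (Y r) (r • ξ)‖ₑ) := by
        refine lintegral_congr fun r => ?_
        have hm1 : Measurable fun ξ : Eucl n =>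
            ENNReal.ofReal (‖ξ‖ ^ (-b)) * (‖F ξ‖ₑ * ‖sphFourier (Y r) (r • ξ)‖ₑ) :=
          Measurable.mul (by fun_prop)
            (hFm.enorm.mul (hSm.comp (by fun_prop : Measurable fun ξ => (ξ, r))))
        rw [← lintegral_const_mul _ hm1]
        refine lintegral_congr fun ξ => ?_
        ring
    _ ≤ ∫⁻ r in Ioi (0 : ℝ), ENNReal.ofReal (Real.sqrt C * (k + 1 : ℝ) ^ ((1 - b) / 2)) *
        N ^ (1 / 2 : ℝ) * (ENNReal.ofReal (r ^ (n - 1)) * ENNReal.ofReal (r ^ ((b - n) / 2)) *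
          ENNReal.ofReal ‖toL2 n (Y r)‖) := by
        refine setLIntegral_mono' measurableSet_Ioi fun r hr => ?_
        have hr : 0 < r := hr
        -- With e = -b the energy exponent 2e + b is again -b, so N reappears on the right.
        have h1 := h (-b) (𝓕 f) k (Y r) (harmonicPart_mem k _) r hr.ne'
        rw [abs_of_pos hr, show 2 * -b + b = -b by ring, ← hF, ← hN] at h1
        have hsq : ∀ {t : ℝ} (_ : 0 < t) (a : ℝ), (t ^ (a / 2)) ^ 2 = t ^ a := by
          intro t ht a
          rw [← Real.rpow_natCast, ← Real.rpow_mul ht.le]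
          congr 1
          norm_num
        have h2 : ∫⁻ ξ, ENNReal.ofReal (‖ξ‖ ^ (-b)) * (‖F ξ‖ₑ * ‖sphFourier (Y r) (r • ξ)‖ₑ) ≤
            N ^ (1 / 2 : ℝ) * ENNReal.ofReal (Real.sqrt C * (k + 1 : ℝ) ^ ((1 - b) / 2) *
              r ^ ((b - n) / 2) * ‖toL2 n (Y r)‖) := by
          refine le_of_sq_le_sq_ennreal (h1.trans_eq ?_)
          rw [mul_pow, rpow_half_sq, ← ENNReal.ofReal_pow (by positivity), mul_pow, mul_pow,
            mul_pow, Real.sq_sqrt hC, hsq hk, hsq hr]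
        refine (mul_le_mul' le_rfl h2).trans_eq ?_
        rw [ENNReal.ofReal_mul (by positivity), ENNReal.ofReal_mul (by positivity)]
        ring
    _ = _ := by
        have hm1 : Measurable fun r : ℝ => ENNReal.ofReal (r ^ (n - 1)) *
            ENNReal.ofReal (r ^ ((b - n) / 2)) * ENNReal.ofReal ‖toL2 n (Y r)‖ :=
          Measurable.mul (by fun_prop) hYm
        rw [lintegral_const_mul _ hm1]

end Estimates

/-! ### Summation over degrees and the three inequalities -/

section Comparison

variable {n : ℕ} [Fact (2 ≤ n)]

theorem sq_rpow_eq {q : ℝ} (hq : 0 ≤ q) (t : ℝ) : (q ^ 2) ^ t = q ^ (2 * t) := by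
  rw [Real.rpow_mul hq, Real.rpow_ofNat]

theorem one_add_sphEigenvalue_rpow_le {t : ℝ} (ht : 0 ≤ t) (k : ℕ) :
    (1 + sphEigenvalue n k) ^ t ≤ (n : ℝ) ^ t * (k + 1 : ℝ) ^ (2 * t) := by
  have h := sphEigenvalue_nonneg n k
  rw [← sq_rpow_eq (by positivity), ← Real.mul_rpow (by positivity) (by positivity)]
  exact Real.rpow_le_rpow (by positivity) (one_add_sphEigenvalue_le n k) ht

theorem le_one_add_sphEigenvalue_rpow {t : ℝ} (ht : 0 ≤ t) (k : ℕ) :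
    (k + 1 : ℝ) ^ (2 * t) ≤ 2 ^ t * (1 + sphEigenvalue n k) ^ t := by
  have h := sphEigenvalue_nonneg n k
  rw [← sq_rpow_eq (by positivity), ← Real.mul_rpow (by positivity) (by positivity)]
  refine Real.rpow_le_rpow (by positivity) ?_ ht
  linarith [le_one_add_sphEigenvalue n k]

theorem eLpNorm_sphere (g : C(Sph n, ℂ)) : eLpNorm g 2 (surf n) = ENNReal.ofReal ‖toL2 n g‖ := by
  have h : (toL2 n g : Sph n → ℂ) =ᵐ[surf n] g := ContinuousMap.coeFn_toLp (surf n) g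
  rw [ofReal_norm, Lp.enorm_def, eLpNorm_congr_ae h]

theorem sphereNorm_two_eq (f : 𝓢(Eucl n, ℂ)) (r : ℝ) :
    sphereNorm 2 f r = ENNReal.ofReal ‖toL2 n (restrictSphere f r)‖ :=
  eLpNorm_sphere (restrictSphere f r)

theorem sphereNorm_top_le (f : 𝓢(Eucl n, ℂ)) (r : ℝ) :
    sphereNorm ∞ f r ≤ ‖restrictSphere f r‖ₑ := by
  rw [sphereNorm, eLpNorm_exponent_top]
  refine eLpNormEssSup_le_of_ae_enorm_bound (Filter.Eventually.of_forall fun ω => ?_)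
  rw [← ofReal_norm, ← ofReal_norm]
  exact ENNReal.ofReal_le_ofReal ((restrictSphere f r).norm_coe_le_norm ω)

theorem mixedNorm_eq (a : ℝ) (f : 𝓢(Eucl n, ℂ)) :
    mixedNorm (fun x => ((‖x‖ ^ a : ℝ) : ℂ) * f x) = ∫⁻ r in Ioi (0 : ℝ),
      ENNReal.ofReal (r ^ (n - 1)) * ENNReal.ofReal (r ^ a) *
        ENNReal.ofReal ‖toL2 n (restrictSphere f r)‖ := by
  refine setLIntegral_congr_fun measurableSet_Ioi fun r hr => ?_
  have hr : 0 < r := hr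
  have h : (fun ω : Sph n => ((‖r • (ω : Eucl n)‖ ^ a : ℝ) : ℂ) * f (r • (ω : Eucl n))) =
      ((r ^ a : ℝ) : ℂ) • ⇑(restrictSphere f r) := by
    ext ω
    simp only [norm_smul, norm_eq_of_mem_sphere, mul_one, Real.norm_of_nonneg hr.le]
    rfl
  simp only [sphereNorm]
  rw [h, eLpNorm_const_smul, eLpNorm_sphere, ← ofReal_norm, Complex.norm_real,
    Real.norm_of_nonneg (by positivity)]
  ring

/-- The factor (2π)^b from the normalisation of the Fourier transform is at least 1 and is dropped.
-/
theorem tsum_harmonicEnergy_le_eLpNorm_sq {b : ℝ} (hb : 0 ≤ b) (s : ℝ) (f : 𝓢(Eucl n, ℂ)) :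
    ∑' k, ENNReal.ofReal ((1 + sphEigenvalue n k) ^ s) * harmonicEnergy b (𝓕 f) k ≤
      eLpNorm (fracD (b / 2) (angularPow s f)) 2 volume ^ 2 := by
  have hn : 2 ≤ n := Fact.out
  have hn' : (0 : ℝ) < n := by positivity
  rw [eLpNorm_fracD_angularPow_sq (by linarith), mul_div_cancel₀ b two_ne_zero]
  refine le_mul_of_one_le_left' ?_
  rw [ENNReal.one_le_ofReal]
  exact Real.one_le_rpow (by linarith [Real.two_le_pi]) hb

/-- After squaring, Parseval on the sphere reduces the claim to each degree, where (k+1)^{1-b} is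
compared with (1+k(k+n-2))^{(1-b)/2}. -/
theorem exists_sphereNorm_two_le {b : ℝ} (hb : 1 < b) (hbn : b < n) : ∃ C : ℝ≥0,
    ∀ f : 𝓢(Eucl n, ℂ), (⨆ (r : ℝ) (_ : 0 < r),
        ENNReal.ofReal (r ^ (((n : ℝ) - b) / 2)) * sphereNorm 2 f r) ≤
      C * eLpNorm (fracD (b / 2) (angularPow ((1 - b) / 2) f)) 2 volume := by
  obtain ⟨C, hC, h⟩ := exists_norm_sq_harmonicPart_le (n := n) hb hbn
  set K := Real.sqrt (C * (n : ℝ) ^ ((b - 1) / 2)) with hK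
  refine ⟨K.toNNReal, fun f => iSup₂_le fun r hr => le_of_sq_le_sq_ennreal ?_⟩
  change _ ≤ (ENNReal.ofReal K * _) ^ 2
  have hr2 : (r ^ ((n - b) / 2)) ^ 2 = (r ^ (b - n))⁻¹ := by
    rw [← Real.rpow_neg hr.le, ← Real.rpow_natCast, ← Real.rpow_mul hr.le]
    congr 1
    push_cast
    ring
  rw [mul_pow, mul_pow, sphereNorm_two_eq, ← ENNReal.ofReal_pow (norm_nonneg _),
    ← ENNReal.ofReal_pow (by positivity), ← ENNReal.ofReal_pow (by positivity),
    tsum_norm_sq_harmonicPart, hr2, hK, Real.sq_sqrt (by positivity)]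
  refine le_trans ?_ (mul_le_mul' le_rfl
    (tsum_harmonicEnergy_le_eLpNorm_sq (by linarith) ((1 - b) / 2) f))
  rw [← ENNReal.tsum_mul_left, ← ENNReal.tsum_mul_left]
  refine ENNReal.tsum_le_tsum fun k => ?_
  refine (mul_le_mul' le_rfl (h f k r hr)).trans ?_
  rw [← mul_assoc, ← mul_assoc, ← ENNReal.ofReal_mul (by positivity),
    ← ENNReal.ofReal_mul (by positivity)]
  refine mul_le_mul' (ENNReal.ofReal_le_ofReal ?_) le_rfl
  have hk := sphEigenvalue_nonneg n k
  have h1 := one_add_sphEigenvalue_rpow_le (n := n) (t := (b - 1) / 2) (by linarith) k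
  rw [mul_div_cancel₀ _ two_ne_zero] at h1
  have h2 : (k + 1 : ℝ) ^ (1 - b) = ((k + 1 : ℝ) ^ (b - 1))⁻¹ := by
    rw [← Real.rpow_neg (by positivity), neg_sub]
  have h3 : (1 + sphEigenvalue n k) ^ ((1 - b) / 2) =
      ((1 + sphEigenvalue n k) ^ ((b - 1) / 2))⁻¹ := by
    rw [← Real.rpow_neg (by positivity)]
    congr 1
    ring
  have h4 : ((k + 1 : ℝ) ^ (b - 1))⁻¹ ≤
      (n : ℝ) ^ ((b - 1) / 2) * ((1 + sphEigenvalue n k) ^ ((b - 1) / 2))⁻¹ := by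
    rw [← div_eq_mul_inv, inv_eq_one_div, div_le_div_iff₀ (by positivity) (by positivity), one_mul]
    exact h1
  have hrr : r ^ (b - n) ≠ 0 := by positivity
  calc (r ^ (b - n))⁻¹ * (C * (k + 1 : ℝ) ^ (1 - b) * r ^ (b - n))
      = C * (k + 1 : ℝ) ^ (1 - b) := by field_simp
    _ ≤ C * ((n : ℝ) ^ ((b - 1) / 2) * ((1 + sphEigenvalue n k) ^ ((b - 1) / 2))⁻¹) := by
        rw [h2]
        gcongr
    _ = _ := by rw [h3, mul_assoc]

/-- Let T be the sum of the weighted energies. Summing the one-degree bounds and using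
Cauchy–Schwarz over k inside the radial integral gives T ≤ K T^{1/2} M, with M the mixed norm;
T^{1/2} is then cancelled. -/
theorem exists_eLpNorm_le_mixedNorm {b : ℝ} (hb : 1 < b) (hbn : b < n) : ∃ C : ℝ≥0,
    ∀ f : 𝓢(Eucl n, ℂ), eLpNorm (fracD (-b / 2) (angularPow ((b - 1) / 2) f)) 2 volume ≤
      C * mixedNorm (fun x => ((‖x‖ ^ ((b - (n : ℝ)) / 2) : ℝ) : ℂ) * f x) := by
  obtain ⟨C, hC, h⟩ := exists_harmonicEnergy_neg_le (n := n) hb hbn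
  set K := C * (n : ℝ) ^ ((b - 1) / 4) with hK
  have hK0 : 0 ≤ K := by positivity
  refine ⟨K.toNNReal, fun f => ?_⟩
  change _ ≤ ENNReal.ofReal K * _
  set c : ℕ → ℝ≥0∞ := fun k => ENNReal.ofReal ((1 + sphEigenvalue n k) ^ ((b - 1) / 2)) with hc
  set N : ℕ → ℝ≥0∞ := fun k => harmonicEnergy (-b) (𝓕 f) k with hN
  set T := ∑' k, c k * N k with hT
  -- The final cancellation needs T finite. This holds for Schwartz functions because -b > -n.
  have hTtop : T < ∞ := by
    rw [hT, hc, hN, tsum_harmonicEnergy_eq_lintegral]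
    exact (polyGrowth_angularSymbol n _).lintegral_lt_top _ (by linarith)
  have hT1 : eLpNorm (fracD (-b / 2) (angularPow ((b - 1) / 2) f)) 2 volume ^ 2 ≤ T := by
    rw [eLpNorm_fracD_angularPow_sq (by linarith), mul_div_cancel₀ _ two_ne_zero]
    refine mul_le_of_le_one_left' ?_
    rw [ENNReal.ofReal_le_one]
    exact Real.rpow_le_one_of_one_le_of_nonpos (by linarith [Real.two_le_pi]) (by linarith)
  set v : ℝ → ℝ≥0∞ := fun r => ENNReal.ofReal (r ^ (n - 1)) * ENNReal.ofReal (r ^ ((b - n) / 2))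
    with hv
  have hvm : Measurable v := by fun_prop
  set y : ℕ → ℝ → ℝ≥0∞ := fun k r =>
    ENNReal.ofReal ‖toL2 n (harmonicPart n k (restrictSphere f r))‖ with hy
  have hym : ∀ k, Measurable (y k) := fun k => (measurable_norm_toL2_harmonicPart f k).ennreal_ofReal
  set M := mixedNorm (fun x => ((‖x‖ ^ ((b - (n : ℝ)) / 2) : ℝ) : ℂ) * f x) with hM
  -- The gain (k+1)^{(1-b)/2} cancels half of the angular weight; the other half pairs with N^{1/2}.
  have hck : ∀ k, c k * ENNReal.ofReal (C * (k + 1 : ℝ) ^ ((1 - b) / 2)) ≤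
      ENNReal.ofReal K * c k ^ (1 / 2 : ℝ) := by
    intro k
    have hk := sphEigenvalue_nonneg n k
    rw [hc]
    simp only
    rw [ENNReal.ofReal_rpow_of_nonneg (by positivity) (by norm_num), ← Real.rpow_mul (by positivity),
      ← ENNReal.ofReal_mul (by positivity), ← ENNReal.ofReal_mul hK0]
    refine ENNReal.ofReal_le_ofReal ?_
    have h1 := one_add_sphEigenvalue_rpow_le (n := n) (t := (b - 1) / 4) (by linarith) k
    have h2 : (1 + sphEigenvalue n k) ^ ((b - 1) / 2) =
        (1 + sphEigenvalue n k) ^ ((b - 1) / 4) * (1 + sphEigenvalue n k) ^ ((b - 1) / 4) := by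
      rw [← Real.rpow_add (by positivity)]
      congr 1
      ring
    have h3 : (k + 1 : ℝ) ^ (2 * ((b - 1) / 4)) * (k + 1 : ℝ) ^ ((1 - b) / 2) = 1 := by
      rw [← Real.rpow_add (by positivity), show 2 * ((b - 1) / 4) + (1 - b) / 2 = 0 by ring,
        Real.rpow_zero]
    rw [h2, show (b - 1) / 2 * (1 / 2) = (b - 1) / 4 by ring]
    calc _ ≤ (1 + sphEigenvalue n k) ^ ((b - 1) / 4) *
          ((n : ℝ) ^ ((b - 1) / 4) * (k + 1 : ℝ) ^ (2 * ((b - 1) / 4))) *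
            (C * (k + 1 : ℝ) ^ ((1 - b) / 2)) := by gcongr
      _ = K * (1 + sphEigenvalue n k) ^ ((b - 1) / 4) *
          ((k + 1 : ℝ) ^ (2 * ((b - 1) / 4)) * (k + 1 : ℝ) ^ ((1 - b) / 2)) := by
          rw [hK]
          ring
      _ = _ := by rw [h3, mul_one]
  have hsum : ∀ r, ∑' k, (c k * N k) ^ (1 / 2 : ℝ) * y k r ≤
      T ^ (1 / 2 : ℝ) * ENNReal.ofReal ‖toL2 n (restrictSphere f r)‖ := by
    intro r
    refine le_of_sq_le_sq_ennreal ((sq_tsum_mul_le _ _).trans_eq ?_)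
    simp only [rpow_half_sq, mul_pow _ _ 2]
    rw [← ENNReal.ofReal_pow (norm_nonneg _), tsum_norm_sq_harmonicPart]
    simp only [hy, ENNReal.ofReal_pow (norm_nonneg _), ← hT]
  have hmain : T ≤ T ^ (1 / 2 : ℝ) * (ENNReal.ofReal K * M) := by
    calc T ≤ ∑' k, ENNReal.ofReal K * (c k * N k) ^ (1 / 2 : ℝ) *
          ∫⁻ r in Ioi (0 : ℝ), v r * y k r := by
          refine ENNReal.tsum_le_tsum fun k => ?_
          calc c k * N k ≤ c k * (ENNReal.ofReal (C * (k + 1 : ℝ) ^ ((1 - b) / 2)) *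
                N k ^ (1 / 2 : ℝ) * ∫⁻ r in Ioi (0 : ℝ), v r * y k r) :=
                mul_le_mul' le_rfl (h f k)
            _ = (c k * ENNReal.ofReal (C * (k + 1 : ℝ) ^ ((1 - b) / 2))) *
                (N k ^ (1 / 2 : ℝ) * ∫⁻ r in Ioi (0 : ℝ), v r * y k r) := by ring
            _ ≤ (ENNReal.ofReal K * c k ^ (1 / 2 : ℝ)) *
                (N k ^ (1 / 2 : ℝ) * ∫⁻ r in Ioi (0 : ℝ), v r * y k r) :=
                mul_le_mul' (hck k) le_rfl
            _ = _ := by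
                rw [ENNReal.mul_rpow_of_nonneg _ _ (by norm_num)]
                ring
      _ = ∫⁻ r in Ioi (0 : ℝ), ∑' k, ENNReal.ofReal K * (c k * N k) ^ (1 / 2 : ℝ) *
          (v r * y k r) := by
          have hm1 : ∀ k, Measurable fun r => v r * y k r := fun k => hvm.mul (hym k)
          rw [lintegral_tsum fun k => ((hm1 k).const_mul _).aemeasurable]
          exact tsum_congr fun k => (lintegral_const_mul _ (hm1 k)).symm
      _ ≤ ∫⁻ r in Ioi (0 : ℝ), (ENNReal.ofReal K * T ^ (1 / 2 : ℝ)) *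
          (v r * ENNReal.ofReal ‖toL2 n (restrictSphere f r)‖) := by
          refine lintegral_mono fun r => ?_
          calc _ = ∑' k, ENNReal.ofReal K * v r * ((c k * N k) ^ (1 / 2 : ℝ) * y k r) :=
                tsum_congr fun k => by ring
            _ ≤ ENNReal.ofReal K * v r *
                (T ^ (1 / 2 : ℝ) * ENNReal.ofReal ‖toL2 n (restrictSphere f r)‖) := by
                rw [ENNReal.tsum_mul_left]
                exact mul_le_mul' le_rfl (hsum r)
            _ = _ := by ring
      _ = _ := by
          have hcont : Continuous fun r => toL2 n (restrictSphere f r) :=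
            (ContinuousMap.toLp (E := ℂ) 2 (surf n) ℂ).continuous.comp (continuous_restrictSphere f)
          have hm1 : Measurable fun r => v r * ENNReal.ofReal ‖toL2 n (restrictSphere f r)‖ :=
            hvm.mul hcont.norm.measurable.ennreal_ofReal
          rw [lintegral_const_mul _ hm1, hM, mixedNorm_eq]
          ring
  have hT2 : T ^ (1 / 2 : ℝ) ≤ ENNReal.ofReal K * M := by
    by_cases h0 : T ^ (1 / 2 : ℝ) = 0
    · rw [h0]
      exact zero_le
    · have h1 : T ^ (1 / 2 : ℝ) ≠ ∞ := (ENNReal.rpow_lt_top_of_nonneg (by norm_num) hTtop.ne).ne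
      rw [← ENNReal.mul_le_mul_iff_right h0 h1]
      refine le_trans (le_of_eq ?_) hmain
      rw [← pow_two, rpow_half_sq]
  refine le_trans (le_of_sq_le_sq_ennreal ?_) hT2
  rwa [rpow_half_sq]

theorem exists_sphereNorm_top_le {b : ℝ} (hb : 1 < b) (hbn : b < n) {s : ℝ}
    (hs : ((n : ℝ) - b) / 2 < s) : ∃ C : ℝ≥0,
    ∀ f : 𝓢(Eucl n, ℂ), (⨆ (r : ℝ) (_ : 0 < r),
        ENNReal.ofReal (r ^ (((n : ℝ) - b) / 2)) * sphereNorm ∞ f r) ≤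
      C * eLpNorm (fracD (b / 2) (angularPow s f)) 2 volume := by
  have hn : 2 ≤ n := Fact.out
  have hs0 : 0 < s := by linarith
  obtain ⟨C, hC, h⟩ := exists_norm_sq_harmonicPart_le (n := n) hb hbn
  obtain ⟨A, hA, hA'⟩ := exists_norm_harmonic_le n
  -- Chosen so that -e + (n-2) + (1-b) = 2s: the Cauchy–Schwarz weight, the sup-norm loss and the
  -- restriction gain together give the power of Λ_ω^s. Summability needs e < -1, which is s >
  -- (n-b)/2.
  set e : ℝ := (n : ℝ) - 1 - b - 2 * s with he
  have hsum : Summable fun k : ℕ => (k + 1 : ℝ) ^ e := by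
    have := (summable_nat_add_iff 1).2 (Real.summable_nat_rpow (p := e).2 (by linarith))
    simpa using this
  set B := ∑' k : ℕ, (k + 1 : ℝ) ^ e with hB
  have hB0 : 0 ≤ B := tsum_nonneg fun k => by positivity
  set K := Real.sqrt (B * (A * C * 2 ^ s)) with hK
  refine ⟨K.toNNReal, fun f => iSup₂_le fun r hr => le_of_sq_le_sq_ennreal ?_⟩
  change _ ≤ (ENNReal.ofReal K * _) ^ 2
  set Y : ℕ → C(Sph n, ℂ) := fun k => harmonicPart n k (restrictSphere f r) with hY
  have h1 : restrictSphere f r = ∑' k, Y k := by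
    conv_lhs => rw [← angularMult_one f r]
    exact tsum_congr fun k => one_smul ℂ (Y k)
  have h2 : sphereNorm ∞ f r ≤ ∑' k, ‖Y k‖ₑ := by
    refine (sphereNorm_top_le f r).trans ?_
    rw [h1]
    exact enorm_tsum_le_tsum_enorm (f := Y)
  have hpw : ∀ (k : ℕ) (t : ℝ), ((k + 1 : ℝ) ^ (t / 2)) ^ 2 = (k + 1 : ℝ) ^ t := by
    intro k t
    rw [← Real.rpow_natCast, ← Real.rpow_mul (by positivity)]
    congr 1
    push_cast
    ring
  have h3 : (∑' k, ‖Y k‖ₑ) ^ 2 ≤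
      ENNReal.ofReal B * ∑' k : ℕ, ENNReal.ofReal ((k + 1 : ℝ) ^ (-e)) * ‖Y k‖ₑ ^ 2 := by
    have h4 := sq_tsum_mul_le (fun k : ℕ => ENNReal.ofReal ((k + 1 : ℝ) ^ (e / 2)))
      (fun k => ENNReal.ofReal ((k + 1 : ℝ) ^ (-e / 2)) * ‖Y k‖ₑ)
    have h5 : ∀ k : ℕ, ENNReal.ofReal ((k + 1 : ℝ) ^ (e / 2)) *
        (ENNReal.ofReal ((k + 1 : ℝ) ^ (-e / 2)) * ‖Y k‖ₑ) = ‖Y k‖ₑ := by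
      intro k
      rw [← mul_assoc, ← ENNReal.ofReal_mul (by positivity), ← Real.rpow_add (by positivity),
        show e / 2 + -e / 2 = 0 by ring, Real.rpow_zero, ENNReal.ofReal_one, one_mul]
    simp only [h5, mul_pow _ _ 2, ← ENNReal.ofReal_pow (Real.rpow_nonneg (Nat.cast_add_one_pos _).le _),
      hpw] at h4
    rwa [← ENNReal.ofReal_tsum_of_nonneg (fun k => by positivity) hsum] at h4
  have hr2 : (r ^ ((n - b) / 2)) ^ 2 = (r ^ (b - n))⁻¹ := by
    rw [← Real.rpow_neg hr.le, ← Real.rpow_natCast, ← Real.rpow_mul hr.le]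
    congr 1
    push_cast
    ring
  calc _ ≤ (ENNReal.ofReal (r ^ (((n : ℝ) - b) / 2)) * ∑' k, ‖Y k‖ₑ) ^ 2 :=
        pow_le_pow_left' (mul_le_mul' le_rfl h2) 2
    _ ≤ ENNReal.ofReal (r ^ (b - n))⁻¹ *
        (ENNReal.ofReal B * ∑' k : ℕ, ENNReal.ofReal ((k + 1 : ℝ) ^ (-e)) * ‖Y k‖ₑ ^ 2) := by
        rw [mul_pow, ← ENNReal.ofReal_pow (by positivity), hr2]
        exact mul_le_mul' le_rfl h3
    _ = ENNReal.ofReal B * ∑' k : ℕ,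
        ENNReal.ofReal (r ^ (b - n))⁻¹ * (ENNReal.ofReal ((k + 1 : ℝ) ^ (-e)) * ‖Y k‖ₑ ^ 2) := by
        rw [ENNReal.tsum_mul_left]
        ring
    _ ≤ ENNReal.ofReal B * ∑' k : ℕ, ENNReal.ofReal (A * C * 2 ^ s) *
        (ENNReal.ofReal ((1 + sphEigenvalue n k) ^ s) * harmonicEnergy b (𝓕 f) k) := by
        refine mul_le_mul' le_rfl (ENNReal.tsum_le_tsum fun k => ?_)
        have hk := sphEigenvalue_nonneg n k
        have h6 : ‖Y k‖ₑ ^ 2 ≤ ENNReal.ofReal (A * (k + 1 : ℝ) ^ (n - 2)) *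
            (ENNReal.ofReal (C * (k + 1 : ℝ) ^ (1 - b) * r ^ (b - n)) *
              harmonicEnergy b (𝓕 f) k) := by
          refine le_trans ?_ (mul_le_mul' le_rfl (h f k r hr))
          rw [← ENNReal.ofReal_mul (by positivity), ← ofReal_norm,
            ← ENNReal.ofReal_pow (norm_nonneg _)]
          exact ENNReal.ofReal_le_ofReal (hA' k _ (harmonicPart_mem k _))
        refine (mul_le_mul' le_rfl (mul_le_mul' le_rfl h6)).trans ?_
        simp only [← mul_assoc]
        refine mul_le_mul' ?_ le_rfl
        have hrr : 0 < r ^ (b - n) := by positivity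
        rw [← ENNReal.ofReal_mul (by positivity), ← ENNReal.ofReal_mul (by positivity),
          ← ENNReal.ofReal_mul (by positivity), ← ENNReal.ofReal_mul (by positivity)]
        refine ENNReal.ofReal_le_ofReal ?_
        have h7 := le_one_add_sphEigenvalue_rpow (n := n) hs0.le k
        have h8 : (k + 1 : ℝ) ^ (-e) * (k + 1 : ℝ) ^ (n - 2) * (k + 1 : ℝ) ^ (1 - b) =
            (k + 1 : ℝ) ^ (2 * s) := by
          rw [← Real.rpow_natCast, ← Real.rpow_add (by positivity), ← Real.rpow_add (by positivity),
            Nat.cast_sub hn]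
          congr 1
          push_cast
          rw [he]
          ring
        calc _ = A * C * ((k + 1 : ℝ) ^ (-e) * (k + 1 : ℝ) ^ (n - 2) * (k + 1 : ℝ) ^ (1 - b)) := by
              field_simp
          _ ≤ A * C * (2 ^ s * (1 + sphEigenvalue n k) ^ s) := by
              rw [h8]
              gcongr
          _ = _ := by ring
    _ ≤ _ := by
        rw [ENNReal.tsum_mul_left, ← mul_assoc, ← ENNReal.ofReal_mul hB0, mul_pow,
          ← ENNReal.ofReal_pow (Real.sqrt_nonneg _), Real.sq_sqrt (by positivity)]
        exact mul_le_mul' le_rfl (tsum_harmonicEnergy_le_eLpNorm_sq (by linarith) s f)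

end Comparison

end AngularSobolev

end

theorem corollary1p2 (n : ℕ) (hn : 2 ≤ n) (b : ℝ) (hb1 : 1 < b) (hbn : b < n) :
    (∃ C : ℝ≥0, ∀ f : 𝓢(AngularSobolev.Eucl n, ℂ),
      (⨆ (r : ℝ) (_ : 0 < r),
          ENNReal.ofReal (r ^ (((n : ℝ) - b) / 2)) * AngularSobolev.sphereNorm 2 f r) ≤
        C * eLpNorm (AngularSobolev.fracD (b / 2)
          (AngularSobolev.angularPow ((1 - b) / 2) f)) 2 volume) ∧
    (∃ C : ℝ≥0, ∀ f : 𝓢(AngularSobolev.Eucl n, ℂ),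
      eLpNorm (AngularSobolev.fracD (-b / 2)
          (AngularSobolev.angularPow ((b - 1) / 2) f)) 2 volume ≤
        C * AngularSobolev.mixedNorm
          (fun x => ((‖x‖ ^ ((b - (n : ℝ)) / 2) : ℝ) : ℂ) * f x)) ∧
    (∀ s : ℝ, ((n : ℝ) - b) / 2 < s →
      ∃ C : ℝ≥0, ∀ f : 𝓢(AngularSobolev.Eucl n, ℂ),
        (⨆ (r : ℝ) (_ : 0 < r),
            ENNReal.ofReal (r ^ (((n : ℝ) - b) / 2)) * AngularSobolev.sphereNorm ∞ f r) ≤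
          C * eLpNorm (AngularSobolev.fracD (b / 2)
            (AngularSobolev.angularPow s f)) 2 volume) := by
  have : Fact (2 ≤ n) := ⟨hn⟩
  exact ⟨AngularSobolev.exists_sphereNorm_two_le hb1 hbn,
    AngularSobolev.exists_eLpNorm_le_mixedNorm hb1 hbn,
    fun _ hs => AngularSobolev.exists_sphereNorm_top_le hb1 hbn hs⟩
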